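/- Let $n\ge 1$. An $n\times n$ input-queued switch has queue lengths $q_{ij}(t)\in\mathbb Z_{\ge 0}$, $1\le i,j\le n$, $t=0,1,2,\dots$ In each slot a (possibly randomized) scheduling policy picks, on the basis of $\mathbf q(t)$ only, a schedule $\mathbf s(t)\in\{0,1\}^{n\times n}$ with all row and column sums at most $1$; then packets $a_{ij}(t)$ arrive, and $q_{ij}(t+1)=[q_{ij}(t)+a_{ij}(t)-s_{ij}(t)]^+$. For $0<\epsilon<1$ consider the switch with Bernoulli arrivals of rate $(1-\epsilon)/n$ to every queue, independent over $i,j,t$ and of the queue lengths and schedules up to and including slot $t$. A policy is stable if $\limsup_{C\to\infty}\limsup_{t\to\infty}P(\sum_{ij}q_{ij}(t)\ge C)=0$. The MaxWeight policy picks a perfect matching (permutation matrix) $\mathbf s$ maximizing $\sum_{ij}q_{ij}(t)s_{ij}$, ties being broken uniformly at random. Let $\mathcal K\subset\mathbb R^{n\times n}$ be the cone of matrices $(w_i+\widetilde w_j)_{ij}$ with $w_i,\widetilde w_j\ge 0$; for $\mathbf x\in\mathbb R^{n\times n}$ let $\mathbf x_\parallel$ be its Euclidean projection onto $\mathcal K$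 and $\mathbf x_\perp=\mathbf x-\mathbf x_\parallel$. (1) Fix a policy under which the switch is stable for every $0<\epsilon<1$, and suppose that its queue length process converges in distribution to a random vector $\overline{\mathbf q}^{(\epsilon)}$. Then for each $0<\epsilon<1$ $$E\Big[\sum_{ij}\overline q_{ij}^{(\epsilon)}\Big]\ge\frac{(1-\epsilon)^2}{2\epsilon}(n-1),\qquad\text{and}\qquad \liminf_{\epsilon\downarrow0}\epsilon\,E\Big[\sum_{ij}\overline q_{ij}^{(\epsilon)}\Big]\ge\frac{n-1}{2}.$$ (2) Under MaxWeight, for each $0<\epsilon<1$ the queue length process (on the states reachable from the empty switch) is positive recurrent, and from any initial law it converges in distribution to a steady state vector $\overline{\mathbf q}^{(\epsilon)}$. For $0<\epsilon\le 1/(2n)$, $$E\big[\|\overline{\mathbf q}^{(\epsilon)}_\perp\|^r\big]\le(\widetilde M_r)^r\quad\text{for all } r\in\{1,2,\dots\},\qquad \widetilde M_r=(2\sqrt r\,e)^{1/r}\,16\,\frac re\,n^2(n+1),$$ and for every $r\in\{2,3,\dots\}$ $$\frac1\epsilon\Big(n-\frac32+\frac1{2n}\Big)-\widetilde B_1(\epsilon,n)\le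 E\Big[\sum_{ij}\overline q^{(\epsilon)}_{ij}\Big]\le\frac1\epsilon\Big(n-\frac32+\frac1{2n}\Big)+\widetilde B_2(\epsilon,n),$$ where $$\widetilde B_1(\epsilon,n)=\Big(1-\frac\epsilon2\Big)\Big(n-2+\frac1n\Big)+n-\frac12+3n^{2-1/r}\epsilon^{-1/r}\widetilde M_r,$$ $$\widetilde B_2(\epsilon,n)=-\Big(1-\frac\epsilon2\Big)\Big(n-2+\frac1n\Big)+\frac{n+1}2+2n^{2-1/r}\epsilon^{-1/r}\widetilde M_r,$$ and both $\widetilde B_1(\epsilon,n)$ and $\widetilde B_2(\epsilon,n)$ are $o(1/\epsilon)$ as $\epsilon\downarrow0$. Hence $$\lim_{\epsilon\downarrow0}\epsilon\,E\Big[\sum_{ij}\overline q^{(\epsilon)}_{ij}\Big]=n-\frac32+\frac1{2n}.$$ (3) MaxWeight has optimal queue length scaling in heavy traffic: the limit in (2) is at most twice the $\liminf$ in (1) for any policy as in (1), and strictly less than twice it if $n\ge2$. -/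

import Mathlib

open MeasureTheory Filter Topology Asymptotics
open scoped ENNReal

noncomputable section

namespace Switch

/-! ## The input-queued switch -/

/-- Queue length vectors of an `n × n` switch: `q (i, j)` is the number of packets at input port
`i` destined to output port `j`. -/
abbrev State (n : ℕ) : Type := Fin n × Fin n → ℕ

/-- The total queue length `∑ᵢⱼ qᵢⱼ`. -/
def total {n : ℕ} (q : State n) : ℕ := ∑ ij, q ij

/-- Feasible schedules: `0`-`1` matrices with all row and column sums at most one (matchings of
the complete bipartite graph between input and output ports). -/
def Schedule (n : ℕ) : Type :=
  {s : Fin n × Fin n → ℕ // (∀ ij, s ij = 0 ∨ s ij = 1) ∧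
    (∀ i, ∑ j, s (i, j) ≤ 1) ∧ (∀ j, ∑ i, s (i, j) ≤ 1)}

/-- A (possibly randomized) scheduling policy chooses a schedule on the basis of the current
queue length vector. -/
def Policy (n : ℕ) : Type := State n → PMF (Schedule n)

/-- The arrival rate `(1 - ε) / n` of each queue, as a point of `[0, 1]`. (The truncation to
`[0, 1]` does nothing for `0 ≤ ε ≤ 1` and `1 ≤ n`.) -/
def rate (n : ℕ) (ε : ℝ) : unitInterval :=
  Set.projIcc 0 1 zero_le_one ((1 - ε) / n)

/-- The point mass function of a Bernoulli variable with parameter `p`. -/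
def bernoulliWeight (p : unitInterval) (b : Bool) : ℝ≥0∞ :=
  if b then ENNReal.ofReal p else ENNReal.ofReal (1 - p)

theorem sum_bernoulliWeight (p : unitInterval) : ∑ b, bernoulliWeight p b = 1 := by
  simp only [bernoulliWeight, Fintype.sum_bool, if_true, Bool.false_eq_true, if_false]
  rw [← ENNReal.ofReal_add p.2.1 (by linarith [p.2.2])]
  simp

/-- The law of the arrival vector in one time slot: independent Bernoulli variables with
parameter `p`, one for each input-output pair. -/
def arrivalLaw (n : ℕ) (p : unitInterval) : PMF (Fin n × Fin n → Bool) :=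
  PMF.ofFintype (fun a => ∏ ij, bernoulliWeight p (a ij)) (by
    have h := Finset.prod_univ_sum (fun _ : Fin n × Fin n => (Finset.univ : Finset Bool))
      (fun _ b => bernoulliWeight p b)
    simp only [sum_bernoulliWeight, Finset.prod_const_one, Fintype.piFinset_univ] at h
    exact h.symm)

/-- One slot of queue dynamics: `q ↦ [q + a - s]⁺`, where truncated subtraction of natural numbers
is the positive part. -/
def next {n : ℕ} (q : State n) (a : Fin n × Fin n → Bool) (s : Schedule n) : State n :=
  fun ij => q ij + (a ij).toNat - s.1 ij

/-- The transition law of the queue length chain: the schedule is chosen from the current queue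
lengths, and the arrivals are independent of the queue lengths and of the schedule. -/
def step {n : ℕ} (ε : ℝ) (P : Policy n) (q : State n) : PMF (State n) :=
  (P q).bind fun s => (arrivalLaw n (rate n ε)).map fun a => next q a s

/-! ## Markov chains on a countable set -/

section Chain

variable {S : Type*}

/-- The law at time `t` of the Markov chain with transition law `K` and initial law `μ₀`. -/
def law (K : S → PMF S) (μ₀ : PMF S) : ℕ → PMF S
  | 0 => μ₀
  | t + 1 => (law K μ₀ t).bind K

/-- `μ` is a stationary law of the chain. -/
def IsStationary (K : S → PMF S) (μ : PMF S) : Prop := μ.bind K = μ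

/-- `y` can be reached from `x` in finitely many (possibly zero) steps. -/
def Reachable (K : S → PMF S) : S → S → Prop :=
  Relation.ReflTransGen fun x y => K x y ≠ 0

open Classical in
/-- `avoid K x t y` is the probability that the chain started from `y` does not visit `x` at any
of the times `1, …, t`. -/
def avoid (K : S → PMF S) (x : S) : ℕ → S → ℝ≥0∞
  | 0, _ => 1
  | t + 1, y => ∑' z, K y z * (if z = x then 0 else avoid K x t z)

/-- The mean return time to `x`, that is, `∑_{t ≥ 0} P_x (return time > t)`. -/
def meanReturnTime (K : S → PMF S) (x : S) : ℝ≥0∞ := ∑' t, avoid K x t x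

/-- The chain, on the state space of all states that can be reached from `x₀`, is positive
recurrent: from every state of it, the mean return time is finite. -/
def IsPositiveRecurrentFrom (K : S → PMF S) (x₀ : S) : Prop :=
  ∀ x, Reachable K x₀ x → meanReturnTime K x < ∞

end Chain

/-- A process with laws `μ t` on queue length vectors is stable:
`limsup_{C → ∞} limsup_{t → ∞} P (∑ᵢⱼ qᵢⱼ(t) ≥ C) = 0`. -/
def IsStable {n : ℕ} (μ : ℕ → PMF (State n)) : Prop :=
  limsup (fun C : ℕ => limsup (fun t : ℕ => (μ t).toMeasure {q | C ≤ total q}) atTop) atTop = 0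

/-- A law on queue length vectors as a Mathlib probability measure. -/
def toProb {n : ℕ} (μ : PMF (State n)) : ProbabilityMeasure (State n) :=
  ⟨μ.toMeasure, PMF.toMeasure.isProbabilityMeasure μ⟩

/-- Convergence in distribution (weak convergence of the laws). -/
def ConvergesInDistribution {n : ℕ} (μ : ℕ → PMF (State n)) (π : PMF (State n)) : Prop :=
  Tendsto (fun t => toProb (μ t)) atTop (𝓝 (toProb π))

/-- The mean total queue length `E[∑ᵢⱼ qᵢⱼ] ∈ [0, ∞]` under the law `π`. -/
def meanTotal {n : ℕ} (π : PMF (State n)) : ℝ≥0∞ := ∫⁻ q, (total q : ℝ≥0∞) ∂π.toMeasure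

/-! ## MaxWeight -/

/-- The weight of the perfect matching `σ`. -/
def weight {n : ℕ} (q : State n) (σ : Equiv.Perm (Fin n)) : ℕ := ∑ i, q (i, σ i)

/-- The perfect matchings of maximum weight. -/
def maxWeightPerms {n : ℕ} (q : State n) : Finset (Equiv.Perm (Fin n)) :=
  Finset.univ.filter fun σ => ∀ τ, weight q τ ≤ weight q σ

theorem maxWeightPerms_nonempty {n : ℕ} (q : State n) : (maxWeightPerms q).Nonempty := by
  obtain ⟨σ, -, hσ⟩ := Finset.exists_max_image (Finset.univ : Finset (Equiv.Perm (Fin n)))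
    (weight q) Finset.univ_nonempty
  exact ⟨σ, by simpa [maxWeightPerms] using fun τ => hσ τ (Finset.mem_univ τ)⟩

/-- The (maximal) schedule that serves the links `(i, σ i)`. -/
def permSchedule {n : ℕ} (σ : Equiv.Perm (Fin n)) : Schedule n :=
  ⟨fun ij => if σ ij.1 = ij.2 then 1 else 0,
    fun ij => by by_cases h : σ ij.1 = ij.2 <;> simp [h],
    fun i => by simp,
    fun j => by simp [← Equiv.eq_symm_apply]⟩

/-- The MaxWeight policy: a maximal schedule (perfect matching) of maximum weight, ties being
broken uniformly at random. -/
def maxWeight (n : ℕ) : Policy n := fun q =>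
  (PMF.uniformOfFinset (maxWeightPerms q) (maxWeightPerms_nonempty q)).map permSchedule

/-- A perfect matching of maximum weight has maximum weight among all feasible schedules. -/
theorem weight_schedule_le {n : ℕ} (q : State n) (s : Schedule n) {σ : Equiv.Perm (Fin n)}
    (hσ : σ ∈ maxWeightPerms q) : ∑ ij, q ij * s.1 ij ≤ ∑ ij, q ij * (permSchedule σ).1 ij := by
  classical
  obtain ⟨s, h01, hr, hc⟩ := s
  have row : ∀ i j k, s (i, j) = 1 → s (i, k) = 1 → j = k := by
    intro i j k hj hk
    by_contra hne
    have h := Finset.add_le_sum (f := fun j => s (i, j)) (fun _ _ => Nat.zero_le _)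
      (Finset.mem_univ j) (Finset.mem_univ k) hne
    have h' := hr i
    simp only [hj, hk] at h
    omega
  have col : ∀ i k j, s (i, j) = 1 → s (k, j) = 1 → i = k := by
    intro i k j hj hk
    by_contra hne
    have h := Finset.add_le_sum (f := fun i => s (i, j)) (fun _ _ => Nat.zero_le _)
      (Finset.mem_univ i) (Finset.mem_univ k) hne
    have h' := hc j
    simp only [hj, hk] at h
    omega
  let p : Fin n → Prop := fun i => ∃ j, s (i, j) = 1
  let f : {i // p i} → Fin n := fun i => i.2.choose
  have hf : ∀ i : {i // p i}, s (i.1, f i) = 1 := fun i => i.2.choose_spec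
  have finj : Function.Injective f := fun i k h =>
    Subtype.ext (col _ _ (f i) (hf i) (h ▸ hf k))
  let τ : Equiv.Perm (Fin n) := (Equiv.ofInjective f finj).extendSubtype
  have hτ : ∀ ij, s ij ≤ (permSchedule τ).1 ij := by
    rintro ⟨i, j⟩
    rcases h01 (i, j) with h | h
    · rw [h]; exact Nat.zero_le _
    · have hi : p i := ⟨j, h⟩
      have e : τ i = j := by
        have := (Equiv.ofInjective f finj).extendSubtype_apply_of_mem i hi
        rw [show τ i = _ from this]
        exact row i _ _ (hf ⟨i, hi⟩) h
      simp [permSchedule, e, h]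
  have hw : ∀ ρ : Equiv.Perm (Fin n), ∑ ij, q ij * (permSchedule ρ).1 ij = weight q ρ := by
    intro ρ
    simp [permSchedule, weight, Fintype.sum_prod_type]
  calc ∑ ij, q ij * s ij ≤ ∑ ij, q ij * (permSchedule τ).1 ij :=
        Finset.sum_le_sum fun ij _ => Nat.mul_le_mul_left _ (hτ ij)
    _ = weight q τ := hw τ
    _ ≤ weight q σ := by
        have h := hσ
        simp only [maxWeightPerms, Finset.mem_filter, Finset.mem_univ, true_and] at h
        exact h τ
    _ = _ := (hw σ).symm

/-! ## The cone and the projection onto it -/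

/-- The space of real `n × n` matrices with the Euclidean norm. -/
abbrev Vec (n : ℕ) : Type := EuclideanSpace ℝ (Fin n × Fin n)

/-- The matrix whose `i`-th row consists of ones, all other entries being zero. -/
def rowVec {n : ℕ} (i : Fin n) : Vec n := WithLp.toLp 2 fun ij => if ij.1 = i then 1 else 0

/-- The matrix whose `j`-th column consists of ones, all other entries being zero. -/
def colVec {n : ℕ} (j : Fin n) : Vec n := WithLp.toLp 2 fun ij => if ij.2 = j then 1 else 0

/-- The cone spanned by the vectors `rowVec i` and `colVec j`. -/
def cone (n : ℕ) : Set (Vec n) :=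
  {x | ∃ w v : Fin n → ℝ, (∀ i, 0 ≤ w i) ∧ (∀ j, 0 ≤ v j) ∧
    x = ∑ i, w i • rowVec i + ∑ j, v j • colVec j}

theorem mem_cone_iff {n : ℕ} (x : Vec n) :
    x ∈ cone n ↔ (∀ ij, 0 ≤ x ij) ∧
      ∀ i j k l, x (i, j) + x (k, l) = x (i, l) + x (k, j) := by
  have key : ∀ (w v : Fin n → ℝ) (i j : Fin n),
      (∑ i, w i • rowVec i + ∑ j, v j • colVec j : Vec n) (i, j) = w i + v j := by
    intro w v i j
    simp [rowVec, colVec]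
  constructor
  · rintro ⟨w, v, hw, hv, rfl⟩
    refine ⟨fun ⟨i, j⟩ => ?_, fun i j k l => ?_⟩
    · rw [key]; exact add_nonneg (hw i) (hv j)
    · simp only [key]; ring
  · rintro ⟨h0, h⟩
    rcases n with _ | n
    · refine ⟨0, 0, by simp, by simp, ?_⟩
      ext ⟨i, -⟩
      exact i.elim0
    · obtain ⟨k, -, hk⟩ := Finset.exists_min_image (Finset.univ : Finset (Fin (n + 1)))
        (fun i => x (i, 0)) Finset.univ_nonempty
      refine ⟨fun i => x (i, 0) - x (k, 0), fun j => x (k, j),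
        fun i => sub_nonneg.2 (hk i (Finset.mem_univ i)), fun j => h0 _, ?_⟩
      ext ⟨i, j⟩
      rw [key]
      linarith [h i j k 0]

theorem isClosed_cone (n : ℕ) : IsClosed (cone n) := by
  have h : cone n = {x : Vec n | (∀ ij, 0 ≤ x ij) ∧
      ∀ i j k l, x (i, j) + x (k, l) = x (i, l) + x (k, j)} := by
    ext x; exact mem_cone_iff x
  rw [h]
  simp only [Set.ofPred_and, Set.ofPred_forall]
  refine IsClosed.inter (isClosed_iInter fun ij => isClosed_le (by fun_prop) (by fun_prop)) ?_
  exact isClosed_iInter fun i => isClosed_iInter fun j => isClosed_iInter fun k =>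
    isClosed_iInter fun l => isClosed_eq (by fun_prop) (by fun_prop)

theorem exists_proj {n : ℕ} (x : Vec n) :
    ∃ y ∈ cone n, ∀ z ∈ cone n, ‖x - y‖ ≤ ‖x - z‖ := by
  obtain ⟨y, hy, h⟩ := (isClosed_cone n).exists_infDist_eq_dist
    ⟨0, 0, 0, by simp, by simp, by simp⟩ x
  refine ⟨y, hy, fun z hz => ?_⟩
  rw [← dist_eq_norm, ← dist_eq_norm, ← h]
  exact Metric.infDist_le_dist_of_mem hz

/-- The projection `x∥` of `x` onto the cone: the point of the cone closest to `x`. -/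
def para {n : ℕ} (x : Vec n) : Vec n := (exists_proj x).choose

/-- `x⊥ = x - x∥`. -/
def perp {n : ℕ} (x : Vec n) : Vec n := x - para x

/-- A queue length vector as a point of Euclidean space. -/
def toVec {n : ℕ} (q : State n) : Vec n := WithLp.toLp 2 fun ij => (q ij : ℝ)

/-! ## The constants -/

/-- The constant `M̃_r = (2 √r e)^{1/r} · 16 (r/e) n² (n + 1)`. -/
def Mconst (n r : ℕ) : ℝ :=
  (2 * √(r : ℝ) * Real.exp 1) ^ (1 / (r : ℝ)) * 16 * ((r : ℝ) / Real.exp 1) * (n : ℝ) ^ 2 *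
    ((n : ℝ) + 1)

/-- The error term `B̃₁(ε, n)` of the lower bound. -/
def B₁ (n r : ℕ) (ε : ℝ) : ℝ :=
  (1 - ε / 2) * ((n : ℝ) - 2 + 1 / (n : ℝ)) + (n : ℝ) - 1 / 2 +
    3 * (n : ℝ) ^ (2 - 1 / (r : ℝ)) * ε ^ (-(1 / (r : ℝ))) * Mconst n r

/-- The error term `B̃₂(ε, n)` of the upper bound. -/
def B₂ (n r : ℕ) (ε : ℝ) : ℝ :=
  -(1 - ε / 2) * ((n : ℝ) - 2 + 1 / (n : ℝ)) + ((n : ℝ) + 1) / 2 +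
    2 * (n : ℝ) ^ (2 - 1 / (r : ℝ)) * ε ^ (-(1 / (r : ℝ))) * Mconst n r

/-- The heavy-traffic constant `n - 3/2 + 1/(2n)`. -/
def heavyTrafficConst (n : ℕ) : ℝ := (n : ℝ) - 3 / 2 + 1 / (2 * (n : ℝ))

end Switch

end

/-! Both halves test stationarity against a quadratic function of the queue lengths: in steady state
its mean drift vanishes, and the drift contains -2ε times a queue length.

Lower bound. A limit in distribution is stationary (`isStationary_of_tendsto`). An input port
receives a binomial number A of packets per slot, of mean 1 - ε, and sends at most one, so under any
policy its load satisfies R' ≥ R + A - 1. The drift of R(R + 1) is therefore at least -2εR + (1 -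
ε)²(1 - 1/n), which bounds the mean of R from below; summing over the n ports gives the claim.
Second moments may be infinite, so R(R + 1) is continued linearly beyond a level that then tends to
infinity (`le_arrivalMean_truncSq`, `le_integral_rowSum`).

Drift under MaxWeight. By Birkhoff's theorem the chosen matching beats every doubly substochastic
matrix (`sum_mul_le_of_substochastic`). Comparison with the constant matrix 1/n gives ‖q‖² a drift
of order -ε‖q‖. Comparison with 1/n plus a small multiple of q⊥, whose row and column sums are
nonpositive because q⊥ lies in the polar cone, gives ‖q⊥‖² a drift of order -‖q⊥‖ uniformly in ε.
With bounded increments, either quadratic drift makes exp(θh) - θh a geometric Lyapunov function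
(`HasDrift`). For h = ‖q‖ this, together with the chance of emptying the switch when no packet
arrives, feeds a Harris-type contraction in a weighted discrete distance, hence existence of a
stationary law and convergence to it. For h = ‖q⊥‖ it gives the moment bounds of the state space
collapse.

Heavy traffic. The test function `quad` is n‖Pq‖², with P the orthogonal projection onto the span of
the cone. Full service along any perfect matching has the same row and column sums, so arrivals and
full service contribute exactly -2ε ∑q plus a constant tending to (2n - 1)(1 - 1/n), the variance n
· p(1 - p) times the dimension 2n - 1 of the span; half of it is the heavy-traffic constant. The
rest involves the unused service u, of mean total nε. Since u vanishes wherever the new queue q' is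
nonzero, its inner product with nPq' only sees q'⊥, and a linearized Hölder inequality against the
moments of q'⊥ makes it of lower order (`abs_sum_unused_mul_spanMap_le`, `sqrt_mul_le`,
`stationary_quad_le`). -/

namespace Switch

open scoped NNReal

/-! ## Expectations under probability mass functions -/

section Expect

variable {α β : Type*}

/-- The expectation of a `[0, ∞]`-valued function. -/
noncomputable def expect (p : PMF α) (F : α → ℝ≥0∞) : ℝ≥0∞ := ∑' x, p x * F x

theorem expect_mono_of_mem_support {p : PMF α} {F G : α → ℝ≥0∞}
    (h : ∀ x ∈ p.support, F x ≤ G x) : expect p F ≤ expect p G := by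
  refine ENNReal.tsum_le_tsum fun x => ?_
  by_cases hx : x ∈ p.support
  · gcongr
    exact h x hx
  · simp [(p.apply_eq_zero_iff x).2 hx]

theorem expect_mono {p : PMF α} {F G : α → ℝ≥0∞} (h : ∀ x, F x ≤ G x) :
    expect p F ≤ expect p G :=
  expect_mono_of_mem_support fun x _ => h x

theorem expect_const (p : PMF α) (c : ℝ≥0∞) : expect p (fun _ => c) = c := by
  simp [expect, ENNReal.tsum_mul_right, p.tsum_coe]

theorem expect_add (p : PMF α) (F G : α → ℝ≥0∞) :
    expect p (fun x => F x + G x) = expect p F + expect p G := by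
  simp [expect, mul_add, ENNReal.tsum_add]

theorem expect_const_mul (p : PMF α) (c : ℝ≥0∞) (F : α → ℝ≥0∞) :
    expect p (fun x => c * F x) = c * expect p F := by
  simp only [expect, ← ENNReal.tsum_mul_left]
  exact tsum_congr fun x => by ring

theorem expect_sum {ι : Type*} (s : Finset ι) (p : PMF α) (F : ι → α → ℝ≥0∞) :
    expect p (fun x => ∑ i ∈ s, F i x) = ∑ i ∈ s, expect p (F i) := by
  classical
  induction s using Finset.induction_on with
  | empty => simp [expect]
  | insert i s hi ih => simp only [Finset.sum_insert hi, expect_add, ih]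

theorem expect_pure (a : α) (F : α → ℝ≥0∞) : expect (PMF.pure a) F = F a := by
  classical
  rw [expect, tsum_eq_single a (fun b hb => by simp [PMF.pure_apply, hb])]
  simp

theorem expect_bind (p : PMF α) (K : α → PMF β) (F : β → ℝ≥0∞) :
    expect (p.bind K) F = expect p fun x => expect (K x) F := by
  simp only [expect, PMF.bind_apply, ← ENNReal.tsum_mul_right, ← ENNReal.tsum_mul_left]
  rw [ENNReal.tsum_comm]
  simp only [mul_assoc]

theorem expect_map (p : PMF α) (f : α → β) (F : β → ℝ≥0∞) :
    expect (p.map f) F = expect p fun x => F (f x) := by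
  rw [← PMF.bind_pure_comp, expect_bind]
  simp [expect_pure]

theorem expect_fintype [Fintype α] (p : PMF α) (F : α → ℝ≥0∞) :
    expect p F = ∑ x, p x * F x := tsum_fintype _

open Classical in
theorem expect_ite (p : PMF α) (a : α) : expect p (fun x => if x = a then 1 else 0) = p a := by
  rw [expect, tsum_eq_single a (fun b hb => by simp [hb])]
  simp

theorem apply_mul_le_expect (p : PMF α) (F : α → ℝ≥0∞) (x : α) : p x * F x ≤ expect p F :=
  ENNReal.le_tsum x

theorem lintegral_toMeasure [MeasurableSpace α] [Countable α] [MeasurableSingletonClass α]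
    (p : PMF α) (F : α → ℝ≥0∞) : ∫⁻ x, F x ∂p.toMeasure = expect p F := by
  rw [lintegral_countable']
  exact tsum_congr fun x => by
    rw [PMF.toMeasure_apply_singleton _ _ (measurableSet_singleton x), mul_comm]

theorem tendsto_expect_of_dominated [Countable α] (p : PMF α) {F : ℕ → α → ℝ≥0∞}
    {f : α → ℝ≥0∞} (b : α → ℝ≥0∞) (hb : ∀ t x, F t x ≤ b x) (hfin : expect p b ≠ ∞)
    (h : ∀ x, Tendsto (fun t => F t x) atTop (𝓝 (f x))) :
    Tendsto (fun t => expect p (F t)) atTop (𝓝 (expect p f)) := by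
  let _ : MeasurableSpace α := ⊤
  simp only [← lintegral_toMeasure] at hfin ⊢
  exact tendsto_lintegral_of_dominated_convergence b (fun t => measurable_from_top)
    (fun t => ae_of_all _ (hb t)) hfin (ae_of_all _ h)

/-- Equal total mass leaves no room for strict inequality. This reduces stationarity to the
one-sided bound that limits of finite partial sums provide. -/
theorem pmf_eq_of_le {p q : PMF α} (h : ∀ x, p x ≤ q x) : p = q := by
  refine PMF.ext fun x => le_antisymm (h x) ?_
  by_contra hlt
  have := ENNReal.tsum_lt_tsum (p.tsum_coe_ne_top) h (not_le.1 hlt)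
  rw [p.tsum_coe, q.tsum_coe] at this
  exact lt_irrefl _ this

end Expect

/-! ## Markov chains -/

section Chain

variable {S : Type*} {K : S → PMF S}

theorem expect_law_add (K : S → PMF S) (μ : PMF S) (s t : ℕ) (F : S → ℝ≥0∞) :
    expect (law K μ (s + t)) F =
      expect (law K μ s) fun x => expect (law K (PMF.pure x) t) F := by
  induction t generalizing F with
  | zero => simp [law, expect_pure]
  | succ t ih =>
    rw [← add_assoc]
    simp only [law, expect_bind]
    exact ih _

theorem expect_law_succ (K : S → PMF S) (x : S) (t : ℕ) (F : S → ℝ≥0∞) :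
    expect (law K (PMF.pure x) (t + 1)) F =
      expect (K x) fun y => expect (law K (PMF.pure y) t) F := by
  rw [add_comm, expect_law_add]
  simp [law, PMF.pure_bind]

theorem expect_law_eq (K : S → PMF S) (μ : PMF S) (t : ℕ) (F : S → ℝ≥0∞) :
    expect (law K μ t) F = expect μ fun x => expect (law K (PMF.pure x) t) F := by
  simpa [law] using expect_law_add K μ 0 t F

theorem IsStationary.law_eq {π : PMF S} (h : IsStationary K π) (t : ℕ) : law K π t = π := by
  induction t with
  | zero => rfl
  | succ t ih => rw [law, ih]; exact h

theorem IsStationary.expect_step {π : PMF S} (h : IsStationary K π) (F : S → ℝ≥0∞) :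
    (expect π fun x => expect (K x) F) = expect π F := by
  rw [← expect_bind, h]

theorem IsStationary.expect_law {π : PMF S} (h : IsStationary K π) (t : ℕ) (F : S → ℝ≥0∞) :
    (expect π fun x => expect (law K (PMF.pure x) t) F) = expect π F := by
  rw [← expect_law_eq, h.law_eq]

/-- A Foster–Lyapunov bound on stationary expectations, without integrability assumptions. -/
theorem IsStationary.expect_le_of_drift [Countable S] {π : PMF S} (hπ : IsStationary K π)
    {F G : S → ℝ≥0∞} {b : ℝ≥0∞} (hF : ∀ x, F x ≠ ∞)
    (h : ∀ x, expect (K x) F + G x ≤ F x + b) : expect π G ≤ b := by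
  -- The drift inequality is telescoped from a deterministic start, where F is finite; F need not be
  -- integrable under π.
  have sum_le : ∀ (N : ℕ) x, expect (law K (PMF.pure x) N) F +
      ∑ t ∈ Finset.range N, expect (law K (PMF.pure x) t) G ≤ F x + N * b := by
    intro N x
    induction N with
    | zero => simp [law, expect_pure]
    | succ N ih =>
      have e : expect (law K (PMF.pure x) (N + 1)) F + expect (law K (PMF.pure x) N) G ≤
          expect (law K (PMF.pure x) N) F + b := by
        simp only [law, expect_bind]
        rw [← expect_add, ← expect_const (law K (PMF.pure x) N) b, ← expect_add]
        exact expect_mono h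
      calc _ = expect (law K (PMF.pure x) (N + 1)) F + expect (law K (PMF.pure x) N) G +
            ∑ t ∈ Finset.range N, expect (law K (PMF.pure x) t) G := by
            rw [Finset.sum_range_succ]; ring
        _ ≤ expect (law K (PMF.pure x) N) F + b +
            ∑ t ∈ Finset.range N, expect (law K (PMF.pure x) t) G := by gcongr
        _ = (expect (law K (PMF.pure x) N) F +
            ∑ t ∈ Finset.range N, expect (law K (PMF.pure x) t) G) + b := by ring
        _ ≤ F x + N * b + b := by gcongr
        _ = _ := by push_cast; ring
  -- Under π an N-step average of min G M has the same mean as min G M, while F x / N tends to 0 for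
  -- each x; the bound M permits dominated convergence.
  have trunc : ∀ M : ℕ, expect π (fun x => min (G x) M) ≤ b := by
    intro M
    have bound : ∀ N : ℕ, expect π (fun x => min (G x) M) ≤
        expect π fun x => min (F x / (N + 1 : ℕ) + b) M := by
      intro N
      have hN : ((N + 1 : ℕ) : ℝ≥0∞) ≠ 0 := by simp
      have hN' : ((N + 1 : ℕ) : ℝ≥0∞) ≠ ∞ := ENNReal.natCast_ne_top _
      have e1 : ((N + 1 : ℕ) : ℝ≥0∞) * expect π (fun x => min (G x) M) =
          expect π fun x => ∑ t ∈ Finset.range (N + 1),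
            expect (law K (PMF.pure x) t) (fun y => min (G y) M) := by
        rw [expect_sum]
        simp only [hπ.expect_law, Finset.sum_const, Finset.card_range, nsmul_eq_mul]
      have e2 : ∀ x, ∑ t ∈ Finset.range (N + 1),
            expect (law K (PMF.pure x) t) (fun y => min (G y) M) ≤
          ((N + 1 : ℕ) : ℝ≥0∞) * min (F x / (N + 1 : ℕ) + b) M := by
        intro x
        rw [mul_min]
        refine le_min ?_ ?_
        · rw [mul_add, ENNReal.mul_div_cancel hN hN']
          refine le_trans (Finset.sum_le_sum fun t _ => expect_mono fun y => min_le_left _ _) ?_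
          exact le_trans le_add_self (sum_le (N + 1) x)
        · refine le_trans (Finset.sum_le_sum fun t _ =>
            (expect_mono fun y => min_le_right _ _).trans (expect_const _ _).le) ?_
          simp
      have e3 := e1.trans_le ((expect_mono e2).trans (expect_const_mul _ _ _).le)
      exact (ENNReal.mul_le_mul_iff_right hN hN').1 e3
    have lim : Tendsto (fun N : ℕ => expect π fun x => min (F x / (N + 1 : ℕ) + b) M) atTop
        (𝓝 (expect π fun _ => min b M)) := by
      refine tendsto_expect_of_dominated π (fun _ => M) (fun _ _ => min_le_right _ _)
        (by simp [expect_const]) fun x => ?_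
      have h0 : Tendsto (fun N : ℕ => F x / ((N + 1 : ℕ) : ℝ≥0∞)) atTop (𝓝 0) :=
        (ENNReal.Tendsto.const_div (ENNReal.tendsto_nat_nhds_top.comp (tendsto_add_atTop_nat 1))
          (Or.inr (hF x))).trans (by simp)
      have h1 := (h0.add_const b).min (tendsto_const_nhds (x := (M : ℝ≥0∞)))
      simpa using h1
    rw [expect_const] at lim
    exact (ge_of_tendsto' lim bound).trans (min_le_left _ _)
  have lim : Tendsto (fun M : ℕ => expect π fun x => min (G x) M) atTop (𝓝 (expect π G)) := by
    let _ : MeasurableSpace S := ⊤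
    simp only [← lintegral_toMeasure]
    refine lintegral_tendsto_of_tendsto_of_monotone (fun M => measurable_from_top.aemeasurable)
      (ae_of_all _ fun x M N h => min_le_min_left _ (by exact_mod_cast h))
      (ae_of_all _ fun x => ?_)
    simpa using (tendsto_const_nhds (x := G x)).min ENNReal.tendsto_nat_nhds_top
  exact le_of_tendsto' lim trunc

/-! ### Positive recurrence from a stationary law -/

theorem IsStationary.apply_pos {π : PMF S} (hπ : IsStationary K π) {x y : S} (hx : π x ≠ 0)
    (h : Reachable K x y) : π y ≠ 0 := by
  induction h with
  | refl => exact hx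
  | tail _ hyz ih =>
    rw [← hπ]
    exact fun h0 => mul_ne_zero ih hyz (ENNReal.tsum_eq_zero.1 h0 _)

/-- One half of Kac's formula. With a_t the stationary probability of avoiding x at times 1, …, t, a
shift of time by one shows that π x times P_x(return time > t) is a_t - a_{t+1}; the sum telescopes.
-/
theorem IsStationary.apply_mul_meanReturnTime_le {π : PMF S} (hπ : IsStationary K π) (x : S) :
    π x * meanReturnTime K x ≤ 1 := by
  classical
  have key : ∀ t, π x * avoid K x t x + expect π (avoid K x (t + 1)) =
      expect π (avoid K x t) := by
    intro t
    have h1 : expect π (avoid K x (t + 1)) =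
        expect π fun z => if z = x then 0 else avoid K x t z := by
      rw [← hπ.expect_step fun z => if z = x then 0 else avoid K x t z]; rfl
    have h2 : π x * avoid K x t x = expect π fun z => if z = x then avoid K x t z else 0 := by
      rw [expect, tsum_eq_single x (fun b hb => by simp [hb])]
      simp
    rw [h1, h2, ← expect_add]
    congr 1
    ext z
    by_cases h : z = x <;> simp [h]
  have sum : ∀ N, ∑ t ∈ Finset.range N, π x * avoid K x t x + expect π (avoid K x N) = 1 := by
    intro N
    induction N with
    | zero =>
      have : avoid K x 0 = fun _ => 1 := rfl
      simp [this, expect_const]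
    | succ N ih => rw [Finset.sum_range_succ, add_assoc, key, ih]
  rw [meanReturnTime, ← ENNReal.tsum_mul_left]
  exact ENNReal.tsum_le_of_sum_range_le fun N => le_self_add.trans (sum N).le

theorem IsStationary.isPositiveRecurrentFrom {π : PMF S} (hπ : IsStationary K π) {x₀ : S}
    (h0 : π x₀ ≠ 0) : IsPositiveRecurrentFrom K x₀ := by
  intro x hx
  have hp := hπ.apply_pos h0 hx
  have h := hπ.apply_mul_meanReturnTime_le x
  rw [lt_top_iff_ne_top]
  intro htop
  rw [htop, ENNReal.mul_top hp] at h
  exact absurd h (by simp)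

end Chain

/-! ## Chains with a geometric drift -/

section Harris

variable {S : Type*} {K : S → PMF S} {V : S → ℝ} {γ C : ℝ}

open Classical in
/-- The weighted discrete distance `1 + β (V u + V v)` between distinct points. -/
noncomputable def weightedDist (β : ℝ) (V : S → ℝ) (u v : S) : ℝ≥0∞ :=
  if u = v then 0 else ENNReal.ofReal (1 + β * (V u + V v))

theorem weightedDist_le (β : ℝ) (V : S → ℝ) (u v : S) :
    weightedDist β V u v ≤ ENNReal.ofReal (1 + β * (V u + V v)) := by
  unfold weightedDist
  split_ifs <;> simp

theorem expect_law_le_of_drift (hV : ∀ x, 0 ≤ V x) (hγ : 0 ≤ γ) (hγ' : γ < 1) (hC : 0 ≤ C)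
    (hd : ∀ x, expect (K x) (fun y => ENNReal.ofReal (V y)) ≤ ENNReal.ofReal (γ * V x + C))
    (t : ℕ) (x : S) :
    expect (law K (PMF.pure x) t) (fun y => ENNReal.ofReal (V y)) ≤
      ENNReal.ofReal (γ ^ t * V x + C / (1 - γ)) := by
  have h1 : 0 < 1 - γ := by linarith
  induction t with
  | zero =>
    rw [law, expect_pure]
    apply ENNReal.ofReal_le_ofReal
    have := div_nonneg hC h1.le
    linarith
  | succ t ih =>
    rw [law, expect_bind]
    calc _ ≤ expect (law K (PMF.pure x) t)
          (fun y => ENNReal.ofReal γ * ENNReal.ofReal (V y) + ENNReal.ofReal C) := by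
          refine expect_mono fun y => (hd y).trans_eq ?_
          rw [ENNReal.ofReal_add (mul_nonneg hγ (hV y)) hC, ENNReal.ofReal_mul hγ]
      _ = ENNReal.ofReal γ * expect (law K (PMF.pure x) t) (fun y => ENNReal.ofReal (V y)) +
          ENNReal.ofReal C := by rw [expect_add, expect_const_mul, expect_const]
      _ ≤ ENNReal.ofReal γ * ENNReal.ofReal (γ ^ t * V x + C / (1 - γ)) +
          ENNReal.ofReal C := by gcongr
      _ = ENNReal.ofReal (γ ^ (t + 1) * V x + C / (1 - γ)) := by
          rw [← ENNReal.ofReal_mul hγ, ← ENNReal.ofReal_add _ hC]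
          · congr 1
            field_simp
            ring
          · exact mul_nonneg hγ (add_nonneg (mul_nonneg (pow_nonneg hγ _) (hV x))
              (div_nonneg hC h1.le))

/-- Two independent copies suffice as a coupling. From low states they meet at x₀ with probability
at least η²; from high states the drift of V shrinks the weighted distance. The right side is the
distance formula for distinct points even if x = y, where independent copies would not contract. -/
theorem exists_contraction {Q : S → PMF S} (hV : ∀ x, 0 ≤ V x) (hγ : 0 ≤ γ) (hγ' : γ < 1)
    (hC : 0 < C)
    (hd : ∀ x, expect (Q x) (fun y => ENNReal.ofReal (V y)) ≤ ENNReal.ofReal (γ * V x + C))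
    {x₀ : S} {η : ℝ} (hη : 0 < η)
    (hmin : ∀ x, V x ≤ 4 * C / (1 - γ) → ENNReal.ofReal η ≤ Q x x₀) :
    ∃ β a : ℝ, 0 < β ∧ 0 ≤ a ∧ a < 1 ∧ ∀ x y,
      (expect (Q x) fun u => expect (Q y) fun v => weightedDist β V u v) ≤
        ENNReal.ofReal a * ENNReal.ofReal (1 + β * (V x + V y)) := by
  classical
  have h1 : 0 < 1 - γ := by linarith
  -- With βC = η²/4 the additive drift constants of the two copies cost η²/2, half of the gain η²
  -- from meeting.
  set β := η ^ 2 / (4 * C) with hβ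
  have hβ0 : 0 < β := by positivity
  have hβC : β * C = η ^ 2 / 4 := by rw [hβ]; field_simp
  set δ := min ((1 - γ) / 4) (η ^ 2 / 4) with hδ
  have hδ1 : δ ≤ (1 - γ) / 4 := min_le_left _ _
  have hδ2 : δ ≤ η ^ 2 / 4 := min_le_right _ _
  have hδ0 : 0 < δ := lt_min (by linarith) (by positivity)
  refine ⟨β, 1 - δ, hβ0, by linarith, by linarith, fun x y => ?_⟩
  set D := expect (Q x) fun u => expect (Q y) fun v => weightedDist β V u v with hD
  -- On the event u = v = x₀ the distance is 0 while 1 + β(V u + V v) is at least 1, so the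
  -- probability of that event can be added on the left.
  have key : D + Q x x₀ * Q y x₀ ≤
      ENNReal.ofReal (1 + β * (γ * V x + C + (γ * V y + C))) := by
    have e1 : Q x x₀ * Q y x₀ = expect (Q x) fun u => expect (Q y) fun v =>
        (if u = x₀ then 1 else 0) * (if v = x₀ then 1 else 0) := by
      simp only [expect_const_mul, expect_ite]
      simp only [mul_comm _ (Q y x₀), expect_const_mul, expect_ite]
    have e2 : (expect (Q x) fun u => expect (Q y) fun v =>
        1 + ENNReal.ofReal β * (ENNReal.ofReal (V u) + ENNReal.ofReal (V v))) ≤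
        ENNReal.ofReal (1 + β * (γ * V x + C + (γ * V y + C))) := by
      simp only [expect_add, expect_const_mul, expect_const]
      have hx : 0 ≤ γ * V x + C := add_nonneg (mul_nonneg hγ (hV x)) hC.le
      have hy : 0 ≤ γ * V y + C := add_nonneg (mul_nonneg hγ (hV y)) hC.le
      rw [ENNReal.ofReal_add zero_le_one (mul_nonneg hβ0.le (add_nonneg hx hy)),
        ENNReal.ofReal_mul hβ0.le, ENNReal.ofReal_add hx hy, ENNReal.ofReal_one]
      gcongr
      · exact hd x
      · exact hd y
    refine le_trans ?_ e2
    rw [e1, hD, ← expect_add]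
    simp only [← expect_add]
    refine expect_mono fun u => expect_mono fun v => ?_
    have e3 : 1 + ENNReal.ofReal β * (ENNReal.ofReal (V u) + ENNReal.ofReal (V v)) =
        ENNReal.ofReal (1 + β * (V u + V v)) := by
      rw [ENNReal.ofReal_add zero_le_one (mul_nonneg hβ0.le (add_nonneg (hV u) (hV v))),
        ENNReal.ofReal_mul hβ0.le, ENNReal.ofReal_add (hV u) (hV v), ENNReal.ofReal_one]
    by_cases h : u = v
    · subst h
      simp only [weightedDist, if_true, zero_add]
      refine le_trans ?_ le_self_add
      split_ifs <;> simp
    · rw [e3, weightedDist, if_neg h]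
      have : (if u = x₀ then (1 : ℝ≥0∞) else 0) * (if v = x₀ then 1 else 0) = 0 := by
        by_cases hu : u = x₀
        · have hv : v ≠ x₀ := fun hv => h (hu.trans hv.symm)
          simp [hv]
        · simp [hu]
      rw [this, add_zero]
  have hx := hV x
  have hy := hV y
  rw [← ENNReal.ofReal_mul (by linarith)]
  -- If the sum is small, each state lies in the sublevel set where `hmin` applies; otherwise 4C ≤
  -- (1 - γ)(V x + V y) lets the drift alone pay for δ and the constants.
  by_cases hR : V x + V y ≤ 4 * C / (1 - γ)
  · have hp : ENNReal.ofReal (η ^ 2) ≤ Q x x₀ * Q y x₀ := by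
      rw [pow_two, ENNReal.ofReal_mul hη.le]
      exact mul_le_mul' (hmin x (by linarith)) (hmin y (by linarith))
    have h2 : D + ENNReal.ofReal (η ^ 2) ≤
        ENNReal.ofReal (1 + β * (γ * V x + C + (γ * V y + C))) :=
      (add_le_add_right hp D).trans key
    have h3 := ENNReal.le_sub_of_add_le_right ENNReal.ofReal_ne_top h2
    rw [← ENNReal.ofReal_sub _ (by positivity)] at h3
    refine h3.trans (ENNReal.ofReal_le_ofReal ?_)
    have : 0 ≤ β * (V x + V y) * (1 - δ - γ) :=
      mul_nonneg (mul_nonneg hβ0.le (by linarith)) (by linarith)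
    nlinarith
  · have h3 : D ≤ _ := le_self_add.trans key
    refine h3.trans (ENNReal.ofReal_le_ofReal ?_)
    have hs : 4 * C ≤ (1 - γ) * (V x + V y) := by
      rw [not_le, div_lt_iff₀ h1] at hR
      linarith
    have h4 : 4 * (β * C) ≤ (1 - γ) * (β * (V x + V y)) := by nlinarith
    have h5 : δ * (β * (V x + V y)) ≤ (1 - γ) / 4 * (β * (V x + V y)) :=
      mul_le_mul_of_nonneg_right hδ1 (by positivity)
    nlinarith

/-- Dual form of the contraction: averaging over a coupling multiplies the Lipschitz constant for
the weighted distance by a. The diagonal, where the contraction says nothing, is trivial here. -/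
theorem expect_le_add_of_contraction {Q : S → PMF S} {β : ℝ} {a : ℝ≥0∞}
    (ha : ∀ x y, (expect (Q x) fun u => expect (Q y) fun v => weightedDist β V u v) ≤
      a * ENNReal.ofReal (1 + β * (V x + V y))) {F : S → ℝ≥0∞} {c : ℝ≥0∞}
    (hF : ∀ x y, F x ≤ F y + c * weightedDist β V x y) (x y : S) :
    expect (Q x) F ≤ expect (Q y) F + c * a * weightedDist β V x y := by
  by_cases hxy : x = y
  · subst hxy; exact le_self_add
  have h := ha x y
  calc expect (Q x) F = expect (Q x) fun u => expect (Q y) fun _ => F u := by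
        simp only [expect_const]
    _ ≤ expect (Q x) fun u => expect (Q y) fun v => F v + c * weightedDist β V u v :=
        expect_mono fun u => expect_mono fun v => hF u v
    _ = expect (Q y) F + c * expect (Q x) fun u => expect (Q y) fun v => weightedDist β V u v := by
        simp only [expect_add, expect_const_mul, expect_const]
    _ ≤ expect (Q y) F + c * (a * ENNReal.ofReal (1 + β * (V x + V y))) := by gcongr
    _ = _ := by rw [weightedDist, if_neg hxy, mul_assoc]

/-- A chain with a geometric drift towards sets from which a fixed point can be reached in a fixed
time forgets its starting point at a geometric rate. -/
theorem exists_merging (hV : ∀ x, 0 ≤ V x) (hγ : 0 ≤ γ) (hγ' : γ < 1) (hC : 0 < C)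
    (hd : ∀ x, expect (K x) (fun y => ENNReal.ofReal (V y)) ≤ ENNReal.ofReal (γ * V x + C))
    {x₀ : S} (hreach : ∀ R : ℝ, ∃ T : ℕ, T ≠ 0 ∧ ∃ η : ℝ, 0 < η ∧ ∀ x, V x ≤ R →
      ENNReal.ofReal η ≤ law K (PMF.pure x) T x₀) :
    ∃ (β : ℝ) (e : ℕ → ℝ≥0∞), 0 < β ∧ Tendsto e atTop (𝓝 0) ∧ ∀ t (F : S → ℝ≥0∞),
      (∀ x, F x ≤ 1) → ∀ x y, expect (law K (PMF.pure x) t) F ≤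
        expect (law K (PMF.pure y) t) F + e t * weightedDist β V x y := by
  have h1 : 0 < 1 - γ := by linarith
  -- The contraction is applied to the T-step chain, whose drift constant is C / (1 - γ) for every
  -- T; this fixes the level before T is known.
  obtain ⟨T, hT, η, hη, hmin⟩ := hreach (4 * (C / (1 - γ)) / (1 - γ))
  have hdT : ∀ x, expect (law K (PMF.pure x) T) (fun y => ENNReal.ofReal (V y)) ≤
      ENNReal.ofReal (γ * V x + C / (1 - γ)) := fun x =>
    (expect_law_le_of_drift hV hγ hγ' hC.le hd T x).trans (ENNReal.ofReal_le_ofReal (by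
      gcongr
      · exact hV x
      · exact pow_le_of_le_one hγ hγ'.le hT))
  obtain ⟨β, a, hβ, ha0, ha1, ha⟩ := exists_contraction (Q := fun x => law K (PMF.pure x) T)
    hV hγ hγ' (div_pos hC h1) hdT hη hmin
  -- One factor a per complete block of T steps; the remaining t % T steps are absorbed into the
  -- test function, which stays bounded by 1.
  refine ⟨β, fun t => ENNReal.ofReal a ^ (t / T), hβ, ?_, fun t F hF => ?_⟩
  · refine (ENNReal.tendsto_pow_atTop_nhds_zero_of_lt_one (by simpa using ha1)).comp ?_
    exact Nat.tendsto_div_const_atTop hT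
  · have base : ∀ G : S → ℝ≥0∞, (∀ x, G x ≤ 1) → ∀ x y,
        G x ≤ G y + 1 * weightedDist β V x y := by
      intro G hG x y
      by_cases h : x = y
      · subst h; exact le_self_add
      · rw [weightedDist, if_neg h, one_mul]
        refine (hG x).trans (le_trans ?_ le_add_self)
        rw [← ENNReal.ofReal_one]
        exact ENNReal.ofReal_le_ofReal (by
          have := mul_nonneg hβ.le (add_nonneg (hV x) (hV y)); linarith)
    have main : ∀ k : ℕ, ∀ G : S → ℝ≥0∞, (∀ x, G x ≤ 1) → ∀ x y,
        expect (law K (PMF.pure x) (T * k)) G ≤ expect (law K (PMF.pure y) (T * k)) G +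
          ENNReal.ofReal a ^ k * weightedDist β V x y := by
      intro k
      induction k with
      | zero => intro G hG x y; simpa [law, expect_pure] using base G hG x y
      | succ k ih =>
        intro G hG x y
        have e : T * (k + 1) = T + T * k := by ring
        simp only [e, expect_law_add K _ T (T * k)]
        have := expect_le_add_of_contraction ha (ih G hG) x y
        simpa [pow_succ] using this
    intro x y
    have e : t = T * (t / T) + t % T := (Nat.div_add_mod t T).symm
    have hr := main (t / T) (fun z => expect (law K (PMF.pure z) (t % T)) F)
      (fun z => (expect_mono hF).trans (expect_const _ _).le) x y
    rw [← expect_law_add, ← expect_law_add, ← e] at hr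
    exact hr

/-- A chain as in `exists_merging` has a stationary law. -/
theorem exists_isStationary [Countable S] (hV : ∀ x, 0 ≤ V x) (hγ : 0 ≤ γ) (hγ' : γ < 1)
    (hC : 0 < C)
    (hd : ∀ x, expect (K x) (fun y => ENNReal.ofReal (V y)) ≤ ENNReal.ofReal (γ * V x + C))
    (hfin : ∀ R : ℝ, {x | V x ≤ R}.Finite) (x₀ : S) {β : ℝ} {e : ℕ → ℝ≥0∞} (hβ : 0 < β)
    (he : Tendsto e atTop (𝓝 0)) (hmerge : ∀ t (F : S → ℝ≥0∞),
      (∀ x, F x ≤ 1) → ∀ x y, expect (law K (PMF.pure x) t) F ≤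
        expect (law K (PMF.pure y) t) F + e t * weightedDist β V x y) :
    ∃ π : PMF S, IsStationary K π := by
  classical
  have h1 : 0 < 1 - γ := by linarith
  set p : ℕ → PMF S := law K (PMF.pure x₀) with hp
  -- A free ultrafilter and compactness of [0, ∞] give limits of all point probabilities at once,
  -- without a diagonal subsequence.
  set U : Ultrafilter ℕ := hyperfilter ℕ with hU
  have hUle : (U : Filter ℕ) ≤ atTop := Nat.hyperfilter_le_atTop
  have hex : ∀ z, ∃ c, Tendsto (fun t => p t z) U (𝓝 c) := fun z => by
    obtain ⟨c, -, hc⟩ := isCompact_univ.ultrafilter_le_nhds (U.map fun t => p t z) (by simp)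
    exact ⟨c, hc⟩
  choose ρ hρ using hex
  set M := V x₀ + C / (1 - γ) with hM
  have hEV : ∀ t, expect (p t) (fun y => ENNReal.ofReal (V y)) ≤ ENNReal.ofReal M := fun t =>
    (expect_law_le_of_drift hV hγ hγ' hC.le hd t x₀).trans (ENNReal.ofReal_le_ofReal (by
      have := mul_le_of_le_one_left (hV x₀) (pow_le_one₀ (n := t) hγ hγ'.le)
      linarith))
  have hM0 : 0 < M := add_pos_of_nonneg_of_pos (hV x₀) (div_pos hC h1)
  have sum_le : ∑' z, ρ z ≤ 1 := by
    rw [ENNReal.tsum_eq_iSup_sum]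
    refine iSup_le fun s => ?_
    exact le_of_tendsto' (tendsto_finsetSum s fun z _ => hρ z) fun t =>
      (ENNReal.sum_le_tsum s).trans (p t).tsum_coe.le
  -- Tightness: by Markov's inequality the mass outside the finite set V ≤ R is at most M / R
  -- uniformly in t, so no mass escapes in the limit.
  have le_sum : 1 ≤ ∑' z, ρ z := by
    have hR : ∀ R : ℝ, 0 < R → 1 ≤ ∑' z, ρ z + ENNReal.ofReal (M / R) := by
      intro R hR
      set s := (hfin R).toFinset with hs
      have hb : ∀ t, 1 ≤ ∑ z ∈ s, p t z + ENNReal.ofReal (M / R) := by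
        intro t
        calc (1 : ℝ≥0∞) = expect (p t) fun _ => 1 := (expect_const _ _).symm
          _ ≤ expect (p t) fun z => (∑ w ∈ s, if z = w then 1 else 0) +
              ENNReal.ofReal R⁻¹ * ENNReal.ofReal (V z) := by
              refine expect_mono fun z => ?_
              by_cases hz : z ∈ s
              · simp [hz]
              · simp only [Finset.sum_ite_eq, hz, if_false, zero_add]
                rw [← ENNReal.ofReal_mul (by positivity), ← ENNReal.ofReal_one]
                apply ENNReal.ofReal_le_ofReal
                simp only [hs, Set.Finite.mem_toFinset, Set.mem_ofPred_eq, not_le] at hz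
                rw [inv_mul_eq_div, le_div_iff₀ hR]
                linarith
          _ = ∑ w ∈ s, p t w + ENNReal.ofReal R⁻¹ *
              expect (p t) (fun z => ENNReal.ofReal (V z)) := by
              simp only [expect_add, expect_sum, expect_ite, expect_const_mul]
          _ ≤ ∑ w ∈ s, p t w + ENNReal.ofReal R⁻¹ * ENNReal.ofReal M := by
              gcongr; exact hEV t
          _ = _ := by rw [← ENNReal.ofReal_mul (by positivity), inv_mul_eq_div]
      have := ge_of_tendsto' ((tendsto_finsetSum s fun z _ => hρ z).add_const
        (ENNReal.ofReal (M / R))) hb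
      exact this.trans (by gcongr; exact ENNReal.sum_le_tsum s)
    have hlim : Tendsto (fun R : ℝ => ∑' z, ρ z + ENNReal.ofReal (M / R)) atTop
        (𝓝 (∑' z, ρ z + ENNReal.ofReal 0)) :=
      (ENNReal.tendsto_ofReal (tendsto_const_nhds.div_atTop tendsto_id)).const_add _
    rw [ENNReal.ofReal_zero, add_zero] at hlim
    exact ge_of_tendsto hlim ((eventually_gt_atTop 0).mono hR)
  have hsum : HasSum ρ 1 := by
    rw [← le_antisymm sum_le le_sum]
    exact ENNReal.summable.hasSum
  let π : PMF S := ⟨ρ, hsum⟩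
  refine ⟨π, pmf_eq_of_le fun z => ?_⟩
  rw [PMF.bind_apply, ENNReal.tsum_eq_iSup_sum]
  refine iSup_le fun s => ?_
  have hA : Tendsto (fun t => ∑ y ∈ s, p t y * K y z) U (𝓝 (∑ y ∈ s, ρ y * K y z)) :=
    tendsto_finsetSum s fun y _ =>
      ENNReal.Tendsto.mul_const (hρ y) (Or.inr ((K y).apply_ne_top z))
  set d := expect (K x₀) fun y => weightedDist β V y x₀ with hdd
  have hdfin : d ≠ ∞ := by
    have : d ≤ expect (K x₀) fun y => ENNReal.ofReal (1 + β * V x₀) +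
        ENNReal.ofReal β * ENNReal.ofReal (V y) := by
      refine expect_mono fun y => (weightedDist_le _ _ _ _).trans_eq ?_
      rw [← ENNReal.ofReal_mul hβ.le, ← ENNReal.ofReal_add
        (add_nonneg zero_le_one (mul_nonneg hβ.le (hV _))) (mul_nonneg hβ.le (hV _))]
      congr 1; ring
    refine ne_top_of_le_ne_top ?_ this
    rw [expect_add, expect_const, expect_const_mul]
    exact ENNReal.add_ne_top.2 ⟨ENNReal.ofReal_ne_top, ENNReal.mul_ne_top ENNReal.ofReal_ne_top
      (ne_top_of_le_ne_top ENNReal.ofReal_ne_top (hd x₀))⟩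
  -- The chain at time t + 1 is the chain at time t started from the law of the first step; merging
  -- compares that start with x₀, at finite mean distance d.
  have hstep : ∀ t, p (t + 1) z ≤ p t z + e t * d := by
    intro t
    set F : S → ℝ≥0∞ := fun x => if x = z then 1 else 0 with hF
    have hF1 : ∀ x, F x ≤ 1 := fun x => by simp only [hF]; split_ifs <;> simp
    calc p (t + 1) z = expect (p (t + 1)) F := (expect_ite _ _).symm
      _ = expect (K x₀) fun y => expect (law K (PMF.pure y) t) F := expect_law_succ _ _ _ _
      _ ≤ expect (K x₀) fun y => expect (p t) F + e t * weightedDist β V y x₀ :=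
          expect_mono fun y => hmerge t F hF1 y x₀
      _ = p t z + e t * d := by
          rw [expect_add, expect_const, expect_const_mul, expect_ite]
  have hB : Tendsto (fun t => p t z + e t * d) U (𝓝 (ρ z)) := by
    simpa using (hρ z).add (ENNReal.Tendsto.mul_const (he.mono_left hUle) (Or.inr hdfin))
  refine le_of_tendsto_of_tendsto' hA hB fun t => le_trans ?_ (hstep t)
  exact ENNReal.sum_le_tsum s

/-- Under merging, the chain converges to its stationary law from every initial law. -/
theorem tendsto_expect_law [Countable S] {β : ℝ} {e : ℕ → ℝ≥0∞}
    (he : Tendsto e atTop (𝓝 0)) (hmerge : ∀ t (F : S → ℝ≥0∞),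
      (∀ x, F x ≤ 1) → ∀ x y, expect (law K (PMF.pure x) t) F ≤
        expect (law K (PMF.pure y) t) F + e t * weightedDist β V x y)
    {π : PMF S} (hπ : IsStationary K π) (μ : PMF S) {F : S → ℝ≥0∞} (hF : ∀ x, F x ≤ 1) :
    Tendsto (fun t => expect (law K μ t) F) atTop (𝓝 (expect π F)) := by
  -- The merging error averaged over independent starts from μ and π. Capping it at 1 allows
  -- dominated convergence although neither law is assumed to integrate V.
  set E : ℕ → ℝ≥0∞ := fun t => expect (μ.bind fun x => π.map fun y => (x, y)) fun z =>
    min 1 (e t * weightedDist β V z.1 z.2) with hE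
  have hE0 : Tendsto E atTop (𝓝 0) := by
    have := tendsto_expect_of_dominated (μ.bind fun x => π.map fun y => (x, y))
      (F := fun t z => min 1 (e t * weightedDist β V z.1 z.2)) (f := fun _ => 0) (fun _ => 1)
      (fun t z => min_le_left _ _) (by simp [expect_const]) (fun z => by
        have h : weightedDist β V z.1 z.2 ≠ ∞ :=
          ne_top_of_le_ne_top ENNReal.ofReal_ne_top (weightedDist_le _ _ _ _)
        have := (ENNReal.Tendsto.mul_const (b := weightedDist β V z.1 z.2) he (Or.inr h))
        simpa using (tendsto_const_nhds (x := (1 : ℝ≥0∞))).min this)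
    simpa [expect_const] using this
  have hEe : ∀ t, E t = expect μ fun x => expect π fun y =>
      min 1 (e t * weightedDist β V x y) := fun t => by
    simp only [hE, expect_bind, expect_map]
  have hm : ∀ t x y, expect (law K (PMF.pure x) t) F ≤
      expect (law K (PMF.pure y) t) F + min 1 (e t * weightedDist β V x y) := by
    intro t x y
    rw [← min_add_add_left]
    exact le_min (((expect_mono hF).trans (expect_const _ _).le).trans le_add_self)
      (hmerge t F hF x y)
  have up : ∀ t, expect (law K μ t) F ≤ expect π F + E t := by
    intro t
    calc expect (law K μ t) F = expect μ fun x => expect π fun _ =>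
          expect (law K (PMF.pure x) t) F := by
          rw [expect_law_eq]; simp only [expect_const]
      _ ≤ expect μ fun x => expect π fun y => expect (law K (PMF.pure y) t) F +
          min 1 (e t * weightedDist β V x y) :=
          expect_mono fun x => expect_mono fun y => hm t x y
      _ = _ := by simp only [expect_add, hπ.expect_law, expect_const, hEe]
  have symm : ∀ x y, weightedDist β V x y = weightedDist β V y x := fun x y => by
    by_cases h : x = y
    · rw [h]
    · simp only [weightedDist, h, Ne.symm h, add_comm (V x), if_false]
  have down : ∀ t, expect π F ≤ expect (law K μ t) F + E t := by
    intro t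
    calc expect π F = expect μ fun _ => expect π fun y => expect (law K (PMF.pure y) t) F := by
          simp only [hπ.expect_law, expect_const]
      _ ≤ expect μ fun x => expect π fun y => expect (law K (PMF.pure x) t) F +
          min 1 (e t * weightedDist β V x y) :=
          expect_mono fun x => expect_mono fun y => by rw [symm]; exact hm t y x
      _ = _ := by rw [expect_law_eq]; simp only [expect_add, expect_const, hEe]
  have hfin : expect π F ≠ ∞ :=
    ne_top_of_le_ne_top ENNReal.one_ne_top ((expect_mono hF).trans (expect_const _ _).le)
  refine tendsto_of_tendsto_of_tendsto_of_le_of_le (g := fun t => expect π F - E t)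
    (h := fun t => expect π F + E t) ?_ ?_ (fun t => tsub_le_iff_right.2 (down t)) up
  · simpa using ENNReal.Tendsto.sub (tendsto_const_nhds (x := expect π F)) hE0 (Or.inl hfin)
  · simpa using hE0.const_add (expect π F)

end Harris

/-! ## Convergence in distribution -/

/-- Passing to the limit in finite partial sums of one step yields πK ≤ π pointwise, and two
probability laws so ordered coincide. -/
theorem isStationary_of_tendsto {S : Type*} {K : S → PMF S} {μ π : PMF S}
    (h : ∀ z, Tendsto (fun t => law K μ t z) atTop (𝓝 (π z))) : IsStationary K π := by
  refine pmf_eq_of_le fun z => ?_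
  rw [PMF.bind_apply, ENNReal.tsum_eq_iSup_sum]
  refine iSup_le fun s => ?_
  refine le_of_tendsto_of_tendsto' (tendsto_finsetSum s fun y _ =>
    ENNReal.Tendsto.mul_const (h y) (Or.inr ((K y).apply_ne_top z)))
    ((tendsto_add_atTop_iff_nat 1).2 (h z)) fun t => ?_
  rw [law, PMF.bind_apply]
  exact ENNReal.sum_le_tsum s

section

variable {n : ℕ}

theorem ConvergesInDistribution.tendsto_apply {μ : ℕ → PMF (State n)} {π : PMF (State n)}
    (h : ConvergesInDistribution μ π) (z : State n) :
    Tendsto (fun t => μ t z) atTop (𝓝 (π z)) := by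
  have := ProbabilityMeasure.tendsto_measure_of_null_frontier_of_tendsto' h (E := {z})
    (by simp)
  simpa [toProb, PMF.toMeasure_apply_singleton _ _ (measurableSet_singleton z)] using this

theorem convergesInDistribution_of_tendsto_expect {μ : ℕ → PMF (State n)} {π : PMF (State n)}
    (h : ∀ F : State n → ℝ≥0∞, (∀ x, F x ≤ 1) →
      Tendsto (fun t => expect (μ t) F) atTop (𝓝 (expect π F))) :
    ConvergesInDistribution μ π := by
  rw [ConvergesInDistribution, ProbabilityMeasure.tendsto_iff_forall_lintegral_tendsto]
  intro f
  set c := nndist f 0 with hc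
  have hc' : ∀ x, f x ≤ c + 1 := fun x => (BoundedContinuousFunction.NNReal.upper_bound f x).trans le_self_add
  -- Normalizing by c + 1 rather than by c covers f = 0 as well.
  have h0 : ((c + 1 : ℝ≥0) : ℝ≥0∞) ≠ 0 := by simp
  have e : ∀ p : PMF (State n), ∫⁻ x, f x ∂(toProb p : Measure (State n)) =
      ((c + 1 : ℝ≥0) : ℝ≥0∞) * expect p fun x => (f x : ℝ≥0∞) / ((c + 1 : ℝ≥0) : ℝ≥0∞) := by
    intro p
    rw [← expect_const_mul]
    simp only [ENNReal.mul_div_cancel h0 ENNReal.coe_ne_top]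
    exact lintegral_toMeasure p _
  simp only [e]
  refine ENNReal.Tendsto.const_mul (h _ fun x => ?_) (Or.inr ENNReal.coe_ne_top)
  exact ENNReal.div_le_of_le_mul (by rw [one_mul]; exact_mod_cast hc' x)

/-! ## Arrivals -/

/-- The probability of an arrival vector, as a real number. -/
noncomputable def arrivalProb (n : ℕ) (p : ℝ) (a : Fin n × Fin n → Bool) : ℝ :=
  ∏ ij, if a ij then p else 1 - p

/-- The expectation over the arrivals. -/
noncomputable def arrivalMean (n : ℕ) (p : ℝ) (f : (Fin n × Fin n → Bool) → ℝ) : ℝ :=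
  ∑ a, arrivalProb n p a * f a

/-- The arrivals as real numbers. -/
noncomputable def arr (a : Fin n × Fin n → Bool) (ij : Fin n × Fin n) : ℝ := ((a ij).toNat : ℝ)

theorem arrivalLaw_apply (p : unitInterval) (a : Fin n × Fin n → Bool) :
    arrivalLaw n p a = ENNReal.ofReal (arrivalProb n p a) := by
  rw [arrivalLaw, PMF.ofFintype_apply, arrivalProb, ENNReal.ofReal_prod_of_nonneg]
  · refine Finset.prod_congr rfl fun ij _ => ?_
    unfold bernoulliWeight
    split_ifs <;> rfl
  · intro ij _
    have h0 := p.2.1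
    have h1 := p.2.2
    split_ifs <;> linarith

theorem arrivalProb_nonneg {p : ℝ} (h0 : 0 ≤ p) (h1 : p ≤ 1) (a : Fin n × Fin n → Bool) :
    0 ≤ arrivalProb n p a :=
  Finset.prod_nonneg fun ij _ => by split_ifs <;> linarith

theorem arrivalMean_prod (p : ℝ) (T : Finset (Fin n × Fin n)) :
    arrivalMean n p (fun a => ∏ ij ∈ T, arr a ij) = p ^ T.card := by
  classical
  have e : ∀ a : Fin n × Fin n → Bool, arrivalProb n p a * ∏ ij ∈ T, arr a ij =
      ∏ ij, (fun (ij : Fin n × Fin n) (b : Bool) => (if b then p else 1 - p) *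
        (if ij ∈ T then (b.toNat : ℝ) else 1)) ij (a ij) := by
    intro a
    rw [Finset.prod_mul_distrib, arrivalProb]
    congr 1
    rw [Finset.prod_ite_mem, Finset.univ_inter]
    rfl
  have e1 := Finset.prod_univ_sum (fun _ : Fin n × Fin n => (Finset.univ : Finset Bool))
    (fun ij b => (if b then p else 1 - p) * (if ij ∈ T then (b.toNat : ℝ) else 1))
  rw [Fintype.piFinset_univ] at e1
  rw [arrivalMean, Finset.sum_congr rfl fun a _ => e a]
  refine e1.symm.trans ?_
  have e2 : ∀ ij : Fin n × Fin n, ∑ b : Bool, (if b then p else 1 - p) *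
      (if ij ∈ T then (b.toNat : ℝ) else 1) = if ij ∈ T then p else 1 := by
    intro ij
    split_ifs <;> simp
  simp only [e2]
  rw [Finset.prod_ite_mem, Finset.univ_inter, Finset.prod_const]

theorem arrivalMean_const (p c : ℝ) : arrivalMean n p (fun _ => c) = c := by
  have h := arrivalMean_prod (n := n) p ∅
  simp only [arrivalMean, Finset.prod_empty, mul_one, Finset.card_empty, pow_zero] at h
  rw [arrivalMean, ← Finset.sum_mul, h, one_mul]

theorem arrivalMean_arr (p : ℝ) (ij : Fin n × Fin n) :
    arrivalMean n p (fun a => arr a ij) = p := by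
  simpa using arrivalMean_prod p {ij}

theorem arr_mul_self (a : Fin n × Fin n → Bool) (ij : Fin n × Fin n) :
    arr a ij * arr a ij = arr a ij := by
  unfold arr; cases a ij <;> simp

theorem arrivalMean_arr_mul_arr (p : ℝ) (ij kl : Fin n × Fin n) :
    arrivalMean n p (fun a => arr a ij * arr a kl) =
      p ^ 2 + if ij = kl then p - p ^ 2 else 0 := by
  classical
  by_cases h : ij = kl
  · subst h
    simp [arr_mul_self, arrivalMean_arr]
  · have := arrivalMean_prod p {ij, kl}
    rw [Finset.card_pair h] at this
    simpa [Finset.prod_pair h, h] using this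

theorem arrivalMean_add (p : ℝ) (f g : (Fin n × Fin n → Bool) → ℝ) :
    arrivalMean n p (fun a => f a + g a) = arrivalMean n p f + arrivalMean n p g := by
  simp [arrivalMean, mul_add, Finset.sum_add_distrib]

theorem arrivalMean_sub (p : ℝ) (f g : (Fin n × Fin n → Bool) → ℝ) :
    arrivalMean n p (fun a => f a - g a) = arrivalMean n p f - arrivalMean n p g := by
  simp [arrivalMean, mul_sub, Finset.sum_sub_distrib]

theorem arrivalMean_const_mul (p c : ℝ) (f : (Fin n × Fin n → Bool) → ℝ) :
    arrivalMean n p (fun a => c * f a) = c * arrivalMean n p f := by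
  simp only [arrivalMean, Finset.mul_sum]
  exact Finset.sum_congr rfl fun a _ => by ring

theorem arrivalMean_mul_const (p c : ℝ) (f : (Fin n × Fin n → Bool) → ℝ) :
    arrivalMean n p (fun a => f a * c) = arrivalMean n p f * c := by
  simp only [mul_comm _ c, arrivalMean_const_mul]

theorem arrivalMean_sum {ι : Type*} (t : Finset ι) (p : ℝ)
    (f : ι → (Fin n × Fin n → Bool) → ℝ) :
    arrivalMean n p (fun a => ∑ i ∈ t, f i a) = ∑ i ∈ t, arrivalMean n p (f i) := by
  simp only [arrivalMean, Finset.mul_sum]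
  exact Finset.sum_comm

theorem arrivalMean_mono {p : ℝ} (h0 : 0 ≤ p) (h1 : p ≤ 1)
    {f g : (Fin n × Fin n → Bool) → ℝ} (h : ∀ a, f a ≤ g a) :
    arrivalMean n p f ≤ arrivalMean n p g :=
  Finset.sum_le_sum fun a _ => mul_le_mul_of_nonneg_left (h a) (arrivalProb_nonneg h0 h1 a)

/-- A sum of arrivals over a set of queues has the second moment of a binomial variable. -/
theorem arrivalMean_sum_arr_sq (p : ℝ) (T : Finset (Fin n × Fin n)) :
    arrivalMean n p (fun a => (∑ ij ∈ T, arr a ij) ^ 2) =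
      (T.card * p) ^ 2 + T.card * (p - p ^ 2) := by
  classical
  simp only [pow_two (∑ ij ∈ T, arr _ ij), Finset.sum_mul_sum, arrivalMean_sum,
    arrivalMean_arr_mul_arr, Finset.sum_add_distrib, Finset.sum_const, nsmul_eq_mul,
    Finset.sum_ite_eq, Finset.sum_ite_mem, Finset.inter_self]
  ring

theorem arrivalMean_sum_arr (p : ℝ) (T : Finset (Fin n × Fin n)) :
    arrivalMean n p (fun a => ∑ ij ∈ T, arr a ij) = T.card * p := by
  simp [arrivalMean_sum, arrivalMean_arr]

theorem rate_eq (hn : 1 ≤ n) {ε : ℝ} (h0 : 0 < ε) (h1 : ε < 1) :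
    (rate n ε : ℝ) = (1 - ε) / n := by
  have hn' : (1 : ℝ) ≤ n := by exact_mod_cast hn
  rw [rate, Set.projIcc_of_mem]
  exact ⟨div_nonneg (by linarith) (by linarith), (div_le_one (by linarith)).2 (by linarith)⟩

/-! ## One step of the queue length chain -/

theorem expect_step (ε : ℝ) (P : Policy n) (q : State n) (F : State n → ℝ≥0∞) :
    expect (step ε P q) F = expect (P q) fun s =>
      ∑ a, ENNReal.ofReal (arrivalProb n (rate n ε) a) * F (next q a s) := by
  simp only [step, expect_bind, expect_map, expect_fintype, arrivalLaw_apply]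

theorem sum_ofReal_arrivalProb (ε : ℝ) {f : (Fin n × Fin n → Bool) → ℝ} (hf : ∀ a, 0 ≤ f a) :
    ∑ a, ENNReal.ofReal (arrivalProb n (rate n ε) a) * ENNReal.ofReal (f a) =
      ENNReal.ofReal (arrivalMean n (rate n ε) f) := by
  have hw := arrivalProb_nonneg (n := n) (rate n ε).2.1 (rate n ε).2.2
  rw [arrivalMean, ENNReal.ofReal_sum_of_nonneg fun a _ => mul_nonneg (hw a) (hf a)]
  exact Finset.sum_congr rfl fun a _ => (ENNReal.ofReal_mul (hw a)).symm

theorem expect_step_le (ε : ℝ) (P : Policy n) (q : State n) {f : State n → ℝ}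
    (hf : ∀ q, 0 ≤ f q) {c : ℝ}
    (h : ∀ s ∈ (P q).support, arrivalMean n (rate n ε) (fun a => f (next q a s)) ≤ c) :
    expect (step ε P q) (fun q' => ENNReal.ofReal (f q')) ≤ ENNReal.ofReal c := by
  rw [expect_step, ← expect_const (P q) (ENNReal.ofReal c)]
  refine expect_mono_of_mem_support fun s hs => ?_
  rw [sum_ofReal_arrivalProb ε fun a => hf _]
  exact ENNReal.ofReal_le_ofReal (h s hs)

/-- Comparison of stationary means through a bound on the conditional means. -/
theorem IsStationary.integral_le {ε : ℝ} {P : Policy n} {π : PMF (State n)}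
    (hπ : IsStationary (step ε P) π) {g G : State n → ℝ} (hg : Integrable g π.toMeasure)
    (hG : Integrable G π.toMeasure)
    (h : ∀ q, ∀ s ∈ (P q).support,
      arrivalMean n (rate n ε) (fun a => g (next q a s)) ≤ G q) :
    ∫ q, g q ∂π.toMeasure ≤ ∫ q, G q ∂π.toMeasure := by
  -- The hypothesis with negative parts moved across, so that both sides are sums in [0, ∞] and
  -- stationarity can be used without subtraction.
  have point : ∀ q, ∀ s ∈ (P q).support,
      ∑ a, ENNReal.ofReal (arrivalProb n (rate n ε) a) * ENNReal.ofReal (g (next q a s)) +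
        ENNReal.ofReal (-G q) ≤
      ∑ a, ENNReal.ofReal (arrivalProb n (rate n ε) a) * ENNReal.ofReal (-g (next q a s)) +
        ENNReal.ofReal (G q) := by
    intro q s hs
    have e : ∀ x : ℝ, ENNReal.ofReal x = ENNReal.ofReal (max x 0) := fun x => by
      rcases le_total x 0 with hx | hx <;> simp [hx]
    have hmax : ∀ x : ℝ, max x 0 - max (-x) 0 = x := fun x => by
      rcases le_total x 0 with hx | hx <;> simp [hx]
    simp only [e (g _), e (-g _), e (G _), e (-G _)]
    have nn : ∀ f : (Fin n × Fin n → Bool) → ℝ, (∀ a, 0 ≤ f a) →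
        0 ≤ arrivalMean n (rate n ε) f := fun f hf => Finset.sum_nonneg fun a _ =>
      mul_nonneg (arrivalProb_nonneg (rate n ε).2.1 (rate n ε).2.2 a) (hf a)
    rw [sum_ofReal_arrivalProb ε fun a => le_max_right _ _,
      sum_ofReal_arrivalProb ε fun a => le_max_right _ _,
      ← ENNReal.ofReal_add (nn _ fun a => le_max_right _ _) (le_max_right _ _),
      ← ENNReal.ofReal_add (nn _ fun a => le_max_right _ _) (le_max_right _ _)]
    refine ENNReal.ofReal_le_ofReal ?_
    have h1 := h q s hs
    have h2 : arrivalMean n (rate n ε) (fun a => max (g (next q a s)) 0) -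
        arrivalMean n (rate n ε) (fun a => max (-g (next q a s)) 0) =
        arrivalMean n (rate n ε) (fun a => g (next q a s)) := by
      rw [← arrivalMean_sub]
      simp only [hmax]
    have h3 := hmax (G q)
    linarith
  have main : expect π (fun q => ENNReal.ofReal (g q)) + expect π (fun q => ENNReal.ofReal (-G q)) ≤
      expect π (fun q => ENNReal.ofReal (-g q)) + expect π (fun q => ENNReal.ofReal (G q)) := by
    rw [← hπ.expect_step fun q => ENNReal.ofReal (g q),
      ← hπ.expect_step fun q => ENNReal.ofReal (-g q), ← expect_add, ← expect_add]
    refine expect_mono fun q => ?_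
    rw [Switch.expect_step, Switch.expect_step, ← expect_const (P q) (ENNReal.ofReal (-G q)),
      ← expect_const (P q) (ENNReal.ofReal (G q)), ← expect_add, ← expect_add]
    exact expect_mono_of_mem_support (point q)
  have fin : ∀ f : State n → ℝ, Integrable f π.toMeasure →
      expect π (fun q => ENNReal.ofReal (f q)) ≠ ∞ := fun f hf => by
    rw [← lintegral_toMeasure]; exact hf.lintegral_lt_top.ne
  rw [integral_eq_lintegral_pos_part_sub_lintegral_neg_part hg,
    integral_eq_lintegral_pos_part_sub_lintegral_neg_part hG]
  simp only [lintegral_toMeasure]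
  have m := ENNReal.toReal_mono (ENNReal.add_ne_top.2 ⟨by simpa using fin _ hg.neg, fin _ hG⟩) main
  have fg := fin _ hg.neg
  have fG := fin _ hG.neg
  simp only [Pi.neg_apply] at fg fG
  rw [ENNReal.toReal_add (fin _ hg) fG, ENNReal.toReal_add fg (fin _ hG)] at m
  linarith

/-- The unused service `uᵢⱼ`. -/
noncomputable def unused (q : State n) (a : Fin n × Fin n → Bool) (s : Schedule n)
    (ij : Fin n × Fin n) : ℝ :=
  if q ij = 0 ∧ a ij = false ∧ s.1 ij = 1 then 1 else 0

theorem next_apply (q : State n) (a : Fin n × Fin n → Bool) (s : Schedule n)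
    (ij : Fin n × Fin n) :
    (next q a s ij : ℝ) = q ij + arr a ij - s.1 ij + unused q a s ij := by
  unfold next unused arr
  rcases s.2.1 ij with hs | hs <;> cases ha : a ij <;> rcases Nat.eq_zero_or_pos (q ij) with hq | hq
  all_goals
    first
    | simp [hs, hq]; done
    | simp [hs, hq.ne', Nat.cast_sub (Nat.one_le_iff_ne_zero.2 hq.ne')]

end

/-! ## The lower bound for an arbitrary policy -/

section LowerBound

/-- The function `r (r + 1)`, continued linearly beyond `N`. -/
noncomputable def truncSq (N r : ℕ) : ℝ :=
  if r ≤ N then (r : ℝ) * (r + 1) else 2 * N * r - N ^ 2 + N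

/-- Convexity: r(r + 1) increases by 2r into r and by 2r + 2 out of r, so 2r is a subgradient on the
integers; the continuation beyond N has slope 2N. -/
theorem truncSq_tangent (N R y : ℕ) :
    truncSq N R + 2 * (min R N : ℕ) * ((y : ℝ) - R) ≤ truncSq N y := by
  unfold truncSq
  rcases le_or_gt R N with hR | hR <;> rcases le_or_gt y N with hy | hy
  · rw [if_pos hR, if_pos hy, min_eq_left hR]
    rcases le_or_gt R y with h | h
    · have : (R : ℝ) ≤ y := by exact_mod_cast h
      nlinarith
    · have : (y : ℝ) + 1 ≤ R := by exact_mod_cast h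
      nlinarith
  · rw [if_pos hR, if_neg hy.not_ge, min_eq_left hR]
    have h1 : (R : ℝ) ≤ N := by exact_mod_cast hR
    have h2 : (N : ℝ) + 1 ≤ y := by exact_mod_cast hy
    nlinarith
  · rw [if_neg hR.not_ge, if_pos hy, min_eq_right hR.le]
    have h1 : (y : ℝ) ≤ N := by exact_mod_cast hy
    rcases hy.lt_or_eq with h | h
    · have h2 : (y : ℝ) + 1 ≤ N := by exact_mod_cast h
      nlinarith
    · rw [h]; nlinarith
  · rw [if_neg hR.not_ge, if_neg hy.not_ge, min_eq_right hR.le]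
    linarith

theorem truncSq_mono (N : ℕ) : Monotone (truncSq N) := fun x y h => by
  have h1 := truncSq_tangent N x y
  have h2 : (x : ℝ) ≤ y := by exact_mod_cast h
  have h3 : 0 ≤ 2 * ((min x N : ℕ) : ℝ) * ((y : ℝ) - x) :=
    mul_nonneg (by positivity) (by linarith)
  linarith

theorem truncSq_of_le {N r : ℕ} (h : r ≤ N) : truncSq N r = r * (r + 1) := if_pos h

theorem truncSq_nonneg (N r : ℕ) : 0 ≤ truncSq N r := by
  have := truncSq_mono N (Nat.zero_le r)
  simpa [truncSq_of_le (Nat.zero_le N)] using this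

theorem truncSq_le (N r : ℕ) : truncSq N r ≤ 2 * N * r + N := by
  have hN : (0 : ℝ) ≤ N := N.cast_nonneg
  have hr : (0 : ℝ) ≤ r := r.cast_nonneg
  unfold truncSq
  split_ifs with h
  · have : (r : ℝ) ≤ N := by exact_mod_cast h
    nlinarith
  · nlinarith

/-! ### Row sums and the drift of their truncated squares -/

variable {n : ℕ}

/-- The number of packets queued at an input port. -/
def rowSum (q : State n) (i : Fin n) : ℕ := ∑ j, q (i, j)

theorem total_eq_sum_rowSum (q : State n) : total q = ∑ i, rowSum q i :=
  Fintype.sum_prod_type _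

theorem sum_arr_row_eq (a : Fin n × Fin n → Bool) (i : Fin n) :
    ∑ j, arr a (i, j) = ∑ ij ∈ Finset.univ.image (fun j => (i, j)), arr a ij := by
  rw [Finset.sum_image fun x _ y _ h => (Prod.mk.inj h).2]

theorem card_image_row (i : Fin n) :
    (Finset.univ.image fun j : Fin n => (i, j)).card = n := by
  rw [Finset.card_image_of_injective _ fun x y h => (Prod.mk.inj h).2, Finset.card_fin]

theorem arrivalMean_row (p : ℝ) (i : Fin n) :
    arrivalMean n p (fun a => ∑ j, arr a (i, j)) = n * p := by
  simp only [sum_arr_row_eq, arrivalMean_sum_arr, card_image_row]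

theorem arrivalMean_row_sq (p : ℝ) (i : Fin n) :
    arrivalMean n p (fun a => (∑ j, arr a (i, j)) ^ 2) = (n * p) ^ 2 + n * (p - p ^ 2) := by
  simp only [sum_arr_row_eq, arrivalMean_sum_arr_sq, card_image_row]

theorem le_rowSum_next (q : State n) (a : Fin n × Fin n → Bool) (s : Schedule n) (i : Fin n) :
    rowSum q i + ∑ j, (a (i, j)).toNat ≤ rowSum (next q a s) i + 1 := by
  calc rowSum q i + ∑ j, (a (i, j)).toNat = ∑ j, (q (i, j) + (a (i, j)).toNat) :=
        Finset.sum_add_distrib.symm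
    _ ≤ ∑ j, (next q a s (i, j) + s.1 (i, j)) :=
        Finset.sum_le_sum fun j _ => by unfold next; omega
    _ = rowSum (next q a s) i + ∑ j, s.1 (i, j) := Finset.sum_add_distrib
    _ ≤ _ := Nat.add_le_add_left (s.2.2.1 i) _

theorem le_arrivalMean_truncSq (hn : 1 ≤ n) {ε : ℝ} (h0 : 0 < ε) (h1 : ε < 1) (m : ℕ)
    (q : State n) (s : Schedule n) (i : Fin n) :
    truncSq (m + n) (rowSum q i) - 2 * ε * rowSum q i + (1 - ε) ^ 2 * (1 - 1 / (n : ℝ)) -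
        (1 - ε) ^ 2 * (1 - 1 / (n : ℝ)) * (rowSum q i / (m + 1)) ≤
      arrivalMean n (rate n ε) fun a => truncSq (m + n) (rowSum (next q a s) i) := by
  have hn' : (1 : ℝ) ≤ n := by exact_mod_cast hn
  have hnp : (n : ℝ) * rate n ε = 1 - ε := by rw [rate_eq hn h0 h1]; field_simp
  have hp2 : (n : ℝ) * (rate n ε : ℝ) ^ 2 = (1 - ε) ^ 2 / n := by
    rw [rate_eq hn h0 h1]; field_simp
  set p : ℝ := (rate n ε : ℝ) with hp
  have hp0 : 0 ≤ p := (rate n ε).2.1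
  have hp1 : p ≤ 1 := (rate n ε).2.2
  set R := rowSum q i with hR
  set v := (1 - ε) ^ 2 * (1 - 1 / (n : ℝ)) with hv
  have hv0 : 0 ≤ v := mul_nonneg (sq_nonneg _) (by
    rw [sub_nonneg, div_le_one (by linarith)]; exact hn')
  have hA : ∀ a : Fin n × Fin n → Bool,
      ((∑ j, (a (i, j)).toNat : ℕ) : ℝ) = ∑ j, arr a (i, j) := fun a => by
    push_cast; rfl
  -- For R ≤ m the load R + A - 1 stays below m + n, where nothing is truncated. For R > m the term
  -- v(1 - R/(m + 1)) is nonpositive, so the tangent line suffices.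
  rcases le_or_gt R m with h | h
  · have hpt : ∀ a, (R : ℝ) ^ 2 - R + ((2 * R - 1) * ∑ j, arr a (i, j) +
        (∑ j, arr a (i, j)) ^ 2) ≤ truncSq (m + n) (rowSum (next q a s) i) := by
      intro a
      have hle := le_rowSum_next q a s i
      rw [← hA]
      set A := ∑ j, (a (i, j)).toNat with hAdef
      have hAn : A ≤ n := by
        refine (Finset.sum_le_sum fun j _ => Bool.toNat_le (a (i, j))).trans ?_
        simp
      -- The reason for r(r + 1) instead of r²: it takes the same value 0 at -1 and at 0, so an idle
      -- empty port costs nothing.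
      rcases Nat.eq_zero_or_pos (R + A) with h00 | hpos
      · have hR0 : R = 0 := by omega
        have hA0 : A = 0 := by omega
        rw [hR0, hA0]
        simpa using truncSq_nonneg _ _
      · have hy : R + A - 1 ≤ rowSum (next q a s) i := by omega
        refine le_trans (le_of_eq ?_) (truncSq_mono (m + n) hy)
        rw [truncSq_of_le (by omega), Nat.cast_sub hpos]
        push_cast
        ring
    refine le_trans ?_ (arrivalMean_mono hp0 hp1 hpt)
    rw [arrivalMean_add, arrivalMean_const, arrivalMean_add, arrivalMean_const_mul,
      arrivalMean_row, arrivalMean_row_sq, truncSq_of_le (by omega), mul_sub, hp2, hnp]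
    have : 0 ≤ v * ((R : ℝ) / (m + 1)) := by positivity
    have e : v = (1 - ε) ^ 2 - (1 - ε) ^ 2 / n := by rw [hv]; ring
    nlinarith
  · have hpt : ∀ a, (truncSq (m + n) R - 2 * (min R (m + n) : ℕ)) +
        2 * (min R (m + n) : ℕ) * ∑ j, arr a (i, j) ≤
          truncSq (m + n) (rowSum (next q a s) i) := by
      intro a
      refine le_trans ?_ (truncSq_tangent (m + n) R _)
      have hle : (R : ℝ) + ∑ j, arr a (i, j) ≤ rowSum (next q a s) i + 1 := by
        rw [← hA]; exact_mod_cast le_rowSum_next q a s i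
      have : 2 * ((min R (m + n) : ℕ) : ℝ) * ((∑ j, arr a (i, j)) - 1) ≤
          2 * ((min R (m + n) : ℕ) : ℝ) * ((rowSum (next q a s) i : ℝ) - R) :=
        mul_le_mul_of_nonneg_left (by linarith) (by positivity)
      linarith
    refine le_trans ?_ (arrivalMean_mono hp0 hp1 hpt)
    rw [arrivalMean_add, arrivalMean_const, arrivalMean_const_mul, arrivalMean_row, hnp]
    have hmin : ((min R (m + n) : ℕ) : ℝ) ≤ R := by exact_mod_cast min_le_left _ _
    have hRm : 1 ≤ (R : ℝ) / (m + 1) := by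
      rw [le_div_iff₀ (by positivity), one_mul]; exact_mod_cast h
    nlinarith [mul_le_mul_of_nonneg_left hRm hv0, mul_le_mul_of_nonneg_left hmin h0.le]

theorem meanTotal_eq_lintegral (π : PMF (State n)) :
    meanTotal π = ∫⁻ q, ENNReal.ofReal (total q) ∂π.toMeasure := by
  simp [meanTotal]

theorem integrable_total {π : PMF (State n)} (h : meanTotal π ≠ ∞) :
    Integrable (fun q : State n => (total q : ℝ)) π.toMeasure := by
  refine ⟨Measurable.of_discrete.aestronglyMeasurable, ?_⟩
  rw [hasFiniteIntegral_iff_ofReal (ae_of_all _ fun q => by positivity),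
    ← meanTotal_eq_lintegral]
  exact h.lt_top

theorem ofReal_integral_total {π : PMF (State n)} (h : meanTotal π ≠ ∞) :
    ENNReal.ofReal (∫ q, (total q : ℝ) ∂π.toMeasure) = meanTotal π := by
  rw [ofReal_integral_eq_lintegral_ofReal (integrable_total h)
    (ae_of_all _ fun q => by positivity), meanTotal_eq_lintegral]

/-- The truncated square is integrable as soon as the mean is finite, so its stationary drift
vanishes. The truncation costs vμ/(m + 1), which disappears as m grows. -/
theorem le_integral_rowSum (hn : 1 ≤ n) {ε : ℝ} (h0 : 0 < ε) (h1 : ε < 1) {P : Policy n}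
    {π : PMF (State n)} (hπ : IsStationary (step ε P) π) (hfin : meanTotal π ≠ ∞) (i : Fin n) :
    (1 - ε) ^ 2 * (1 - 1 / (n : ℝ)) ≤
      2 * ε * ∫ q, (rowSum q i : ℝ) ∂π.toMeasure := by
  set v := (1 - ε) ^ 2 * (1 - 1 / (n : ℝ)) with hv
  have hI : Integrable (fun q : State n => (rowSum q i : ℝ)) π.toMeasure := by
    refine (integrable_total hfin).mono' Measurable.of_discrete.aestronglyMeasurable
      (ae_of_all _ fun q => ?_)
    rw [Real.norm_of_nonneg (by positivity), total_eq_sum_rowSum]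
    exact_mod_cast Finset.single_le_sum (f := fun i => rowSum q i)
      (fun _ _ => Nat.zero_le _) (Finset.mem_univ i)
  have hIt : ∀ N, Integrable (fun q : State n => truncSq N (rowSum q i)) π.toMeasure := by
    intro N
    refine ((hI.const_mul (2 * N : ℝ)).add (integrable_const (N : ℝ))).mono'
      Measurable.of_discrete.aestronglyMeasurable (ae_of_all _ fun q => ?_)
    rw [Real.norm_of_nonneg (truncSq_nonneg _ _)]
    exact truncSq_le _ _
  set μ := ∫ q, (rowSum q i : ℝ) ∂π.toMeasure with hμ
  have key : ∀ m : ℕ, v ≤ 2 * ε * μ + v * μ * (1 / ((m : ℝ) + 1)) := by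
    intro m
    have h := hπ.integral_le (g := fun q => -truncSq (m + n) (rowSum q i))
      (G := fun q => -truncSq (m + n) (rowSum q i) +
        ((2 * ε + v * (1 / ((m : ℝ) + 1))) * rowSum q i - v)) (hIt _).neg
      ((hIt _).neg.add ((hI.const_mul _).sub (integrable_const _))) (fun q s _ => by
        have h2 := le_arrivalMean_truncSq hn h0 h1 m q s i
        have h3 := arrivalMean_const_mul (n := n) (rate n ε) (-1)
          (fun a => truncSq (m + n) (rowSum (next q a s) i))
        simp only [neg_one_mul] at h3
        rw [h3]
        have e : v * (1 / ((m : ℝ) + 1)) * rowSum q i = v * (rowSum q i / (m + 1)) := by ring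
        linarith)
    have hN : Integrable (fun q : State n => -truncSq (m + n) (rowSum q i)) π.toMeasure :=
      (hIt _).neg
    have hL : Integrable (fun q : State n =>
        (2 * ε + v * (1 / ((m : ℝ) + 1))) * (rowSum q i : ℝ)) π.toMeasure := hI.const_mul _
    have hLv : Integrable (fun q : State n =>
        (2 * ε + v * (1 / ((m : ℝ) + 1))) * (rowSum q i : ℝ) - v) π.toMeasure :=
      hL.sub (integrable_const _)
    rw [integral_add hN hLv, integral_sub hL (integrable_const _), integral_const_mul] at h
    simp only [integral_const, probReal_univ, one_smul] at h
    rw [← hμ] at h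
    linarith
  have lim : Tendsto (fun m : ℕ => 2 * ε * μ + v * μ * (1 / ((m : ℝ) + 1))) atTop
      (𝓝 (2 * ε * μ + v * μ * 0)) :=
    (tendsto_one_div_add_atTop_nhds_zero_nat.const_mul _).const_add _
  rw [mul_zero, add_zero] at lim
  exact ge_of_tendsto' lim key

theorem le_meanTotal (hn : 1 ≤ n) {ε : ℝ} (h0 : 0 < ε) (h1 : ε < 1) {P : Policy n}
    {π : PMF (State n)} (hπ : IsStationary (step ε P) π) :
    ENNReal.ofReal ((1 - ε) ^ 2 / (2 * ε) * ((n : ℝ) - 1)) ≤ meanTotal π := by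
  by_cases hfin : meanTotal π = ∞
  · rw [hfin]; exact le_top
  have hn' : (0 : ℝ) < n := by exact_mod_cast hn
  rw [← ofReal_integral_total hfin]
  refine ENNReal.ofReal_le_ofReal ?_
  have hI : ∀ i : Fin n, Integrable (fun q : State n => (rowSum q i : ℝ)) π.toMeasure := by
    intro i
    refine (integrable_total hfin).mono' Measurable.of_discrete.aestronglyMeasurable
      (ae_of_all _ fun q => ?_)
    rw [Real.norm_of_nonneg (by positivity), total_eq_sum_rowSum]
    exact_mod_cast Finset.single_le_sum (f := fun i => rowSum q i)
      (fun _ _ => Nat.zero_le _) (Finset.mem_univ i)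
  have e : ∫ q, (total q : ℝ) ∂π.toMeasure =
      ∑ i, ∫ q, (rowSum q i : ℝ) ∂π.toMeasure := by
    rw [← integral_finsetSum _ fun i _ => hI i]
    simp only [total_eq_sum_rowSum, Nat.cast_sum]
  rw [e]
  have hrow : ∀ i : Fin n, (1 - ε) ^ 2 * (1 - 1 / (n : ℝ)) / (2 * ε) ≤
      ∫ q, (rowSum q i : ℝ) ∂π.toMeasure := fun i => by
    rw [div_le_iff₀ (by positivity)]
    linarith [le_integral_rowSum hn h0 h1 hπ hfin i]
  have := Finset.sum_le_sum fun i (_ : i ∈ Finset.univ) => hrow i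
  rw [Finset.sum_const, Finset.card_fin, nsmul_eq_mul] at this
  refine le_trans (le_of_eq ?_) this
  field_simp

end LowerBound

/-! ## Exponential moments from a quadratic drift -/

section Drift

variable {n : ℕ}

/-- Converts a change of w² into a change of exp(θw). The derivative θ(exp(θw) - 1) of exp(θw) - θw
vanishes at w = 0, which makes the conversion factor after division by 2w bounded near 0; that is
why θw is subtracted. At w = 0 the convention x / 0 = 0 gives the correct factor for the inequality.
-/
theorem exp_sub_le_of_sq {θ w w' D : ℝ} (hw : 0 ≤ w) (hθ : 0 ≤ θ) (hD : |w' - w| ≤ D)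
    (hθD : θ * D ≤ 1) :
    Real.exp (θ * w') - θ * w' ≤ Real.exp (θ * w) - θ * w +
      θ * (Real.exp (θ * w) - 1) / (2 * w) * (w' ^ 2 - w ^ 2) +
        Real.exp (θ * w) * (θ ^ 2 * D ^ 2) := by
  have hd : |θ * (w' - w)| ≤ 1 := by
    rw [abs_mul, abs_of_nonneg hθ]
    exact (mul_le_mul_of_nonneg_left hD hθ).trans hθD
  have h1 := (abs_le.1 (Real.abs_exp_sub_one_sub_id_le hd)).2
  have h2 : (θ * (w' - w)) ^ 2 ≤ θ ^ 2 * D ^ 2 := by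
    rw [mul_pow, ← sq_abs (w' - w)]
    gcongr
  have e : Real.exp (θ * w') = Real.exp (θ * w) * Real.exp (θ * (w' - w)) := by
    rw [← Real.exp_add]; ring_nf
  have hexp := Real.exp_pos (θ * w)
  have h3 : Real.exp (θ * w') ≤ Real.exp (θ * w) * (1 + θ * (w' - w) + θ ^ 2 * D ^ 2) := by
    rw [e]
    exact mul_le_mul_of_nonneg_left (by linarith) hexp.le
  have h4 : θ * (Real.exp (θ * w) - 1) * (w' - w) ≤
      θ * (Real.exp (θ * w) - 1) / (2 * w) * (w' ^ 2 - w ^ 2) := by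
    rcases hw.eq_or_lt with h | h
    · simp [← h]
    · have h5 : 1 ≤ Real.exp (θ * w) := Real.one_le_exp (mul_nonneg hθ hw)
      rw [div_mul_eq_mul_div, le_div_iff₀ (by positivity), mul_assoc]
      refine mul_le_mul_of_nonneg_left ?_ (mul_nonneg hθ (by linarith))
      nlinarith [sq_nonneg (w' - w)]
  nlinarith

/-- The function `h` has bounded increments, and its square has a negative drift that is
proportional to `h`. -/
structure HasDrift (ε : ℝ) (P : Policy n) (h : State n → ℝ) (κ C D : ℝ) : Prop where
  nonneg : ∀ q, 0 ≤ h q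
  abs_sub_le : ∀ q, ∀ s ∈ (P q).support, ∀ a, |h (next q a s) - h q| ≤ D
  mean_sq_le : ∀ q, ∀ s ∈ (P q).support,
    arrivalMean n (rate n ε) (fun a => h (next q a s) ^ 2) ≤ h q ^ 2 - κ * h q + C

theorem id_le_exp (x : ℝ) : 0 ≤ Real.exp x - x := by linarith [Real.add_one_le_exp x]

namespace HasDrift

variable {ε : ℝ} {P : Policy n} {h : State n → ℝ} {κ C D : ℝ}

/-- The conversion factor g satisfies g w = θ(exp(θw) - 1)/2, which turns -κw into exponential
decay, and g ≤ θ² exp(θw)/2, so that C and D² enter only at order θ². -/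
theorem arrivalMean_exp_le (hh : HasDrift ε P h κ C D) (hC : 0 ≤ C) {θ : ℝ} (hθ : 0 ≤ θ)
    (hθD : θ * D ≤ 1) (q : State n) {s : Schedule n} (hs : s ∈ (P q).support) :
    arrivalMean n (rate n ε)
        (fun a => Real.exp (θ * h (next q a s)) - θ * h (next q a s)) ≤
      Real.exp (θ * h q) - θ * h q + θ * κ / 2 -
        (θ * κ / 2 - θ ^ 2 * (C / 2 + D ^ 2)) * Real.exp (θ * h q) := by
  set w := h q with hw
  have hw0 : 0 ≤ w := hh.nonneg q
  set g := θ * (Real.exp (θ * w) - 1) / (2 * w) with hg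
  have hexp1 : 1 ≤ Real.exp (θ * w) := Real.one_le_exp (mul_nonneg hθ hw0)
  have hg0 : 0 ≤ g := div_nonneg (mul_nonneg hθ (by linarith)) (by linarith)
  have hgw : g * w = θ * (Real.exp (θ * w) - 1) / 2 := by
    rcases hw0.eq_or_lt with h0 | h0
    · simp [← h0]
    · rw [hg]; field_simp
  have hg1 : g ≤ θ ^ 2 * Real.exp (θ * w) / 2 := by
    rcases hw0.eq_or_lt with h0 | h0
    · rw [hg, ← h0]; simp; positivity
    · have h1 : Real.exp (θ * w) - 1 ≤ θ * w * Real.exp (θ * w) := by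
        have h2 := Real.add_one_le_exp (-(θ * w))
        have h3 : Real.exp (θ * w) * Real.exp (-(θ * w)) = 1 := by
          rw [← Real.exp_add]; simp
        nlinarith [Real.exp_pos (θ * w)]
      rw [hg, div_le_iff₀ (by positivity)]
      nlinarith [mul_le_mul_of_nonneg_left h1 hθ]
  have hpt : ∀ a, Real.exp (θ * h (next q a s)) - θ * h (next q a s) ≤
      (Real.exp (θ * w) - θ * w - g * w ^ 2 + Real.exp (θ * w) * (θ ^ 2 * D ^ 2)) +
        g * h (next q a s) ^ 2 := fun a => by
    have := exp_sub_le_of_sq hw0 hθ (hh.abs_sub_le q s hs a) hθD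
    rw [← hg] at this
    linarith
  refine (arrivalMean_mono (rate n ε).2.1 (rate n ε).2.2 hpt).trans ?_
  rw [arrivalMean_add, arrivalMean_const, arrivalMean_const_mul]
  have hm := mul_le_mul_of_nonneg_left (hh.mean_sq_le q s hs) hg0
  have hgC := mul_le_mul_of_nonneg_right hg1 hC
  rw [← hw] at hm
  have e : g * (w ^ 2 - κ * w + C) = g * w ^ 2 - κ * (g * w) + g * C := by ring
  rw [e, hgw] at hm
  linarith

/-- Stationary exponential moments. -/
theorem expect_exp_le (hh : HasDrift ε P h κ C D) (hC : 0 ≤ C) {θ α : ℝ} (hθ : 0 ≤ θ)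
    (hθD : θ * D ≤ 1) (hκ : 0 ≤ κ) (hα : 0 < α)
    (hα' : α ≤ θ * κ / 2 - θ ^ 2 * (C / 2 + D ^ 2))
    {π : PMF (State n)} (hπ : IsStationary (step ε P) π) :
    expect π (fun q => ENNReal.ofReal (Real.exp (θ * h q))) ≤
      ENNReal.ofReal (θ * κ / 2 / α) := by
  have key := hπ.expect_le_of_drift
    (F := fun q => ENNReal.ofReal (Real.exp (θ * h q) - θ * h q))
    (G := fun q => ENNReal.ofReal α * ENNReal.ofReal (Real.exp (θ * h q)))
    (b := ENNReal.ofReal (θ * κ / 2)) (fun _ => ENNReal.ofReal_ne_top) (fun q => by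
      have h1 : ∀ s ∈ (P q).support, arrivalMean n (rate n ε)
          (fun a => Real.exp (θ * h (next q a s)) - θ * h (next q a s)) ≤
          Real.exp (θ * h q) - θ * h q + θ * κ / 2 - α * Real.exp (θ * h q) := fun s hs =>
        (hh.arrivalMean_exp_le hC hθ hθD q hs).trans (by
          have := mul_le_mul_of_nonneg_right hα' (Real.exp_pos (θ * h q)).le
          linarith)
      have h2 := expect_step_le ε P q (fun q => id_le_exp (θ * h q)) h1
      have h3 : 0 ≤ Real.exp (θ * h q) - θ * h q + θ * κ / 2 - α * Real.exp (θ * h q) := by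
        obtain ⟨s, hs⟩ := (P q).support_nonempty
        refine le_trans ?_ (h1 s hs)
        rw [← arrivalMean_const (n := n) (rate n ε) 0]
        exact arrivalMean_mono (rate n ε).2.1 (rate n ε).2.2 fun a => id_le_exp _
      rw [← ENNReal.ofReal_mul hα.le]
      refine (add_le_add_left h2 _).trans ?_
      rw [← ENNReal.ofReal_add h3 (by positivity), ← ENNReal.ofReal_add (id_le_exp _)
        (by positivity)]
      exact ENNReal.ofReal_le_ofReal (by linarith))
  rw [expect_const_mul] at key
  rw [div_eq_inv_mul, ENNReal.ofReal_mul (by positivity), ENNReal.ofReal_inv_of_pos hα,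
    ← ENNReal.div_eq_inv_mul]
  rw [mul_comm] at key
  exact ENNReal.le_div_iff_mul_le (Or.inl (by simpa using hα)) (Or.inl ENNReal.ofReal_ne_top)
    |>.2 key

/-- A geometric drift. -/
theorem expect_step_le (hh : HasDrift ε P h κ C D) (hC : 0 ≤ C) {θ α : ℝ} (hθ : 0 ≤ θ)
    (hθD : θ * D ≤ 1) (hα : 0 ≤ α)
    (hα' : α ≤ θ * κ / 2 - θ ^ 2 * (C / 2 + D ^ 2)) (q : State n) :
    expect (step ε P q) (fun q => ENNReal.ofReal (Real.exp (θ * h q) - θ * h q)) ≤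
      ENNReal.ofReal ((1 - α) * (Real.exp (θ * h q) - θ * h q) + θ * κ / 2) := by
  refine Switch.expect_step_le ε P q (fun q => id_le_exp (θ * h q)) fun s hs =>
    (hh.arrivalMean_exp_le hC hθ hθD q hs).trans ?_
  have h1 := mul_le_mul_of_nonneg_right hα' (Real.exp_pos (θ * h q)).le
  have h2 : 0 ≤ α * (θ * h q) := mul_nonneg hα (mul_nonneg hθ (hh.nonneg q))
  linarith

end HasDrift

/-- Moments from an exponential moment. -/
theorem integrable_pow_of_expect_exp {π : PMF (State n)} {h : State n → ℝ} (h0 : ∀ q, 0 ≤ h q)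
    {θ B : ℝ} (hθ : 0 < θ) (hB : 0 ≤ B)
    (hE : expect π (fun q => ENNReal.ofReal (Real.exp (θ * h q))) ≤ ENNReal.ofReal B) (r : ℕ) :
    Integrable (fun q => h q ^ r) π.toMeasure ∧
      ∫ q, h q ^ r ∂π.toMeasure ≤ B * (r.factorial * (1 / θ) ^ r) := by
  rw [← lintegral_toMeasure] at hE
  have hexp : Integrable (fun q => Real.exp (θ * h q)) π.toMeasure := by
    refine ⟨Measurable.of_discrete.aestronglyMeasurable, ?_⟩
    rw [hasFiniteIntegral_iff_ofReal (ae_of_all _ fun q => (Real.exp_pos _).le)]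
    exact hE.trans_lt ENNReal.ofReal_lt_top
  have hexpB : ∫ q, Real.exp (θ * h q) ∂π.toMeasure ≤ B := by
    rw [integral_eq_lintegral_of_nonneg_ae (ae_of_all _ fun q => (Real.exp_pos _).le)
      hexp.aestronglyMeasurable]
    exact ENNReal.toReal_le_of_le_ofReal hB hE
  set c : ℝ := r.factorial * (1 / θ) ^ r with hc
  have hc0 : 0 ≤ c := by positivity
  have hpt : ∀ q, h q ^ r ≤ c * Real.exp (θ * h q) := fun q => by
    have := Real.pow_div_factorial_le_exp (θ * h q) (mul_nonneg hθ.le (h0 q)) r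
    have h2 := mul_le_mul_of_nonneg_left this hc0
    refine le_trans (le_of_eq ?_) h2
    rw [hc, mul_pow, one_div, inv_pow]
    have : (r.factorial : ℝ) ≠ 0 := by positivity
    field_simp
  have hint : Integrable (fun q => h q ^ r) π.toMeasure :=
    (hexp.const_mul c).mono' Measurable.of_discrete.aestronglyMeasurable (ae_of_all _ fun q => by
      rw [Real.norm_of_nonneg (pow_nonneg (h0 q) r)]; exact hpt q)
  refine ⟨hint, (integral_mono hint (hexp.const_mul c) hpt).trans ?_⟩
  rw [integral_const_mul, mul_comm]
  exact mul_le_mul_of_nonneg_right hexpB hc0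

end Drift

/-! ## The weight of maximum perfect matchings -/

section MaxWeight

variable {n : ℕ}

theorem sum_mul_permSchedule (x : Fin n × Fin n → ℝ) (σ : Equiv.Perm (Fin n)) :
    ∑ ij, x ij * (permSchedule σ).1 ij = ∑ i, x (i, σ i) := by
  simp [permSchedule, Fintype.sum_prod_type]

/-- Birkhoff–von Neumann: a doubly stochastic matrix is a convex combination of permutation
matrices, none of which has larger weight. -/
theorem sum_mul_le_of_doublyStochastic {q : State n} {σ : Equiv.Perm (Fin n)}
    (hσ : σ ∈ maxWeightPerms q) {M : Matrix (Fin n) (Fin n) ℝ}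
    (hM : M ∈ doublyStochastic ℝ (Fin n)) :
    ∑ ij, (q ij : ℝ) * M ij.1 ij.2 ≤ ∑ ij, (q ij : ℝ) * (permSchedule σ).1 ij := by
  obtain ⟨c, hc0, hc1, hcM⟩ := exists_eq_sum_perm_of_mem_doublyStochastic hM
  have hw : ∀ τ : Equiv.Perm (Fin n), ∑ i, (q (i, τ i) : ℝ) ≤ ∑ i, (q (i, σ i) : ℝ) := by
    intro τ
    simp only [maxWeightPerms, Finset.mem_filter, Finset.mem_univ, true_and] at hσ
    have := hσ τ
    unfold weight at this
    exact_mod_cast this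
  have e : ∀ ij : Fin n × Fin n, M ij.1 ij.2 =
      ∑ τ, c τ * (permSchedule τ).1 ij := by
    intro ij
    rw [← hcM, Matrix.sum_apply]
    refine Finset.sum_congr rfl fun τ _ => ?_
    simp [permSchedule, PEquiv.toMatrix_apply, Equiv.toPEquiv_apply]
  calc ∑ ij, (q ij : ℝ) * M ij.1 ij.2
      = ∑ τ, c τ * ∑ ij, (q ij : ℝ) * (permSchedule τ).1 ij := by
        simp only [e, Finset.mul_sum]
        rw [Finset.sum_comm]
        exact Finset.sum_congr rfl fun τ _ => Finset.sum_congr rfl fun ij _ => by ring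
    _ ≤ ∑ τ, c τ * ∑ ij, (q ij : ℝ) * (permSchedule σ).1 ij := by
        refine Finset.sum_le_sum fun τ _ => mul_le_mul_of_nonneg_left ?_ (hc0 τ)
        rw [sum_mul_permSchedule, sum_mul_permSchedule]
        exact hw τ
    _ = _ := by rw [← Finset.sum_mul, hc1, one_mul]

/-- The maximum weight bounds the weight of all doubly substochastic matrices. -/
theorem sum_mul_le_of_substochastic {q : State n} {σ : Equiv.Perm (Fin n)}
    (hσ : σ ∈ maxWeightPerms q) {m : Fin n × Fin n → ℝ} (h0 : ∀ ij, 0 ≤ m ij)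
    (hr : ∀ i, ∑ j, m (i, j) ≤ 1) (hc : ∀ j, ∑ i, m (i, j) ≤ 1) :
    ∑ ij, (q ij : ℝ) * m ij ≤ ∑ ij, (q ij : ℝ) * (permSchedule σ).1 ij := by
  set d : ℝ := ∑ i, (1 - ∑ j, m (i, j)) with hd
  have hd' : d = ∑ j, (1 - ∑ i, m (i, j)) := by
    rw [hd, Finset.sum_sub_distrib, Finset.sum_sub_distrib, Finset.sum_comm]
  have hr0 : ∀ i, 0 ≤ 1 - ∑ j, m (i, j) := fun i => sub_nonneg.2 (hr i)
  have hc0 : ∀ j, 0 ≤ 1 - ∑ i, m (i, j) := fun j => sub_nonneg.2 (hc j)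
  have hd0 : 0 ≤ d := Finset.sum_nonneg fun i _ => hr0 i
  -- The rank-one matrix of row deficits times column deficits, divided by the common total deficit
  -- d, fills all deficits at once. If d = 0 all deficits vanish and the quotient is 0.
  let M : Matrix (Fin n) (Fin n) ℝ := fun i j =>
    m (i, j) + (1 - ∑ k, m (i, k)) * (1 - ∑ k, m (k, j)) / d
  have hrow : ∀ i, (1 - ∑ k, m (i, k)) * d / d = 1 - ∑ k, m (i, k) := fun i => by
    rcases hd0.eq_or_lt with h | h
    · have := (Finset.sum_eq_zero_iff_of_nonneg fun i _ => hr0 i).1 (hd ▸ h.symm) i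
        (Finset.mem_univ i)
      rw [this]; simp
    · field_simp
  have hcol : ∀ j, (1 - ∑ k, m (k, j)) * d / d = 1 - ∑ k, m (k, j) := fun j => by
    rcases hd0.eq_or_lt with h | h
    · have := (Finset.sum_eq_zero_iff_of_nonneg fun i _ => hc0 i).1 (hd' ▸ h.symm) j
        (Finset.mem_univ j)
      rw [this]; simp
    · field_simp
  have hM : M ∈ doublyStochastic ℝ (Fin n) := by
    rw [mem_doublyStochastic_iff_sum]
    refine ⟨fun i j => add_nonneg (h0 _) (div_nonneg (mul_nonneg (hr0 i) (hc0 j)) hd0),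
      fun i => ?_, fun j => ?_⟩
    · simp only [M]
      rw [Finset.sum_add_distrib, ← Finset.sum_div, ← Finset.mul_sum, ← hd', hrow]
      ring
    · simp only [M]
      rw [Finset.sum_add_distrib, ← Finset.sum_div, ← Finset.sum_mul, ← hd, mul_comm d, hcol]
      ring
  refine le_trans (Finset.sum_le_sum fun ij _ => ?_) (sum_mul_le_of_doublyStochastic hσ hM)
  refine mul_le_mul_of_nonneg_left ?_ (Nat.cast_nonneg _)
  exact le_add_of_nonneg_right (div_nonneg (mul_nonneg (hr0 _) (hc0 _)) hd0)

theorem mem_support_maxWeight {q : State n} {s : Schedule n}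
    (hs : s ∈ (maxWeight n q).support) : ∃ σ ∈ maxWeightPerms q, permSchedule σ = s := by
  simpa [maxWeight, PMF.support_map] using hs

end MaxWeight

/-! ## The projection onto the cone -/

section Projection

variable {n : ℕ}

theorem toVec_apply (q : State n) (ij : Fin n × Fin n) : toVec q ij = q ij := rfl

theorem para_mem (x : Vec n) : para x ∈ cone n := (exists_proj x).choose_spec.1

theorem norm_perp_le (x : Vec n) {z : Vec n} (hz : z ∈ cone n) : ‖perp x‖ ≤ ‖x - z‖ :=
  (exists_proj x).choose_spec.2 z hz

theorem add_mem_cone {x y : Vec n} (hx : x ∈ cone n) (hy : y ∈ cone n) : x + y ∈ cone n := by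
  rw [mem_cone_iff] at *
  refine ⟨fun ij => add_nonneg (hx.1 ij) (hy.1 ij), fun i j k l => ?_⟩
  have h1 := hx.2 i j k l
  have h2 := hy.2 i j k l
  simp only [PiLp.add_apply]
  linarith

theorem smul_mem_cone {x : Vec n} (hx : x ∈ cone n) {c : ℝ} (hc : 0 ≤ c) : c • x ∈ cone n := by
  rw [mem_cone_iff] at *
  refine ⟨fun ij => mul_nonneg hc (hx.1 ij), fun i j k l => ?_⟩
  have h1 := hx.2 i j k l
  simp only [PiLp.smul_apply, smul_eq_mul]
  linear_combination c * h1

theorem convex_cone : Convex ℝ (cone n) := fun _ hx _ hy _ _ ha hb _ =>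
  add_mem_cone (smul_mem_cone hx ha) (smul_mem_cone hy hb)

/-- The variational inequality for projection onto a convex set. Taking z = 0 and z = 2x∥ makes x⊥
orthogonal to x∥, and then x⊥ lies in the polar cone. -/
theorem inner_perp_sub_le (x : Vec n) {z : Vec n} (hz : z ∈ cone n) :
    inner ℝ (perp x) (z - para x) ≤ 0 := by
  have hne : Nonempty (cone n) := ⟨⟨_, para_mem x⟩⟩
  refine (norm_eq_iInf_iff_real_inner_le_zero convex_cone (para_mem x)).1 ?_ z hz
  refine le_antisymm (le_ciInf fun w => norm_perp_le x w.2) ?_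
  exact ciInf_le ⟨0, by rintro _ ⟨w, rfl⟩; exact norm_nonneg _⟩ (⟨_, para_mem x⟩ : cone n)

theorem inner_perp_para (x : Vec n) : inner ℝ (perp x) (para x) = 0 := by
  have h0 : (0 : Vec n) ∈ cone n := by simpa using smul_mem_cone (para_mem x) le_rfl
  have h1 := inner_perp_sub_le x h0
  have h2 := inner_perp_sub_le x (add_mem_cone (para_mem x) (para_mem x))
  rw [add_sub_cancel_right] at h2
  rw [zero_sub, inner_neg_right] at h1
  linarith

theorem inner_perp_le (x : Vec n) {z : Vec n} (hz : z ∈ cone n) :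
    inner ℝ (perp x) z ≤ 0 := by
  have h1 := inner_perp_sub_le x hz
  rw [inner_sub_right, inner_perp_para] at h1
  linarith

theorem inner_eq_sum (x y : Vec n) : inner ℝ x y = ∑ ij, x ij * y ij := by
  rw [PiLp.inner_apply]
  exact Finset.sum_congr rfl fun ij _ => mul_comm _ _

theorem para_nonneg (x : Vec n) (ij : Fin n × Fin n) : 0 ≤ para x ij :=
  ((mem_cone_iff _).1 (para_mem x)).1 ij

theorem rowVec_mem_cone (i : Fin n) : rowVec i ∈ cone n :=
  ⟨Pi.single i 1, 0, fun k => by by_cases h : k = i <;> simp [h], by simp, by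
    simp [Pi.single_apply]⟩

theorem colVec_mem_cone (j : Fin n) : colVec j ∈ cone n :=
  ⟨0, Pi.single j 1, by simp, fun k => by by_cases h : k = j <;> simp [h], by
    simp [Pi.single_apply]⟩

/-- The row indicator lies in the cone and x⊥ in its polar. This sign keeps 1/n + c x⊥ within the
row constraint for c ≥ 0. -/
theorem sum_row_perp_le (x : Vec n) (i : Fin n) : ∑ j, perp x (i, j) ≤ 0 := by
  have := inner_perp_le x (rowVec_mem_cone i)
  rw [inner_eq_sum, Fintype.sum_prod_type] at this
  simpa [rowVec] using this

theorem sum_col_perp_le (x : Vec n) (j : Fin n) : ∑ i, perp x (i, j) ≤ 0 := by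
  have := inner_perp_le x (colVec_mem_cone j)
  rw [inner_eq_sum, Fintype.sum_prod_type] at this
  simpa [colVec] using this

theorem sum_mul_perp_self (x : Vec n) : ∑ ij, x ij * perp x ij = ‖perp x‖ ^ 2 := by
  rw [← inner_eq_sum, ← real_inner_self_eq_norm_sq]
  have h : x = perp x + para x := by simp [perp]
  conv_lhs => rw [h]
  rw [inner_add_left, ← h, real_inner_comm _ (para x), inner_perp_para, add_zero]

/-- The distance to a set is 1-Lipschitz. -/
theorem abs_norm_perp_sub_le (x y : Vec n) : |‖perp x‖ - ‖perp y‖| ≤ ‖x - y‖ := by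
  have h : ∀ x y : Vec n, ‖perp x‖ ≤ ‖x - y‖ + ‖perp y‖ := fun x y => by
    refine (norm_perp_le x (para_mem y)).trans ?_
    have e : x - para y = (x - y) + perp y := by simp [perp]
    rw [e]
    exact norm_add_le _ _
  rw [abs_le]
  have h1 := h x y
  have h2 := h y x
  rw [norm_sub_rev] at h2
  constructor <;> linarith

/-- The row and column sums of `1/n - s` vanish for a perfect matching `s`. -/
theorem sum_mul_eq_zero_of_mem_cone (hn : 1 ≤ n) {z : Vec n} (hz : z ∈ cone n)
    (σ : Equiv.Perm (Fin n)) :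
    ∑ ij, z ij * (1 / (n : ℝ) - (permSchedule σ).1 ij) = 0 := by
  have hn' : (n : ℝ) ≠ 0 := by positivity
  obtain ⟨w, v, -, -, rfl⟩ := hz
  have e : ∀ ij : Fin n × Fin n,
      (∑ i, w i • rowVec i + ∑ j, v j • colVec j : Vec n) ij = w ij.1 + v ij.2 := by
    intro ij
    simp [rowVec, colVec]
  simp only [e, mul_sub, Finset.sum_sub_distrib]
  rw [sum_mul_permSchedule (fun ij => w ij.1 + v ij.2), ← Finset.sum_mul, Fintype.sum_prod_type]
  simp only [Finset.sum_add_distrib, Finset.sum_const, Finset.card_fin, nsmul_eq_mul,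
    ← Finset.mul_sum]
  rw [Equiv.sum_comp σ v]
  field_simp
  ring

end Projection

/-! ## Drift of the queue lengths under MaxWeight -/

section

variable {n : ℕ}

theorem unused_nonneg (q : State n) (a : Fin n × Fin n → Bool) (s : Schedule n)
    (ij : Fin n × Fin n) : 0 ≤ unused q a s ij := by
  unfold unused; split_ifs <;> simp

theorem sq_next_sub_le (q : State n) (a : Fin n × Fin n → Bool) (s : Schedule n)
    (ij : Fin n × Fin n) :
    ((next q a s ij : ℝ) - q ij) ^ 2 ≤ arr a ij + s.1 ij ∧
      ((next q a s ij : ℝ) - q ij) ^ 2 ≤ 1 := by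
  rw [next_apply]
  unfold unused arr
  rcases s.2.1 ij with hs | hs <;> cases ha : a ij <;> by_cases hq : q ij = 0 <;>
    simp [hs, hq]

theorem norm_toVec_next_sub_le (q : State n) (a : Fin n × Fin n → Bool) (s : Schedule n) :
    ‖toVec (next q a s) - toVec q‖ ≤ n := by
  refine abs_le_of_sq_le_sq' ?_ (Nat.cast_nonneg n) |>.2
  rw [EuclideanSpace.real_norm_sq_eq]
  refine (Finset.sum_le_sum fun ij _ => (sq_next_sub_le q a s ij).2).trans (le_of_eq ?_)
  simp [pow_two]

/-- The one-step change of a squared distance. -/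
theorem arrivalMean_sum_sq_le {p : ℝ} (h0 : 0 ≤ p) (h1 : p ≤ 1) {q : State n}
    {y : Fin n × Fin n → ℝ} (hy : ∀ ij, q ij = 0 → y ij ≤ 0) (s : Schedule n) :
    arrivalMean n p (fun a => ∑ ij, (y ij + ((next q a s ij : ℝ) - q ij)) ^ 2) ≤
      ∑ ij, y ij ^ 2 + 2 * ∑ ij, y ij * (p - s.1 ij) +
        ((n : ℝ) ^ 2 * p + ∑ ij, (s.1 ij : ℝ)) := by
  have hpt : ∀ a ij, (y ij + ((next q a s ij : ℝ) - q ij)) ^ 2 ≤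
      (y ij ^ 2 - 2 * y ij * s.1 ij + s.1 ij) + (2 * y ij + 1) * arr a ij := by
    intro a ij
    have e1 := (sq_next_sub_le q a s ij).1
    -- Unused service occurs only where q is zero, and there y ≤ 0, so its contribution to the cross
    -- term is nonpositive.
    have e2 : y ij * ((next q a s ij : ℝ) - q ij) ≤ y ij * (arr a ij - s.1 ij) := by
      rw [next_apply]
      by_cases h : q ij = 0
      · have := mul_nonneg_of_nonpos_of_nonpos (hy ij h)
          (neg_nonpos.2 (unused_nonneg q a s ij))
        nlinarith
      · simp [unused, h]
        apply le_of_eq; ring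
    nlinarith
  refine (arrivalMean_mono h0 h1 fun a => Finset.sum_le_sum fun ij _ => hpt a ij).trans ?_
  rw [arrivalMean_sum]
  simp only [arrivalMean_add, arrivalMean_const, arrivalMean_const_mul, arrivalMean_arr]
  apply le_of_eq
  simp only [Finset.sum_add_distrib, Finset.sum_sub_distrib, mul_sub, Finset.mul_sum, add_mul,
    Finset.sum_const, Finset.card_univ, Fintype.card_prod, Fintype.card_fin, nsmul_eq_mul, one_mul]
  push_cast
  simp only [mul_assoc]
  ring

theorem sum_permSchedule (σ : Equiv.Perm (Fin n)) :
    ∑ ij, ((permSchedule σ).1 ij : ℝ) = n := by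
  simpa using sum_mul_permSchedule (fun _ => 1) σ

/-- The competitor to the chosen matching is 1/n + z; the hypotheses say exactly that it is doubly
substochastic. -/
theorem sum_mul_sub_le (hn : 1 ≤ n) {q : State n} {σ : Equiv.Perm (Fin n)}
    (hσ : σ ∈ maxWeightPerms q) {z : Fin n × Fin n → ℝ} (hz : ∀ ij, -(1 / (n : ℝ)) ≤ z ij)
    (hr : ∀ i, ∑ j, z (i, j) ≤ 0) (hc : ∀ j, ∑ i, z (i, j) ≤ 0) :
    ∑ ij, (q ij : ℝ) * (1 / (n : ℝ) - (permSchedule σ).1 ij) ≤ -∑ ij, (q ij : ℝ) * z ij := by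
  have hn' : (n : ℝ) ≠ 0 := by positivity
  have := sum_mul_le_of_substochastic hσ (m := fun ij => 1 / (n : ℝ) + z ij)
    (fun ij => by linarith [hz ij])
    (fun i => by simp [Finset.sum_add_distrib, hn', hr i])
    (fun j => by simp [Finset.sum_add_distrib, hn', hc j])
  simp only [mul_add, mul_sub, Finset.sum_add_distrib, Finset.sum_sub_distrib] at this ⊢
  linarith

/-- Against the uniform matrix 1/n the arrival rates have slack ε/n in each queue, and ∑q ≥ ‖q‖. The
constant 2n bounds the mean number n(1 - ε) of arrivals plus n services; each queue changes by at
most 1, so the norm changes by at most n. -/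
theorem hasDrift_norm (hn : 1 ≤ n) {ε : ℝ} (h0 : 0 < ε) (h1 : ε < 1) :
    HasDrift ε (maxWeight n) (fun q => ‖toVec q‖) (2 * ε / n) (2 * n) n where
  nonneg q := norm_nonneg _
  abs_sub_le q s _ a := (abs_norm_sub_norm_le _ _).trans (norm_toVec_next_sub_le q a s)
  mean_sq_le q s hs := by
    obtain ⟨σ, hσ, rfl⟩ := mem_support_maxWeight hs
    have hn' : (0 : ℝ) < n := by exact_mod_cast hn
    have key := arrivalMean_sum_sq_le (rate n ε).2.1 (rate n ε).2.2 (q := q)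
      (y := fun ij => (q ij : ℝ)) (fun ij h => by simp [h]) (permSchedule σ)
    simp only [add_sub_cancel] at key
    simp only [EuclideanSpace.real_norm_sq_eq, toVec_apply]
    refine key.trans ?_
    rw [sum_permSchedule, rate_eq hn h0 h1]
    have e1 := sum_mul_sub_le hn hσ (z := fun _ => 0) (fun _ => by simp) (by simp) (by simp)
    simp only [mul_zero, Finset.sum_const_zero, neg_zero] at e1
    have e2 : ∑ ij, (q ij : ℝ) * ((1 - ε) / n - (permSchedule σ).1 ij) =
        ∑ ij, (q ij : ℝ) * (1 / (n : ℝ) - (permSchedule σ).1 ij) -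
          ε / n * ∑ ij, (q ij : ℝ) := by
      rw [Finset.mul_sum, ← Finset.sum_sub_distrib]
      exact Finset.sum_congr rfl fun ij _ => by ring
    have e3 : ‖toVec q‖ ≤ ∑ ij, (q ij : ℝ) := by
      refine abs_le_of_sq_le_sq' ?_ (Finset.sum_nonneg fun _ _ => Nat.cast_nonneg _) |>.2
      rw [EuclideanSpace.real_norm_sq_eq]
      exact Finset.sum_sq_le_sq_sum_of_nonneg fun _ _ => Nat.cast_nonneg _
    have e4 := mul_le_mul_of_nonneg_left e3 (div_nonneg h0.le hn'.le)
    have e5 : (n : ℝ) ^ 2 * ((1 - ε) / n) = n - ε * n := by field_simp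
    have e6 : 0 ≤ ε * n := by positivity
    have e7 : 2 * ε / n * ‖toVec q‖ = 2 * (ε / n * ‖toVec q‖) := by ring
    rw [e2, e5, e7]
    linarith

theorem sum_perp_mul_sub_le (hn : 1 ≤ n) {q : State n} {σ : Equiv.Perm (Fin n)}
    (hσ : σ ∈ maxWeightPerms q) :
    ∑ ij, perp (toVec q) ij * (1 / (n : ℝ) - (permSchedule σ).1 ij) ≤
      -(‖perp (toVec q)‖ / n) := by
  have hn' : (0 : ℝ) < n := by exact_mod_cast hn
  set y := perp (toVec q) with hy
  have e1 : ∑ ij, y ij * (1 / (n : ℝ) - (permSchedule σ).1 ij) =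
      ∑ ij, (q ij : ℝ) * (1 / (n : ℝ) - (permSchedule σ).1 ij) := by
    rw [← sub_zero (∑ ij, (q ij : ℝ) * _),
      ← sum_mul_eq_zero_of_mem_cone hn (para_mem (toVec q)) σ, ← Finset.sum_sub_distrib]
    refine Finset.sum_congr rfl fun ij _ => ?_
    rw [← sub_mul, ← toVec_apply]
    rfl
  rw [e1]
  -- Since each |y ij| is at most ‖y‖, this scale keeps 1/n + c y nonnegative. For y = 0 it is 0 by
  -- convention and the bound is trivial.
  set c := 1 / (n * ‖y‖) with hc
  have hc0 : 0 ≤ c := by positivity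
  have hcy : c * ‖y‖ ≤ 1 / n := by
    rcases (norm_nonneg y).eq_or_lt with h | h
    · rw [← h, mul_zero]; positivity
    · rw [hc]; apply le_of_eq; field_simp
  have hz := sum_mul_sub_le hn hσ (z := fun ij => c * y ij)
    (fun ij => by
      have h1 : -‖y‖ ≤ y ij := by
        have := PiLp.norm_apply_le y ij
        rw [Real.norm_eq_abs] at this
        exact neg_le_of_abs_le this
      have := mul_le_mul_of_nonneg_left h1 hc0
      linarith)
    (fun i => by
      rw [← Finset.mul_sum]; exact mul_nonpos_of_nonneg_of_nonpos hc0 (sum_row_perp_le _ i))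
    (fun j => by
      rw [← Finset.mul_sum]; exact mul_nonpos_of_nonneg_of_nonpos hc0 (sum_col_perp_le _ j))
  refine hz.trans (neg_le_neg (le_of_eq ?_))
  have e2 : ∑ ij, (q ij : ℝ) * (c * y ij) = c * ‖y‖ ^ 2 := by
    rw [hy, ← sum_mul_perp_self, Finset.mul_sum]
    exact Finset.sum_congr rfl fun ij _ => by rw [toVec_apply]; ring
  rw [e2]
  rcases (norm_nonneg y).eq_or_lt with h | h
  · simp [← h]
  · rw [hc]; field_simp

theorem neg_sum_perp_le (x : Vec n) : -∑ ij, perp x ij ≤ n * ‖perp x‖ := by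
  have h := real_inner_le_norm (-perp x) (WithLp.toLp 2 fun _ => 1 : Vec n)
  rw [inner_eq_sum, norm_neg] at h
  have e : ‖(WithLp.toLp 2 fun _ => 1 : Vec n)‖ = n := by
    rw [← abs_of_nonneg (norm_nonneg _), ← abs_of_nonneg (Nat.cast_nonneg (α := ℝ) n),
      ← sq_eq_sq_iff_abs_eq_abs, EuclideanSpace.real_norm_sq_eq]
    simp [pow_two]
  rw [e] at h
  simp only [PiLp.neg_apply, mul_one, Finset.sum_neg_distrib] at h
  linarith

/-- The weight advantage contributes -2‖q⊥‖/n and the reduced arrival rate at most 2ε‖q⊥‖; for ε ≤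
1/(2n) at least ‖q⊥‖/n of decay survives, independently of ε. -/
theorem hasDrift_perp (hn : 1 ≤ n) {ε : ℝ} (h0 : 0 < ε) (h1 : ε < 1)
    (h2 : ε ≤ 1 / (2 * (n : ℝ))) :
    HasDrift ε (maxWeight n) (fun q => ‖perp (toVec q)‖) (1 / n) (2 * n) n where
  nonneg q := norm_nonneg _
  abs_sub_le q s _ a := (abs_norm_perp_sub_le _ _).trans (norm_toVec_next_sub_le q a s)
  mean_sq_le q s hs := by
    obtain ⟨σ, hσ, rfl⟩ := mem_support_maxWeight hs
    have hn' : (0 : ℝ) < n := by exact_mod_cast hn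
    set y := perp (toVec q) with hy
    have key := arrivalMean_sum_sq_le (rate n ε).2.1 (rate n ε).2.2 (q := q)
      (y := fun ij => y ij) (fun ij h => by
        have := para_nonneg (toVec q) ij
        have e : y ij = (q ij : ℝ) - para (toVec q) ij := rfl
        rw [e, h]; simpa using this) (permSchedule σ)
    -- The old projection competes with the new one, so only the movement of the queues enters.
    -- Where q is zero, y = -q∥ is nonpositive, as the general squared-distance bound requires.
    have hpt : ∀ a, ‖perp (toVec (next q a (permSchedule σ)))‖ ^ 2 ≤
        ∑ ij, (y ij + ((next q a (permSchedule σ) ij : ℝ) - q ij)) ^ 2 := fun a => by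
      have := pow_le_pow_left₀ (norm_nonneg _)
        (norm_perp_le (toVec (next q a (permSchedule σ))) (para_mem (toVec q))) 2
      refine this.trans (le_of_eq ?_)
      rw [EuclideanSpace.real_norm_sq_eq]
      refine Finset.sum_congr rfl fun ij _ => ?_
      have e : y ij = (q ij : ℝ) - para (toVec q) ij := rfl
      rw [PiLp.sub_apply, toVec_apply, e]
      ring
    refine (arrivalMean_mono (rate n ε).2.1 (rate n ε).2.2 hpt).trans (key.trans ?_)
    rw [sum_permSchedule, rate_eq hn h0 h1, ← EuclideanSpace.real_norm_sq_eq]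
    have e1 := sum_perp_mul_sub_le hn hσ
    rw [← hy] at e1
    have e2 : ∑ ij, y ij * ((1 - ε) / n - (permSchedule σ).1 ij) =
        ∑ ij, y ij * (1 / (n : ℝ) - (permSchedule σ).1 ij) + ε / n * -∑ ij, y ij := by
      rw [mul_neg, ← sub_eq_add_neg, Finset.mul_sum, ← Finset.sum_sub_distrib]
      exact Finset.sum_congr rfl fun ij _ => by ring
    have e4 := mul_le_mul_of_nonneg_left (neg_sum_perp_le (toVec q)) (div_nonneg h0.le hn'.le)
    rw [← hy] at e4
    have e5 : (n : ℝ) ^ 2 * ((1 - ε) / n) = n - ε * n := by field_simp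
    have e6 : 0 ≤ ε * n := by positivity
    have e7 : ε / n * (n * ‖y‖) = ε * ‖y‖ := by field_simp
    have e8 := mul_le_mul_of_nonneg_right h2 (norm_nonneg y)
    have e9 : 1 / (2 * (n : ℝ)) * ‖y‖ = ‖y‖ / n / 2 := by field_simp
    have e10 : 1 / (n : ℝ) * ‖y‖ = ‖y‖ / n := by ring
    rw [e2, e5, e10]
    linarith

end

section MaxWeightChain

variable {n : ℕ}

/-! ## Ergodicity under MaxWeight -/

/-- A transposition covers any given nonempty queue, so the maximum weight is positive and at least
one packet is served. -/
theorem exists_pos_of_mem_maxWeightPerms {q : State n} (hq : q ≠ 0) {σ : Equiv.Perm (Fin n)}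
    (hσ : σ ∈ maxWeightPerms q) : ∃ i, 0 < q (i, σ i) := by
  obtain ⟨⟨i, j⟩, hij⟩ := Function.ne_iff.1 hq
  simp only [maxWeightPerms, Finset.mem_filter, Finset.mem_univ, true_and] at hσ
  have h1 : q (i, j) ≤ weight q (Equiv.swap i j) := by
    have := Finset.single_le_sum (f := fun k => q (k, Equiv.swap i j k))
      (fun _ _ => Nat.zero_le _) (Finset.mem_univ i)
    simpa [weight] using this
  have h2 : 0 < weight q σ :=
    (Nat.pos_of_ne_zero hij).trans_le (h1.trans (hσ _))
  obtain ⟨k, -, hk⟩ := Finset.exists_ne_zero_of_sum_ne_zero h2.ne'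
  exact ⟨k, Nat.pos_of_ne_zero hk⟩

theorem total_next_le {q : State n} {σ : Equiv.Perm (Fin n)} (hσ : σ ∈ maxWeightPerms q) {t : ℕ}
    (h : total q ≤ t + 1) : total (next q (fun _ => false) (permSchedule σ)) ≤ t := by
  have hle : ∀ ij, next q (fun _ => false) (permSchedule σ) ij ≤ q ij := fun ij => by
    simp [next]
  by_cases hq : q = 0
  · have : total (next q (fun _ => false) (permSchedule σ)) = 0 := by
      refine Finset.sum_eq_zero fun ij _ => Nat.le_zero.1 ((hle ij).trans ?_)
      simp [hq]
    omega
  · obtain ⟨i, hi⟩ := exists_pos_of_mem_maxWeightPerms hq hσ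
    have : total (next q (fun _ => false) (permSchedule σ)) < total q := by
      refine Finset.sum_lt_sum (fun ij _ => hle ij) ⟨(i, σ i), Finset.mem_univ _, ?_⟩
      simp only [next, permSchedule, Bool.toNat_false, add_zero, if_true]
      omega
    omega

theorem total_eq_zero_iff {q : State n} : total q = 0 ↔ q = 0 := by
  simp [total, funext_iff]

/-- With no arrivals for t slots, an event of probability δ^t, the total drops by one per slot until
the switch is empty, and then stays there. Hence a single time t serves all states with at most t
packets. -/
theorem exists_pow_le_law (hn : 1 ≤ n) {ε : ℝ} (h0 : 0 < ε) (h1 : ε < 1) :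
    ∃ δ : ℝ, 0 < δ ∧ ∀ (t : ℕ) (q : State n), total q ≤ t →
      ENNReal.ofReal (δ ^ t) ≤ law (step ε (maxWeight n)) (PMF.pure q) t 0 := by
  classical
  have hn' : (1 : ℝ) ≤ n := by exact_mod_cast hn
  have hp : (rate n ε : ℝ) < 1 := by
    rw [rate_eq hn h0 h1, div_lt_one (by linarith)]; linarith
  set δ := arrivalProb n (rate n ε) fun _ => false with hδ
  have hδ0 : 0 < δ := by
    simp only [hδ, arrivalProb]
    exact Finset.prod_pos fun _ _ => by simpa using hp
  refine ⟨δ, hδ0, fun t => ?_⟩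
  induction t with
  | zero =>
    intro q hq
    rw [total_eq_zero_iff.1 (Nat.le_zero.1 hq)]
    simp [law]
  | succ t ih =>
    intro q hq
    rw [← expect_ite, expect_law_succ, expect_step,
      ← expect_const (maxWeight n q) (ENNReal.ofReal (δ ^ (t + 1)))]
    refine expect_mono_of_mem_support fun s hs => ?_
    obtain ⟨σ, hσ, rfl⟩ := mem_support_maxWeight hs
    simp only [expect_ite]
    refine le_trans ?_ (Finset.single_le_sum (fun _ _ => zero_le)
      (Finset.mem_univ fun _ => false))
    rw [pow_succ', ENNReal.ofReal_mul hδ0.le]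
    gcongr
    exact ih _ (total_next_le hσ hq)

theorem total_le_norm (q : State n) : (total q : ℝ) ≤ n * ‖toVec q‖ := by
  have h := real_inner_le_norm (toVec q) (WithLp.toLp 2 fun _ => 1 : Vec n)
  rw [inner_eq_sum] at h
  have e : ‖(WithLp.toLp 2 fun _ => 1 : Vec n)‖ = n := by
    rw [← abs_of_nonneg (norm_nonneg _), ← abs_of_nonneg (Nat.cast_nonneg (α := ℝ) n),
      ← sq_eq_sq_iff_abs_eq_abs, EuclideanSpace.real_norm_sq_eq]
    simp [pow_two]
  rw [e, mul_comm] at h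
  simpa [total, toVec_apply] using h

theorem exists_total_le {θ : ℝ} (hθ : 0 < θ) (R : ℝ) : ∃ T : ℕ, ∀ q : State n,
    Real.exp (θ * ‖toVec q‖) - θ * ‖toVec q‖ ≤ R → total q ≤ T := by
  refine ⟨⌊n * ((2 * R + 1) / θ)⌋₊, fun q hq => Nat.le_floor ((total_le_norm q).trans ?_)⟩
  refine mul_le_mul_of_nonneg_left ?_ (Nat.cast_nonneg _)
  have hx : 0 ≤ θ * ‖toVec q‖ := by positivity
  have h1 := Real.quadratic_le_exp_of_nonneg hx
  rw [le_div_iff₀ hθ]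
  nlinarith [sq_nonneg (θ * ‖toVec q‖ - 1)]

theorem finite_total_le (T : ℕ) : {q : State n | total q ≤ T}.Finite := by
  refine (Set.finite_Icc (0 : State n) fun _ => T).subset fun q hq => ⟨zero_le, fun ij => ?_⟩
  exact (Finset.single_le_sum (f := q) (fun _ _ => Nat.zero_le _) (Finset.mem_univ ij)).trans hq

/-- With C = 2n and D = n the loss is θ² n(n + 1); the choice θ = κ/(4n(n + 1)) makes it half of the
gain θκ/2, leaving α = θκ/4. -/
theorem exists_exponent (hn : 1 ≤ n) {ε : ℝ} (h0 : 0 < ε) (h1 : ε < 1) :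
    ∃ θ α : ℝ, 0 < θ ∧ 0 < α ∧ α < 1 ∧ θ * n ≤ 1 ∧
      α ≤ θ * (2 * ε / n) / 2 - θ ^ 2 * (2 * n / 2 + (n : ℝ) ^ 2) := by
  have hn' : (1 : ℝ) ≤ n := by exact_mod_cast hn
  have hκ : 2 * ε / n ≤ 2 := by
    rw [div_le_iff₀ (by linarith)]; nlinarith
  have hκ0 : 0 < 2 * ε / n := by positivity
  set κ := 2 * ε / n with hκd
  set θ := κ / (4 * (n * (n + 1))) with hθ
  have hθ0 : 0 < θ := by positivity
  have e1 : θ * (n * (n + 1)) = κ / 4 := by rw [hθ]; field_simp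
  have e2 : θ * n ≤ 1 := by nlinarith [mul_pos hθ0 (by linarith : (0 : ℝ) < n)]
  have e3 : θ ≤ 1 := by nlinarith
  refine ⟨θ, θ * κ / 4, hθ0, by positivity, by nlinarith, e2, ?_⟩
  have e4 : θ ^ 2 * (2 * n / 2 + (n : ℝ) ^ 2) = θ * (κ / 4) := by rw [← e1]; ring
  rw [e4]
  linarith

theorem exists_stationary_maxWeight (hn : 1 ≤ n) {ε : ℝ} (h0 : 0 < ε) (h1 : ε < 1) :
    ∃ π : PMF (State n), IsPositiveRecurrentFrom (step ε (maxWeight n)) 0 ∧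
      IsStationary (step ε (maxWeight n)) π ∧
      ∀ μ₀ : PMF (State n), ConvergesInDistribution (law (step ε (maxWeight n)) μ₀) π := by
  have hn' : (1 : ℝ) ≤ n := by exact_mod_cast hn
  obtain ⟨θ, α, hθ, hα, hα1, hθn, hαθ⟩ := exists_exponent hn h0 h1
  obtain ⟨δ, hδ, hreach⟩ := exists_pow_le_law hn h0 h1
  set K := step ε (maxWeight n) with hK
  set V : State n → ℝ := fun q => Real.exp (θ * ‖toVec q‖) - θ * ‖toVec q‖ with hV
  have hV0 : ∀ q, 0 ≤ V q := fun q => id_le_exp _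
  set C := θ * (2 * ε / n) / 2 with hC
  have hC0 : 0 < C := by positivity
  have hd : ∀ q, expect (K q) (fun y => ENNReal.ofReal (V y)) ≤
      ENNReal.ofReal ((1 - α) * V q + C) :=
    (hasDrift_norm hn h0 h1).expect_step_le (by positivity) hθ.le hθn hα.le hαθ
  have hre : ∀ R : ℝ, ∃ T : ℕ, T ≠ 0 ∧ ∃ η : ℝ, 0 < η ∧ ∀ q, V q ≤ R →
      ENNReal.ofReal η ≤ law K (PMF.pure q) T 0 := fun R => by
    obtain ⟨T, hT⟩ := exists_total_le (n := n) hθ R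
    exact ⟨T + 1, T.succ_ne_zero, δ ^ (T + 1), by positivity, fun q hq =>
      hreach _ q ((hT q hq).trans T.le_succ)⟩
  have hfin : ∀ R : ℝ, {q | V q ≤ R}.Finite := fun R => by
    obtain ⟨T, hT⟩ := exists_total_le (n := n) hθ R
    exact (finite_total_le T).subset hT
  obtain ⟨β, e, hβ, he, hmerge⟩ := exists_merging hV0 (by linarith) (by linarith) hC0 hd hre
  obtain ⟨π, hπ⟩ := exists_isStationary hV0 (by linarith) (by linarith) hC0 hd hfin 0 hβ he hmerge
  -- Some state carries mass, and the empty switch is reached from it with positive probability.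
  have hπ0 : π 0 ≠ 0 := by
    classical
    obtain ⟨q, hq⟩ := π.support_nonempty
    rw [← expect_ite, ← hπ.expect_law (total q)]
    simp only [expect_ite]
    refine (lt_of_lt_of_le ?_ (apply_mul_le_expect π _ q)).ne'
    refine ENNReal.mul_pos hq (lt_of_lt_of_le ?_ (hreach _ q le_rfl)).ne'
    rw [ENNReal.ofReal_pos]
    positivity
  exact ⟨π, hπ.isPositiveRecurrentFrom hπ0, hπ, fun μ₀ =>
    convergesInDistribution_of_tendsto_expect fun F hF =>
      tendsto_expect_law he hmerge hπ μ₀ hF⟩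

/-- All moments of the queue lengths are finite in steady state. -/
theorem integrable_norm_pow (hn : 1 ≤ n) {ε : ℝ} (h0 : 0 < ε) (h1 : ε < 1) {π : PMF (State n)}
    (hπ : IsStationary (step ε (maxWeight n)) π) (r : ℕ) :
    Integrable (fun q => ‖toVec q‖ ^ r) π.toMeasure := by
  obtain ⟨θ, α, hθ, hα, -, hθn, hαθ⟩ := exists_exponent hn h0 h1
  have h := (hasDrift_norm hn h0 h1).expect_exp_le (by positivity) hθ.le hθn (by positivity) hα
    hαθ hπ
  exact (integrable_pow_of_expect_exp (fun q => norm_nonneg _) hθ (by positivity) h r).1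

/-! ## State space collapse -/

/-- The sequence r! / (√(2r) (r/e)^r) decreases from its first value e/√2. -/
theorem factorial_le_stirling {r : ℕ} (hr : 1 ≤ r) :
    (r.factorial : ℝ) ≤ Real.exp 1 * √r * (r / Real.exp 1) ^ r := by
  obtain ⟨k, rfl⟩ : ∃ k, r = k + 1 := ⟨r - 1, by omega⟩
  have h := Stirling.stirlingSeq'_antitone (Nat.zero_le k)
  simp only [Function.comp_apply, Nat.succ_eq_add_one, zero_add, Stirling.stirlingSeq_one] at h
  rw [Stirling.stirlingSeq, div_le_iff₀ (by positivity), Real.sqrt_mul (by norm_num)] at h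
  refine h.trans (le_of_eq ?_)
  have : √(2 : ℝ) ≠ 0 := by positivity
  field_simp

theorem Mconst_pow {r : ℕ} (hr : 1 ≤ r) :
    Mconst n r ^ r = 2 * (Real.exp 1 * √r * (r / Real.exp 1) ^ r *
      (16 * (n : ℝ) ^ 2 * (n + 1)) ^ r) := by
  have hr' : (r : ℝ) ≠ 0 := by positivity
  have e : ((2 * √(r : ℝ) * Real.exp 1) ^ (1 / (r : ℝ))) ^ r = 2 * √(r : ℝ) * Real.exp 1 := by
    rw [← Real.rpow_natCast, ← Real.rpow_mul (by positivity), one_div_mul_cancel hr',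
      Real.rpow_one]
  rw [Mconst]
  simp only [mul_pow, e]
  ring

theorem Mconst_nonneg (n r : ℕ) : 0 ≤ Mconst n r := by
  unfold Mconst; positivity

theorem integral_perp_pow_le (hn : 1 ≤ n) {ε : ℝ} (h0 : 0 < ε) (h2 : ε ≤ 1 / (2 * (n : ℝ)))
    {π : PMF (State n)} (hπ : IsStationary (step ε (maxWeight n)) π) {r : ℕ} (hr : 1 ≤ r) :
    Integrable (fun q => ‖perp (toVec q)‖ ^ r) π.toMeasure ∧
      ∫ q, ‖perp (toVec q)‖ ^ r ∂π.toMeasure ≤ Mconst n r ^ r := by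
  have hn' : (1 : ℝ) ≤ n := by exact_mod_cast hn
  have h1 : ε < 1 := h2.trans_lt (by rw [div_lt_one (by linarith)]; linarith)
  -- Here κ = 1/n, so the loss is θκ/16 and α = θκ/4 is admissible; the exponential moment is then
  -- at most (θκ/2)/α = 2, and 1/θ is the factor in `Mconst`.
  set θ : ℝ := 1 / (16 * (n : ℝ) ^ 2 * (n + 1)) with hθ
  have hθ0 : 0 < θ := by positivity
  have e1 : θ * (n * (n + 1)) = 1 / (16 * n) := by rw [hθ]; field_simp
  have e2 : 1 / (16 * (n : ℝ)) = 1 / n / 16 := by field_simp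
  have hnn : 1 / (n : ℝ) ≤ 1 := by rw [div_le_one (by linarith)]; exact hn'
  have hn0 : 0 < 1 / (n : ℝ) := by positivity
  have h := (hasDrift_perp hn h0 h1 h2).expect_exp_le (θ := θ) (α := θ * (1 / n) / 4)
    (by positivity) hθ0.le (by nlinarith [mul_pos hθ0 (by linarith : (0 : ℝ) < n)])
    (by positivity) (by positivity) (by
      have e4 : θ ^ 2 * (2 * n / 2 + (n : ℝ) ^ 2) = θ * (1 / n / 16) := by
        rw [← e2, ← e1]; ring
      rw [e4]
      nlinarith [mul_pos hθ0 hn0]) hπ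
  have e3 : θ * (1 / (n : ℝ)) / 2 / (θ * (1 / n) / 4) = 2 := by
    field_simp; norm_num
  rw [e3] at h
  obtain ⟨hi, hle⟩ := integrable_pow_of_expect_exp (fun q => norm_nonneg _) hθ0 (by norm_num) h r
  refine ⟨hi, hle.trans ?_⟩
  rw [Mconst_pow hr, hθ, one_div_one_div]
  gcongr
  exact factorial_le_stirling hr

end MaxWeightChain

/-! ## The quadratic form vanishing to first order on the cone -/

section Quad

variable {n : ℕ}

/-- The linear map `x ↦ (∑ₗ xᵢₗ + ∑ₖ xₖⱼ - (∑ x) / n)ᵢⱼ`, that is, `n` times the orthogonal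
projection onto the span of the cone. -/
noncomputable def spanMap (x : Fin n × Fin n → ℝ) (ij : Fin n × Fin n) : ℝ :=
  ∑ l, x (ij.1, l) + ∑ k, x (k, ij.2) - (∑ kl, x kl) / n

/-- The sum of the squares of the row and column sums, minus `(∑ x)² / n`. -/
noncomputable def quad (x : Fin n × Fin n → ℝ) : ℝ :=
  ∑ i, (∑ j, x (i, j)) ^ 2 + ∑ j, (∑ i, x (i, j)) ^ 2 - (∑ ij, x ij) ^ 2 / n

/-- The right side is symmetric in x and y, so `spanMap` is self-adjoint; on the diagonal it is
`quad`, which is thus n times the squared norm of the projection. -/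
theorem sum_mul_spanMap (x y : Fin n × Fin n → ℝ) :
    ∑ ij, y ij * spanMap x ij = ∑ i, (∑ j, y (i, j)) * (∑ j, x (i, j)) +
      ∑ j, (∑ i, y (i, j)) * (∑ i, x (i, j)) - (∑ ij, y ij) * (∑ ij, x ij) / n := by
  simp only [spanMap, mul_sub, mul_add, Finset.sum_sub_distrib, Finset.sum_add_distrib]
  congr 1
  · congr 1
    · rw [Fintype.sum_prod_type]
      simp only [Finset.sum_mul]
    · rw [Fintype.sum_prod_type_right]
      simp only [Finset.sum_mul]
  · rw [← Finset.sum_mul, mul_div_assoc]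

theorem quad_add (x y : Fin n × Fin n → ℝ) :
    quad (fun ij => x ij + y ij) = quad x + 2 * ∑ ij, y ij * spanMap x ij + quad y := by
  rw [sum_mul_spanMap]
  simp only [quad, Finset.sum_add_distrib, add_sq]
  have e : ∀ f g : Fin n → ℝ, ∑ i, 2 * f i * g i = 2 * ∑ i, g i * f i := fun f g => by
    rw [Finset.mul_sum]
    exact Finset.sum_congr rfl fun i _ => by ring
  rw [e, e]
  ring

/-- Idempotence: on the row sums, column sums and total that define it, `spanMap` acts as
multiplication by n. -/
theorem sum_spanMap_sq (hn : 1 ≤ n) (x : Fin n × Fin n → ℝ) :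
    ∑ ij, spanMap x ij ^ 2 = n * ∑ ij, x ij * spanMap x ij := by
  have hn' : (n : ℝ) ≠ 0 := by positivity
  have hrow : ∀ i, ∑ j, spanMap x (i, j) = n * ∑ j, x (i, j) := fun i => by
    simp only [spanMap, Finset.sum_sub_distrib, Finset.sum_add_distrib, Finset.sum_const,
      Finset.card_univ, Fintype.card_fin, nsmul_eq_mul]
    rw [Fintype.sum_prod_type_right]
    field_simp
    ring
  have hcol : ∀ j, ∑ i, spanMap x (i, j) = n * ∑ i, x (i, j) := fun j => by
    simp only [spanMap, Finset.sum_sub_distrib, Finset.sum_add_distrib, Finset.sum_const,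
      Finset.card_univ, Fintype.card_fin, nsmul_eq_mul]
    rw [Fintype.sum_prod_type]
    field_simp
    ring
  have htot : ∑ ij, spanMap x ij = n * ∑ ij, x ij := by
    rw [Fintype.sum_prod_type]
    simp only [hrow, ← Finset.mul_sum]
    rw [Fintype.sum_prod_type]
  have e : ∑ ij, spanMap x ij ^ 2 = ∑ ij, spanMap x ij * spanMap x ij :=
    Finset.sum_congr rfl fun ij _ => pow_two _
  rw [e, sum_mul_spanMap, sum_mul_spanMap]
  simp only [hrow, hcol, htot, mul_assoc, ← Finset.mul_sum]
  ring

theorem sum_spanMap_sub_sq_le (hn : 1 ≤ n) (x : Fin n × Fin n → ℝ) :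
    ∑ ij, (spanMap x ij - n * x ij) ^ 2 ≤ (n : ℝ) ^ 2 * ∑ ij, x ij ^ 2 := by
  have e : ∑ ij, (spanMap x ij - n * x ij) ^ 2 =
      ∑ ij, spanMap x ij ^ 2 - 2 * (n * ∑ ij, x ij * spanMap x ij) +
        (n : ℝ) ^ 2 * ∑ ij, x ij ^ 2 := by
    simp only [Finset.mul_sum, ← Finset.sum_sub_distrib, ← Finset.sum_add_distrib]
    exact Finset.sum_congr rfl fun ij _ => by ring
  rw [e, ← sum_spanMap_sq hn]
  have := Finset.sum_nonneg fun ij (_ : ij ∈ Finset.univ) => sq_nonneg (spanMap x ij)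
  linarith

theorem spanMap_of_mem_cone (hn : 1 ≤ n) {z : Vec n} (hz : z ∈ cone n) (ij : Fin n × Fin n) :
    spanMap z ij = n * z ij := by
  have hn' : (n : ℝ) ≠ 0 := by positivity
  obtain ⟨w, v, -, -, rfl⟩ := hz
  have e : ∀ ij : Fin n × Fin n,
      (∑ i, w i • rowVec i + ∑ j, v j • colVec j : Vec n) ij = w ij.1 + v ij.2 := by
    intro ij
    simp [rowVec, colVec]
  simp only [spanMap, e, Fintype.sum_prod_type, Finset.sum_add_distrib, Finset.sum_const,
    Finset.card_univ, Fintype.card_fin, nsmul_eq_mul, ← Finset.mul_sum]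
  field_simp
  ring

/-- The map x ↦ spanMap x - n x annihilates the cone, hence sees only x⊥. -/
theorem spanMap_sub_eq_perp (hn : 1 ≤ n) (x : Vec n) (ij : Fin n × Fin n) :
    spanMap x ij - n * x ij = spanMap (perp x) ij - n * perp x ij := by
  have h := spanMap_of_mem_cone hn (para_mem x) ij
  have e : ∀ kl, perp x kl = x kl - para x kl := fun kl => rfl
  have e2 : spanMap (perp x) ij = spanMap x ij - spanMap (para x) ij := by
    simp only [spanMap, e, Finset.sum_sub_distrib]
    ring
  rw [e2, h, e]
  ring

/-! ## Unused service -/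

/-- The total unused service. -/
noncomputable def unusedTotal (q : State n) (a : Fin n × Fin n → Bool) (s : Schedule n) : ℝ :=
  ∑ ij, unused q a s ij

variable (q : State n) (a : Fin n × Fin n → Bool) (σ : Equiv.Perm (Fin n))

theorem unused_eq_zero_or_one (s : Schedule n) (ij : Fin n × Fin n) :
    unused q a s ij = 0 ∨ unused q a s ij = 1 := by
  unfold unused; split_ifs <;> simp

theorem unused_sq (s : Schedule n) (ij : Fin n × Fin n) :
    unused q a s ij ^ 2 = unused q a s ij := by
  rcases unused_eq_zero_or_one q a s ij with h | h <;> simp [h]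

theorem unused_of_ne {ij : Fin n × Fin n} (h : σ ij.1 ≠ ij.2) :
    unused q a (permSchedule σ) ij = 0 := by
  simp [unused, permSchedule, h]

theorem sum_row_unused (i : Fin n) :
    ∑ j, unused q a (permSchedule σ) (i, j) = unused q a (permSchedule σ) (i, σ i) :=
  Finset.sum_eq_single_of_mem _ (Finset.mem_univ _) fun _ _ h => unused_of_ne q a σ h.symm

theorem sum_col_unused (j : Fin n) :
    ∑ i, unused q a (permSchedule σ) (i, j) = unused q a (permSchedule σ) (σ.symm j, j) :=
  Finset.sum_eq_single_of_mem _ (Finset.mem_univ _) fun _ _ h =>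
    unused_of_ne q a σ fun h' => h ((Equiv.eq_symm_apply σ).2 h')

/-- Unused service is supported on a matching, so each of its row and column sums is 0 or 1 and
equals its own square. -/
theorem quad_unused : quad (unused q a (permSchedule σ)) =
    2 * unusedTotal q a (permSchedule σ) - unusedTotal q a (permSchedule σ) ^ 2 / n := by
  have h1 : ∑ i, (∑ j, unused q a (permSchedule σ) (i, j)) ^ 2 =
      unusedTotal q a (permSchedule σ) := by
    rw [unusedTotal, Fintype.sum_prod_type]
    exact Finset.sum_congr rfl fun i _ => by rw [sum_row_unused, unused_sq]
  have h2 : ∑ j, (∑ i, unused q a (permSchedule σ) (i, j)) ^ 2 =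
      unusedTotal q a (permSchedule σ) := by
    rw [unusedTotal, Fintype.sum_prod_type_right]
    exact Finset.sum_congr rfl fun i _ => by rw [sum_col_unused, unused_sq]
  rw [quad, h1, h2, unusedTotal]
  ring

theorem unusedTotal_nonneg (s : Schedule n) : 0 ≤ unusedTotal q a s :=
  Finset.sum_nonneg fun ij _ => unused_nonneg q a s ij

theorem unusedTotal_le : unusedTotal q a (permSchedule σ) ≤ n := by
  rw [← sum_permSchedule σ]
  refine Finset.sum_le_sum fun ij _ => ?_
  unfold unused
  split_ifs with h
  · simp [h.2.2]
  · exact Nat.cast_nonneg _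

/-- This dichotomy allows √U to be replaced by larger powers of U, down to a bound linear in U. -/
theorem unusedTotal_eq_zero_or_one_le (s : Schedule n) :
    unusedTotal q a s = 0 ∨ 1 ≤ unusedTotal q a s := by
  by_cases h : ∀ ij, unused q a s ij = 0
  · left; simp [unusedTotal, h]
  · right
    push Not at h
    obtain ⟨ij, hij⟩ := h
    rw [← (unused_eq_zero_or_one q a s ij).resolve_left hij]
    exact Finset.single_le_sum (fun kl _ => unused_nonneg q a s kl) (Finset.mem_univ ij)

theorem quad_unused_bounds (hn : 1 ≤ n) :
    unusedTotal q a (permSchedule σ) ≤ quad (unused q a (permSchedule σ)) ∧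
      quad (unused q a (permSchedule σ)) ≤ 2 * unusedTotal q a (permSchedule σ) := by
  have hn' : (0 : ℝ) < n := by exact_mod_cast hn
  have h0 := unusedTotal_nonneg q a (permSchedule σ)
  have h1 := unusedTotal_le q a σ
  have h2 : unusedTotal q a (permSchedule σ) ^ 2 / n ≤ unusedTotal q a (permSchedule σ) := by
    rw [div_le_iff₀ hn']
    nlinarith
  have h3 : 0 ≤ unusedTotal q a (permSchedule σ) ^ 2 / n := by positivity
  rw [quad_unused]
  constructor <;> linarith

theorem unused_mul_next (s : Schedule n) (ij : Fin n × Fin n) :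
    unused q a s ij * (next q a s ij : ℝ) = 0 := by
  unfold unused next
  split_ifs with h
  · simp [h]
  · simp

/-- The unused service is almost orthogonal to the queue lengths: only their component
perpendicular to the cone matters. -/
theorem abs_sum_unused_mul_spanMap_le (hn : 1 ≤ n) (s : Schedule n) :
    |∑ ij, unused q a s ij * spanMap (fun kl => (next q a s kl : ℝ)) ij| ≤
      n * (√(unusedTotal q a s) * ‖perp (toVec (next q a s))‖) := by
  set y := perp (toVec (next q a s)) with hy
  -- Because u vanishes wherever the new queue is nonzero, n times the new queue can be subtracted
  -- freely, and the difference depends only on its perpendicular part. Cauchy–Schwarz finishes.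
  have e : ∑ ij, unused q a s ij * spanMap (fun kl => (next q a s kl : ℝ)) ij =
      ∑ ij, unused q a s ij * (spanMap y ij - n * y ij) := by
    refine Finset.sum_congr rfl fun ij _ => ?_
    rw [hy, ← spanMap_sub_eq_perp hn, mul_sub]
    have h := unused_mul_next q a s ij
    have h' : unused q a s ij * (n * toVec (next q a s) ij) = 0 := by
      rw [toVec_apply, mul_left_comm, h, mul_zero]
    rw [h', sub_zero]
    rfl
  rw [e]
  refine abs_le_of_sq_le_sq ?_ (by positivity)
  refine (Finset.sum_mul_sq_le_sq_mul_sq _ _ _).trans ?_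
  simp only [unused_sq]
  rw [mul_pow, mul_pow, Real.sq_sqrt (unusedTotal_nonneg q a s), EuclideanSpace.real_norm_sq_eq,
    mul_left_comm]
  exact mul_le_mul_of_nonneg_left (sum_spanMap_sub_sq_le hn y) (unusedTotal_nonneg q a s)

/-- One step of the quadratic form. -/
theorem quad_next (s : Schedule n) :
    quad (fun ij => (next q a s ij : ℝ)) = quad (fun ij => (q ij : ℝ)) +
      2 * ∑ ij, (arr a ij - s.1 ij) * spanMap (fun kl => (q kl : ℝ)) ij +
      quad (fun ij => arr a ij - s.1 ij) +
      2 * ∑ ij, unused q a s ij * spanMap (fun kl => (next q a s kl : ℝ)) ij -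
      quad (unused q a s) := by
  have e1 := quad_add (fun ij => (q ij : ℝ)) (fun ij => arr a ij - s.1 ij)
  -- The form is expanded around the new state, not around q + a - s, because it is the new state to
  -- which u is orthogonal; this is also why quad u enters negatively.
  have e2 := quad_add (fun ij => (next q a s ij : ℝ)) (fun ij => -unused q a s ij)
  have e3 : (fun ij => (next q a s ij : ℝ) + -unused q a s ij) =
      fun ij => (q ij : ℝ) + (arr a ij - s.1 ij) := by
    ext ij; rw [next_apply]; ring
  have e4 : quad (fun ij => -unused q a s ij) = quad (unused q a s) := by
    simp [quad, Finset.sum_neg_distrib]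
  rw [e3, e1, e4] at e2
  simp only [neg_mul, Finset.sum_neg_distrib] at e2
  linarith

/-- Packet conservation, through which the stationary mean of the unused service is nε. -/
theorem unusedTotal_eq : unusedTotal q a (permSchedule σ) =
    (total (next q a (permSchedule σ)) : ℝ) - total q - ∑ ij, arr a ij + n := by
  have h : (total (next q a (permSchedule σ)) : ℝ) =
      total q + ∑ ij, arr a ij - n + unusedTotal q a (permSchedule σ) := by
    simp only [total, Nat.cast_sum, next_apply, Finset.sum_add_distrib, Finset.sum_sub_distrib,
      sum_permSchedule]
    rfl
  linarith

/-! ## Averages over the arrivals -/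

theorem sum_arr_col_eq (j : Fin n) :
    ∑ i, arr a (i, j) = ∑ ij ∈ Finset.univ.image (fun i => (i, j)), arr a ij := by
  rw [Finset.sum_image fun x _ y _ h => (Prod.mk.inj h).1]

theorem arrivalMean_col_sq (p : ℝ) (j : Fin n) :
    arrivalMean n p (fun a => (∑ i, arr a (i, j)) ^ 2) = (n * p) ^ 2 + n * (p - p ^ 2) := by
  simp only [sum_arr_col_eq, arrivalMean_sum_arr_sq]
  rw [Finset.card_image_of_injective _ fun x y h => (Prod.mk.inj h).1, Finset.card_fin]

/-- Only the row sums, column sums and total of the increment matter, and these are the same for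
every perfect matching; MaxWeight plays no role in this term. -/
theorem arrivalMean_spanMap {p : ℝ} :
    arrivalMean n p (fun a => ∑ ij, (arr a ij - (permSchedule σ).1 ij) *
      spanMap (fun kl => (q kl : ℝ)) ij) = (n * p - 1) * total q := by
  have e1 : ∑ ij, spanMap (fun kl => (q kl : ℝ)) ij = n * total q := by
    rcases Nat.eq_zero_or_pos n with rfl | hn
    · simp
    have hn' : (n : ℝ) ≠ 0 := by positivity
    have := sum_mul_spanMap (fun kl => (q kl : ℝ)) (fun _ => 1)
    simp only [one_mul, Finset.sum_const, Finset.card_univ, Fintype.card_fin, Fintype.card_prod,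
      nsmul_eq_mul, mul_one, ← Finset.mul_sum] at this
    rw [this, ← Fintype.sum_prod_type (fun x => (q x : ℝ)),
      ← Fintype.sum_prod_type_right (fun x => (q x : ℝ)), total]
    push_cast
    field_simp
    ring
  have e2 : ∑ ij, spanMap (fun kl => (q kl : ℝ)) ij * (permSchedule σ).1 ij = total q := by
    rcases Nat.eq_zero_or_pos n with rfl | hn
    · simp [total]
    have hn' : (n : ℝ) ≠ 0 := by positivity
    rw [sum_mul_permSchedule]
    simp only [spanMap, Finset.sum_sub_distrib, Finset.sum_add_distrib]
    rw [Equiv.sum_comp σ fun j => ∑ k, (q (k, j) : ℝ), ← Fintype.sum_prod_type (fun x => (q x : ℝ)),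
      ← Fintype.sum_prod_type_right (fun x => (q x : ℝ))]
    simp only [Finset.sum_const, Finset.card_univ, Fintype.card_fin, nsmul_eq_mul, total,
      Nat.cast_sum]
    field_simp
    ring
  simp only [sub_mul, Finset.sum_sub_distrib, arrivalMean_sub, arrivalMean_sum,
    arrivalMean_mul_const, arrivalMean_arr, arrivalMean_const, ← Finset.mul_sum]
  simp only [mul_comm ((((permSchedule σ).1 _ : ℕ)) : ℝ)]
  rw [e1, e2]
  ring

theorem arrivalMean_quad {p : ℝ} :
    arrivalMean n p (fun a => quad (fun ij => arr a ij - (permSchedule σ).1 ij)) =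
      2 * n * ((n * p) ^ 2 + n * (p - p ^ 2) - 2 * (n * p) + 1) -
        ((n ^ 2 * p) ^ 2 + n ^ 2 * (p - p ^ 2) - 2 * n * (n ^ 2 * p) + n ^ 2) / n := by
  have hr : ∀ i, ∑ j, ((permSchedule σ).1 (i, j) : ℝ) = 1 := fun i => by simp [permSchedule]
  have hc : ∀ j, ∑ i, ((permSchedule σ).1 (i, j) : ℝ) = 1 := fun j => by
    simp [permSchedule, ← Equiv.eq_symm_apply]
  have ht := arrivalMean_sum_arr_sq (n := n) p Finset.univ
  rw [Finset.card_univ, Fintype.card_prod, Fintype.card_fin] at ht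
  simp only [quad, Finset.sum_sub_distrib, hr, hc, sum_permSchedule, sub_sq, mul_assoc,
    div_eq_mul_inv, arrivalMean_sub, arrivalMean_add, arrivalMean_sum, arrivalMean_mul_const,
    arrivalMean_const_mul, arrivalMean_const, arrivalMean_row_sq, arrivalMean_col_sq,
    arrivalMean_arr] at ht ⊢
  simp only [ht, Finset.sum_const, Finset.card_univ,
    Fintype.card_fin, Fintype.card_prod, nsmul_eq_mul, mul_one, one_pow]
  push_cast
  ring

end Quad

section HeavyTraffic

variable {n : ℕ}

/-! ## The mean total queue length under MaxWeight -/

/-- A linearized form of Hölder's inequality for an integer-like variable `U`. -/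
theorem sqrt_mul_le {U y c : ℝ} {r : ℕ} (hU : U = 0 ∨ 1 ≤ U) (hy : 0 ≤ y) (hc : 0 < c)
    (hr : 2 ≤ r) :
    √U * y ≤ (1 - 1 / (r : ℝ)) * c * U + 1 / r * (c ^ (r - 1))⁻¹ * y ^ r := by
  have hr' : (2 : ℝ) ≤ r := by exact_mod_cast hr
  have hr0 : (r : ℝ) ≠ 0 := by linarith
  have h1r : 1 / (r : ℝ) ≤ 1 / 2 := one_div_le_one_div_of_le two_pos hr'
  rcases hU with rfl | hU
  · simp only [Real.sqrt_zero, zero_mul, mul_zero, zero_add]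
    positivity
  · have hU0 : 0 < U := by linarith
    have h1 := Real.geom_mean_le_arith_mean2_weighted (w₁ := 1 - 1 / (r : ℝ)) (w₂ := 1 / r)
      (p₁ := c * U) (p₂ := (c ^ (r - 1))⁻¹ * y ^ r) (by linarith) (by positivity)
      (by positivity) (by positivity) (by ring)
    -- Since r ≥ 2 the exponent is at least 1/2, and U ≥ 1. Weighted AM–GM applied to cU and y^r /
    -- c^(r-1), where the powers of c cancel, gives the rest.
    have h2 : √U ≤ U ^ (1 - 1 / (r : ℝ)) := by
      rw [Real.sqrt_eq_rpow]
      exact Real.rpow_le_rpow_of_exponent_le hU (by linarith)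
    have h3 : (c * U) ^ (1 - 1 / (r : ℝ)) * ((c ^ (r - 1))⁻¹ * y ^ r) ^ (1 / (r : ℝ)) =
        U ^ (1 - 1 / (r : ℝ)) * y := by
      rw [Real.mul_rpow hc.le hU0.le, Real.mul_rpow (by positivity) (by positivity),
        ← Real.rpow_natCast y, ← Real.rpow_mul hy, mul_one_div_cancel hr0, Real.rpow_one,
        ← Real.rpow_natCast c, ← Real.rpow_neg hc.le, ← Real.rpow_mul hc.le,
        Nat.cast_sub (by omega)]
      have : c ^ (1 - 1 / (r : ℝ)) * c ^ (-((r : ℝ) - (1 : ℕ)) * (1 / (r : ℝ))) = 1 := by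
        rw [← Real.rpow_add hc]
        have : 1 - 1 / (r : ℝ) + -((r : ℝ) - (1 : ℕ)) * (1 / (r : ℝ)) = 0 := by
          field_simp; push_cast; ring
        rw [this, Real.rpow_zero]
      linear_combination U ^ (1 - 1 / (r : ℝ)) * y * this
    rw [h3] at h1
    have := mul_le_mul_of_nonneg_right h2 hy
    linarith

/-- The mean change of the quadratic form caused by arrivals and full service. -/
noncomputable def quadVar (n : ℕ) (ε : ℝ) : ℝ :=
  (2 * n - 1) * ((1 - ε) * (1 - (1 - ε) / n)) + n * ε ^ 2

/-- In `quadVar` the first term is the variance p(1 - p) of an arrival times the trace n(2n - 1) of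
`spanMap`; nε² is the form at the mean increment, whose row and column sums are all -ε. -/
theorem arrivalMean_quad_step (hn : 1 ≤ n) {ε : ℝ} (h0 : 0 < ε) (h1 : ε < 1) (q : State n)
    (σ : Equiv.Perm (Fin n)) :
    arrivalMean n (rate n ε) (fun a => quad (fun ij => (q ij : ℝ)) +
      2 * ∑ ij, (arr a ij - (permSchedule σ).1 ij) * spanMap (fun kl => (q kl : ℝ)) ij +
      quad (fun ij => arr a ij - (permSchedule σ).1 ij)) =
      quad (fun ij => (q ij : ℝ)) - 2 * ε * total q + quadVar n ε := by
  have hn' : (n : ℝ) ≠ 0 := by positivity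
  rw [arrivalMean_add, arrivalMean_add, arrivalMean_const, arrivalMean_const_mul,
    arrivalMean_spanMap, arrivalMean_quad, rate_eq hn h0 h1, quadVar]
  field_simp
  ring

theorem arrivalMean_sum_all (hn : 1 ≤ n) {ε : ℝ} (h0 : 0 < ε) (h1 : ε < 1) :
    arrivalMean n (rate n ε) (fun a => ∑ ij, arr a ij) = n * (1 - ε) := by
  have hn' : (n : ℝ) ≠ 0 := by positivity
  rw [arrivalMean_sum_arr, Finset.card_univ, Fintype.card_prod, Fintype.card_fin, rate_eq hn h0 h1]
  push_cast
  field_simp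

theorem integrable_quad {π : PMF (State n)}
    (h : Integrable (fun q => ‖toVec q‖ ^ 2) π.toMeasure) :
    Integrable (fun q : State n => quad (fun ij => (q ij : ℝ))) π.toMeasure := by
  refine (h.const_mul (3 * (n : ℝ) ^ 2)).mono' Measurable.of_discrete.aestronglyMeasurable
    (ae_of_all _ fun q => ?_)
  have hT : ((total q : ℕ) : ℝ) ^ 2 ≤ n ^ 2 * ‖toVec q‖ ^ 2 := by
    rw [← mul_pow]
    exact pow_le_pow_left₀ (Nat.cast_nonneg _) (total_le_norm q) 2
  have e : ((total q : ℕ) : ℝ) = ∑ ij, (q ij : ℝ) := by simp [total]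
  have h1 : ∑ i, (∑ j, (q (i, j) : ℝ)) ^ 2 ≤ (total q : ℝ) ^ 2 := by
    rw [e, Fintype.sum_prod_type]
    exact Finset.sum_sq_le_sq_sum_of_nonneg fun i _ =>
      Finset.sum_nonneg fun j _ => Nat.cast_nonneg _
  have h2 : ∑ j, (∑ i, (q (i, j) : ℝ)) ^ 2 ≤ (total q : ℝ) ^ 2 := by
    rw [e, Fintype.sum_prod_type_right]
    exact Finset.sum_sq_le_sq_sum_of_nonneg fun i _ =>
      Finset.sum_nonneg fun j _ => Nat.cast_nonneg _
  have h3 : (total q : ℝ) ^ 2 / n ≤ (total q : ℝ) ^ 2 := by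
    rcases Nat.eq_zero_or_pos n with rfl | hn
    · simp
    · exact div_le_self (sq_nonneg _) (by exact_mod_cast hn)
  have h4 : 0 ≤ (total q : ℝ) ^ 2 / n := by positivity
  have h5 : 0 ≤ ∑ i, (∑ j, (q (i, j) : ℝ)) ^ 2 := Finset.sum_nonneg fun _ _ => sq_nonneg _
  have h6 : 0 ≤ ∑ j, (∑ i, (q (i, j) : ℝ)) ^ 2 := Finset.sum_nonneg fun _ _ => sq_nonneg _
  rw [Real.norm_eq_abs, abs_le, quad, ← e]
  constructor <;> linarith

theorem meanTotal_ne_top {π : PMF (State n)}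
    (h : Integrable (fun q => ‖toVec q‖ ^ 1) π.toMeasure) : meanTotal π ≠ ∞ := by
  rw [meanTotal_eq_lintegral]
  have : Integrable (fun q : State n => (total q : ℝ)) π.toMeasure :=
    (h.const_mul (n : ℝ)).mono' Measurable.of_discrete.aestronglyMeasurable
      (ae_of_all _ fun q => by
        rw [Real.norm_of_nonneg (Nat.cast_nonneg _), pow_one]; exact total_le_norm q)
  exact this.lintegral_lt_top.ne

section

variable {ε : ℝ} {π : PMF (State n)} {c : ℝ} {r : ℕ}

theorem abs_two_mul_sum_unused_le (hn : 1 ≤ n) (hc : 0 < c) (hr : 2 ≤ r) (q : State n)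
    (a : Fin n × Fin n → Bool) (s : Schedule n) :
    |2 * ∑ ij, unused q a s ij * spanMap (fun kl => (next q a s kl : ℝ)) ij| ≤
      2 * n * (1 - 1 / (r : ℝ)) * c * unusedTotal q a s +
        2 * n * (1 / r * (c ^ (r - 1))⁻¹) * ‖perp (toVec (next q a s))‖ ^ r := by
  have h1 := abs_sum_unused_mul_spanMap_le q a hn s
  have h2 := sqrt_mul_le (unusedTotal_eq_zero_or_one_le q a s)
    (norm_nonneg (perp (toVec (next q a s)))) hc hr
  have h3 := mul_le_mul_of_nonneg_left h2 (Nat.cast_nonneg (α := ℝ) n)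
  rw [abs_mul, abs_two]
  linarith

/-- Stationarity of `±quad` turned into a one-sided bound; `sgn` is the sign, and `k` the
coefficient with which the unused service enters. -/
theorem stationary_quad_le (hn : 1 ≤ n) (h0 : 0 < ε) (h1 : ε < 1)
    (h2 : ε ≤ 1 / (2 * (n : ℝ))) (hπ : IsStationary (step ε (maxWeight n)) π) (hc : 0 < c)
    (hr : 2 ≤ r) {sgn k : ℝ} (hsgn : |sgn| ≤ 1)
    (hk : ∀ q a σ, -sgn * quad (unused q a (permSchedule σ : Schedule n)) ≤
      k * unusedTotal q a (permSchedule σ)) :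
    sgn * (2 * ε * (meanTotal π).toReal - quadVar n ε) ≤
      (2 * n * (1 - 1 / (r : ℝ)) * c + k) * (n * ε) +
        2 * n * (1 / r * (c ^ (r - 1))⁻¹) * Mconst n r ^ r := by
  set k₁ := 2 * n * (1 - 1 / (r : ℝ)) * c + k with hk₁
  set k₂ := 2 * n * (1 / r * (c ^ (r - 1))⁻¹) with hk₂
  have hk₂0 : 0 ≤ k₂ := by positivity
  have hfin := meanTotal_ne_top (integrable_norm_pow hn h0 h1 hπ 1)
  have iT := integrable_total hfin
  have iQ := integrable_quad (integrable_norm_pow hn h0 h1 hπ 2)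
  obtain ⟨iP, hP⟩ := integral_perp_pow_le hn h0 h2 hπ (show 1 ≤ r by omega)
  have ET : (meanTotal π).toReal = ∫ q, (total q : ℝ) ∂π.toMeasure := by
    rw [← ofReal_integral_total hfin,
      ENNReal.toReal_ofReal (integral_nonneg fun q => Nat.cast_nonneg _)]
  -- Subtracting k₁ · total makes the k₁-multiple of unused service cancel through packet
  -- conservation, leaving its mean nε; subtracting k₂ ‖perp‖^r absorbs the perpendicular part at
  -- the new state, whose moment bound is used after integration.
  have key := hπ.integral_le
    (g := fun q => (sgn * quad (fun ij => (q ij : ℝ)) - k₁ * total q) -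
      k₂ * ‖perp (toVec q)‖ ^ r)
    (G := fun q => (sgn * quad (fun ij => (q ij : ℝ)) - k₁ * total q) -
      (2 * ε * sgn * total q - (sgn * quadVar n ε + k₁ * (n * ε))))
    (((iQ.const_mul sgn).sub (iT.const_mul k₁)).sub (iP.const_mul k₂))
    (((iQ.const_mul sgn).sub (iT.const_mul k₁)).sub
      ((iT.const_mul _).sub (integrable_const _))) (fun q s hs => by
      obtain ⟨σ, -, rfl⟩ := mem_support_maxWeight hs
      have hpt : ∀ a, (sgn * quad (fun ij => (next q a (permSchedule σ) ij : ℝ)) -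
          k₁ * total (next q a (permSchedule σ))) -
            k₂ * ‖perp (toVec (next q a (permSchedule σ)))‖ ^ r ≤
          sgn * (quad (fun ij => (q ij : ℝ)) +
            2 * ∑ ij, (arr a ij - (permSchedule σ).1 ij) * spanMap (fun kl => (q kl : ℝ)) ij +
            quad (fun ij => arr a ij - (permSchedule σ).1 ij)) +
          (k₁ * (n - total q) - k₁ * ∑ ij, arr a ij) := fun a => by
        have e1 := quad_next q a (permSchedule σ)
        have e2 := abs_two_mul_sum_unused_le hn hc hr q a (permSchedule σ)
        have e3 := hk q a σ
        have e4 := unusedTotal_eq q a σ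
        set X := 2 * ∑ ij, unused q a (permSchedule σ) ij *
          spanMap (fun kl => (next q a (permSchedule σ) kl : ℝ)) ij with hX
        have e5 : sgn * X ≤ |X| := by
          refine (le_abs_self _).trans ?_
          rw [abs_mul]
          exact mul_le_of_le_one_left (abs_nonneg _) hsgn
        rw [e1]
        have e6 : k₁ * (total (next q a (permSchedule σ)) : ℝ) =
            k₁ * unusedTotal q a (permSchedule σ) -
              (k₁ * (n - total q) - k₁ * ∑ ij, arr a ij) := by rw [e4]; ring
        have e7 : k₁ * unusedTotal q a (permSchedule σ) =
            2 * n * (1 - 1 / (r : ℝ)) * c * unusedTotal q a (permSchedule σ) +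
              k * unusedTotal q a (permSchedule σ) := by rw [hk₁]; ring
        rw [e6, e7]
        linarith
      refine (arrivalMean_mono (rate n ε).2.1 (rate n ε).2.2 hpt).trans (le_of_eq ?_)
      rw [arrivalMean_add, arrivalMean_const_mul, arrivalMean_quad_step hn h0 h1,
        arrivalMean_sub, arrivalMean_const, arrivalMean_const_mul, arrivalMean_sum_all hn h0 h1]
      ring)
  have iQT : Integrable (fun q : State n =>
      sgn * quad (fun ij => (q ij : ℝ)) - k₁ * total q) π.toMeasure :=
    (iQ.const_mul sgn).sub (iT.const_mul k₁)
  have iTc : Integrable (fun q : State n =>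
      2 * ε * sgn * (total q : ℝ)) π.toMeasure := iT.const_mul _
  have iTcc : Integrable (fun q : State n =>
      2 * ε * sgn * (total q : ℝ) - (sgn * quadVar n ε + k₁ * (n * ε))) π.toMeasure :=
    iTc.sub (integrable_const _)
  rw [integral_sub iQT (iP.const_mul k₂), integral_sub iQT iTcc,
    integral_sub iTc (integrable_const _), integral_const_mul, integral_const_mul (2 * ε * sgn),
    integral_const, probReal_univ, one_smul, ← ET] at key
  have := mul_le_mul_of_nonneg_left hP hk₂0
  linarith

theorem Mconst_pos (hn : 1 ≤ n) (hr : 1 ≤ r) : 0 < Mconst n r := by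
  have : (0 : ℝ) < n := by exact_mod_cast hn
  have : (0 : ℝ) < r := by exact_mod_cast hr
  unfold Mconst
  positivity

/-- The choice of the parameter in `stationary_quad_le`. -/
theorem exists_weight (hn : 1 ≤ n) (h0 : 0 < ε) (hr : 2 ≤ r) : ∃ c : ℝ, 0 < c ∧
    2 * n * (1 - 1 / (r : ℝ)) * c * (n * ε) + 2 * n * (1 / r * (c ^ (r - 1))⁻¹) * Mconst n r ^ r =
      2 * ε * ((n : ℝ) ^ (2 - 1 / (r : ℝ)) * ε ^ (-(1 / (r : ℝ))) * Mconst n r) := by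
  have hn' : (0 : ℝ) < n := by exact_mod_cast hn
  have hM := Mconst_pos hn (show 1 ≤ r by omega)
  have hr0 : (r : ℝ) ≠ 0 := by positivity
  set x := (n * ε) ^ (-(1 / (r : ℝ))) with hx
  have hnε : 0 < n * ε := by positivity
  have hx0 : 0 < x := Real.rpow_pos_of_pos hnε _
  have hxr : x ^ r * (n * ε) = 1 := by
    rw [hx, ← Real.rpow_natCast, ← Real.rpow_mul hnε.le]
    have : -(1 / (r : ℝ)) * r = -1 := by field_simp
    rw [this, Real.rpow_neg_one]
    field_simp
  have e : (n : ℝ) ^ (2 - 1 / (r : ℝ)) * ε ^ (-(1 / (r : ℝ))) = n ^ 2 * x := by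
    rw [hx, Real.mul_rpow hn'.le h0.le, sub_eq_add_neg, Real.rpow_add hn']
    norm_cast
    ring
  -- With c = M (nε)^(-1/r) the two terms stand in the ratio (1 - 1/r) : 1/r and add up to the
  -- Hölder bound.
  refine ⟨Mconst n r * x, by positivity, ?_⟩
  have e2 : ((Mconst n r * x) ^ (r - 1))⁻¹ * Mconst n r ^ r = Mconst n r * x * (n * ε) := by
    have h1 : Mconst n r ^ r = Mconst n r ^ (r - 1) * Mconst n r := by
      rw [← pow_succ]; congr 1; omega
    have h2 : x ^ (r - 1) * (x * (n * ε)) = 1 := by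
      rw [← hxr, ← mul_assoc, ← pow_succ]; congr 2; omega
    rw [mul_pow, h1, inv_mul_eq_div, div_eq_iff (by positivity)]
    linear_combination -(Mconst n r ^ (r - 1) * Mconst n r) * h2
  rw [e]
  have e3 : 2 * n * (1 / r * ((Mconst n r * x) ^ (r - 1))⁻¹) * Mconst n r ^ r =
      2 * n * (1 / r) * (((Mconst n r * x) ^ (r - 1))⁻¹ * Mconst n r ^ r) := by ring
  rw [e3, e2]
  ring

theorem quadVar_div (hn : 1 ≤ n) (h0 : 0 < ε) : quadVar n ε / (2 * ε) =
    1 / ε * heavyTrafficConst n - (1 - ε / 2) * ((n : ℝ) - 2 + 1 / n) + 1 / 2 := by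
  have hn' : (n : ℝ) ≠ 0 := by positivity
  rw [quadVar, heavyTrafficConst]
  field_simp
  ring

/-- With U the total unused service, U ≤ quad u ≤ 2U gives the coefficients -1 and 2 for the two
signs. After division by 2ε the true errors contain only one Y; the constants `B₁` and `B₂` leave
room. -/
theorem meanTotal_bounds (hn : 1 ≤ n) (h0 : 0 < ε) (h2 : ε ≤ 1 / (2 * (n : ℝ)))
    (hπ : IsStationary (step ε (maxWeight n)) π) (hr : 2 ≤ r) :
    1 / ε * heavyTrafficConst n - B₁ n r ε ≤ (meanTotal π).toReal ∧
      (meanTotal π).toReal ≤ 1 / ε * heavyTrafficConst n + B₂ n r ε := by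
  have hn' : (1 : ℝ) ≤ n := by exact_mod_cast hn
  have h1 : ε < 1 := h2.trans_lt (by rw [div_lt_one (by linarith)]; linarith)
  obtain ⟨c, hc, hcY⟩ := exists_weight hn h0 hr
  set Y := (n : ℝ) ^ (2 - 1 / (r : ℝ)) * ε ^ (-(1 / (r : ℝ))) * Mconst n r with hY
  have hY0 : 0 ≤ Y := by
    have := Mconst_nonneg n r
    positivity
  have up := stationary_quad_le hn h0 h1 h2 hπ hc hr (sgn := 1) (k := -1) (by simp)
    (fun q a σ => by linarith [(quad_unused_bounds q a σ hn).1])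
  have lo := stationary_quad_le hn h0 h1 h2 hπ hc hr (sgn := -1) (k := 2) (by simp)
    (fun q a σ => by linarith [(quad_unused_bounds q a σ hn).2])
  have hq : quadVar n ε = 2 * ε * (quadVar n ε / (2 * ε)) := by field_simp
  rw [hq, quadVar_div hn h0] at up lo
  have hε2 : 0 < 2 * ε := by linarith
  set H := 1 / ε * heavyTrafficConst n - (1 - ε / 2) * ((n : ℝ) - 2 + 1 / n) with hH
  have up' : 2 * ε * (meanTotal π).toReal ≤ 2 * ε * (H + 1 / 2 - n / 2 + Y) := by
    linarith
  have lo' : 2 * ε * (H + 1 / 2 - n - Y) ≤ 2 * ε * (meanTotal π).toReal := by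
    linarith
  have up'' := le_of_mul_le_mul_left up' hε2
  have lo'' := le_of_mul_le_mul_left lo' hε2
  have e1 : B₁ n r ε = (1 - ε / 2) * ((n : ℝ) - 2 + 1 / n) + n - 1 / 2 + 3 * Y := by
    rw [B₁, hY]; ring
  have e2 : B₂ n r ε = -(1 - ε / 2) * ((n : ℝ) - 2 + 1 / n) + (n + 1) / 2 + 2 * Y := by
    rw [B₂, hY]; ring
  rw [e1, e2]
  constructor <;> linarith

end

/-! ## Asymptotics -/

theorem tendsto_rpow_nhdsGT_zero {r : ℕ} (hr : 2 ≤ r) :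
    Tendsto (fun ε : ℝ => ε * ε ^ (-(1 / (r : ℝ)))) (𝓝[>] 0) (𝓝 0) := by
  have hr' : (2 : ℝ) ≤ r := by exact_mod_cast hr
  have h1 : 0 < 1 - 1 / (r : ℝ) := by
    rw [sub_pos, div_lt_one (by linarith)]; linarith
  have h := (Real.continuousAt_rpow_const 0 (1 - 1 / (r : ℝ)) (Or.inr h1.le)).tendsto
  rw [Real.zero_rpow h1.ne'] at h
  refine (h.mono_left nhdsWithin_le_nhds).congr' ?_
  filter_upwards [self_mem_nhdsWithin] with ε hε
  rw [sub_eq_add_neg, Real.rpow_add hε, Real.rpow_one]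

theorem tendsto_mul_affine (r : ℕ) (hr : 2 ≤ r) (u v w : ℝ) :
    Tendsto (fun ε : ℝ => ε * (u + v * ε + w * ε ^ (-(1 / (r : ℝ))))) (𝓝[>] 0) (𝓝 0) := by
  have h1 : Tendsto (fun ε : ℝ => ε) (𝓝[>] 0) (𝓝 0) := nhdsWithin_le_nhds
  have h := ((h1.mul_const u).add ((h1.mul h1).mul_const v)).add
    ((tendsto_rpow_nhdsGT_zero hr).mul_const w)
  simp only [zero_mul, add_zero] at h
  exact h.congr fun ε => by ring

theorem tendsto_mul_B₁ (n : ℕ) {r : ℕ} (hr : 2 ≤ r) :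
    Tendsto (fun ε : ℝ => ε * B₁ n r ε) (𝓝[>] 0) (𝓝 0) := by
  refine (tendsto_mul_affine r hr ((n : ℝ) - 2 + 1 / n + n - 1 / 2)
    (-(1 / 2) * ((n : ℝ) - 2 + 1 / n))
    (3 * (n : ℝ) ^ (2 - 1 / (r : ℝ)) * Mconst n r)).congr fun ε => ?_
  rw [B₁]; ring

theorem tendsto_mul_B₂ (n : ℕ) {r : ℕ} (hr : 2 ≤ r) :
    Tendsto (fun ε : ℝ => ε * B₂ n r ε) (𝓝[>] 0) (𝓝 0) := by
  refine (tendsto_mul_affine r hr (-((n : ℝ) - 2 + 1 / n) + (n + 1) / 2)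
    (1 / 2 * ((n : ℝ) - 2 + 1 / n))
    (2 * (n : ℝ) ^ (2 - 1 / (r : ℝ)) * Mconst n r)).congr fun ε => ?_
  rw [B₂]; ring

theorem isLittleO_one_div {f : ℝ → ℝ} (h : Tendsto (fun ε : ℝ => ε * f ε) (𝓝[>] 0) (𝓝 0)) :
    f =o[𝓝[>] 0] fun ε : ℝ => 1 / ε := by
  rw [isLittleO_iff_tendsto']
  · refine h.congr fun ε => ?_
    rw [div_div_eq_mul_div, div_one, mul_comm]
  · filter_upwards [self_mem_nhdsWithin] with ε hε h'
    exact absurd h' (one_div_ne_zero (ne_of_gt hε))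

/-- A squeeze with r = 2; any fixed r ≥ 2 makes ε · ε^(-1/r) vanish. -/
theorem tendsto_mul_meanTotal (hn : 1 ≤ n) {π : ℝ → PMF (State n)}
    (hπ : ∀ ε : ℝ, 0 < ε → ε < 1 → IsStationary (step ε (maxWeight n)) (π ε)) :
    Tendsto (fun ε : ℝ => ε * (meanTotal (π ε)).toReal) (𝓝[>] 0)
      (𝓝 (heavyTrafficConst n)) := by
  have hn' : (1 : ℝ) ≤ n := by exact_mod_cast hn
  have hn2 : 0 < 1 / (2 * (n : ℝ)) := by positivity
  have ev : ∀ᶠ ε : ℝ in 𝓝[>] 0, 0 < ε ∧ ε ≤ 1 / (2 * (n : ℝ)) :=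
    Ioc_mem_nhdsGT hn2
  have bounds : ∀ ε : ℝ, 0 < ε ∧ ε ≤ 1 / (2 * (n : ℝ)) →
      heavyTrafficConst n - ε * B₁ n 2 ε ≤ ε * (meanTotal (π ε)).toReal ∧
        ε * (meanTotal (π ε)).toReal ≤ heavyTrafficConst n + ε * B₂ n 2 ε := by
    rintro ε ⟨h0, h2⟩
    have h1 : ε < 1 := h2.trans_lt (by rw [div_lt_one (by linarith)]; linarith)
    obtain ⟨lo, up⟩ := meanTotal_bounds hn h0 h2 (hπ ε h0 h1) le_rfl
    have e : ε * (1 / ε * heavyTrafficConst n) = heavyTrafficConst n := by field_simp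
    have lo' := mul_le_mul_of_nonneg_left lo h0.le
    have up' := mul_le_mul_of_nonneg_left up h0.le
    rw [mul_sub, e] at lo'
    rw [mul_add, e] at up'
    exact ⟨lo', up'⟩
  refine tendsto_of_tendsto_of_tendsto_of_le_of_le'
    (g := fun ε => heavyTrafficConst n - ε * B₁ n 2 ε)
    (h := fun ε => heavyTrafficConst n + ε * B₂ n 2 ε) ?_ ?_
    (ev.mono fun ε hε => (bounds ε hε).1) (ev.mono fun ε hε => (bounds ε hε).2)
  · simpa using (tendsto_mul_B₁ n le_rfl).const_sub (heavyTrafficConst n)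
  · simpa using (tendsto_mul_B₂ n le_rfl).const_add (heavyTrafficConst n)

theorem le_liminf_mul_meanTotal (hn : 1 ≤ n) {P : Policy n} {π : ℝ → PMF (State n)}
    (hπ : ∀ ε : ℝ, 0 < ε → ε < 1 → IsStationary (step ε P) (π ε)) :
    ENNReal.ofReal (((n : ℝ) - 1) / 2) ≤
      liminf (fun ε : ℝ => ENNReal.ofReal ε * meanTotal (π ε)) (𝓝[>] 0) := by
  have lim : Tendsto (fun ε : ℝ => ENNReal.ofReal ((1 - ε) ^ 2 * (((n : ℝ) - 1) / 2))) (𝓝[>] 0)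
      (𝓝 (ENNReal.ofReal (((n : ℝ) - 1) / 2))) := by
    refine ENNReal.tendsto_ofReal ?_
    have h : Continuous fun ε : ℝ => (1 - ε) ^ 2 * (((n : ℝ) - 1) / 2) := by fun_prop
    simpa using (h.tendsto 0).mono_left (nhdsWithin_le_nhds (s := Set.Ioi 0))
  rw [← lim.liminf_eq]
  refine liminf_le_liminf ?_
  filter_upwards [Ioo_mem_nhdsGT one_pos] with ε hε
  have h := le_meanTotal hn hε.1 hε.2 (hπ ε hε.1 hε.2)
  have h' := mul_le_mul_right h (ENNReal.ofReal ε)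
  rw [← ENNReal.ofReal_mul hε.1.le] at h'
  refine le_trans (le_of_eq ?_) h'
  congr 1
  have := hε.1.ne'
  field_simp

theorem heavyTrafficConst_le (hn : 1 ≤ n) : heavyTrafficConst n ≤ n - 1 := by
  have hn' : (1 : ℝ) ≤ n := by exact_mod_cast hn
  have : 1 / (2 * (n : ℝ)) ≤ 1 / 2 := one_div_le_one_div_of_le two_pos (by linarith)
  rw [heavyTrafficConst]; linarith

theorem heavyTrafficConst_lt (hn : 2 ≤ n) : heavyTrafficConst n < n - 1 := by
  have hn' : (2 : ℝ) ≤ n := by exact_mod_cast hn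
  have : 1 / (2 * (n : ℝ)) < 1 / 2 := one_div_lt_one_div_of_lt two_pos (by linarith)
  rw [heavyTrafficConst]; linarith

end HeavyTraffic

end Switch

/-! ### Assembly of the statements -/

theorem theorem2 (n : ℕ) (hn : 1 ≤ n) :
    -- Universal lower bound, under any policy.
    (∀ (P : Switch.Policy n) (ε : ℝ), 0 < ε → ε < 1 → ∀ μ₀ π : PMF (Switch.State n),
      Switch.IsStable (Switch.law (Switch.step ε P) μ₀) →
      Switch.ConvergesInDistribution (Switch.law (Switch.step ε P) μ₀) π →
      ENNReal.ofReal ((1 - ε) ^ 2 / (2 * ε) * ((n : ℝ) - 1)) ≤ Switch.meanTotal π) ∧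
    -- Its heavy-traffic limit, and the comparison with the limit under MaxWeight.
    (∀ (P : Switch.Policy n) (μ₀ π : ℝ → PMF (Switch.State n)),
      (∀ ε : ℝ, 0 < ε → ε < 1 →
        Switch.IsStable (Switch.law (Switch.step ε P) (μ₀ ε)) ∧
        Switch.ConvergesInDistribution (Switch.law (Switch.step ε P) (μ₀ ε)) (π ε)) →
      ENNReal.ofReal (((n : ℝ) - 1) / 2) ≤
        liminf (fun ε : ℝ => ENNReal.ofReal ε * Switch.meanTotal (π ε)) (𝓝[>] 0) ∧
      ENNReal.ofReal (Switch.heavyTrafficConst n) ≤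
        2 * liminf (fun ε : ℝ => ENNReal.ofReal ε * Switch.meanTotal (π ε)) (𝓝[>] 0) ∧
      (2 ≤ n → ENNReal.ofReal (Switch.heavyTrafficConst n) <
        2 * liminf (fun ε : ℝ => ENNReal.ofReal ε * Switch.meanTotal (π ε)) (𝓝[>] 0))) ∧
    -- MaxWeight.
    (∃ π : ℝ → PMF (Switch.State n),
      -- positive recurrence and convergence to the steady state
      (∀ ε : ℝ, 0 < ε → ε < 1 →
        Switch.IsPositiveRecurrentFrom (Switch.step ε (Switch.maxWeight n)) 0 ∧
        Switch.IsStationary (Switch.step ε (Switch.maxWeight n)) (π ε) ∧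
        ∀ μ₀ : PMF (Switch.State n), Switch.ConvergesInDistribution
          (Switch.law (Switch.step ε (Switch.maxWeight n)) μ₀) (π ε)) ∧
      -- state space collapse
      (∀ ε : ℝ, 0 < ε → ε ≤ 1 / (2 * (n : ℝ)) → ∀ r : ℕ, 1 ≤ r →
        Integrable (fun q => ‖Switch.perp (Switch.toVec q)‖ ^ r) (π ε).toMeasure ∧
        ∫ q, ‖Switch.perp (Switch.toVec q)‖ ^ r ∂(π ε).toMeasure ≤ Switch.Mconst n r ^ r) ∧
      -- bounds on the mean total queue length
      (∀ ε : ℝ, 0 < ε → ε ≤ 1 / (2 * (n : ℝ)) →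
        Switch.meanTotal (π ε) ≠ ∞ ∧
        ∀ r : ℕ, 2 ≤ r →
          1 / ε * Switch.heavyTrafficConst n - Switch.B₁ n r ε ≤
            (Switch.meanTotal (π ε)).toReal ∧
          (Switch.meanTotal (π ε)).toReal ≤
            1 / ε * Switch.heavyTrafficConst n + Switch.B₂ n r ε) ∧
      -- the heavy-traffic limit
      Tendsto (fun ε : ℝ => ε * (Switch.meanTotal (π ε)).toReal) (𝓝[>] 0)
        (𝓝 (Switch.heavyTrafficConst n))) ∧
    -- The error terms are of lower order.
    (∀ r : ℕ, 2 ≤ r →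
      (fun ε : ℝ => Switch.B₁ n r ε) =o[𝓝[>] 0] (fun ε : ℝ => 1 / ε) ∧
      (fun ε : ℝ => Switch.B₂ n r ε) =o[𝓝[>] 0] (fun ε : ℝ => 1 / ε)) := by
  have two_mul_liminf : ∀ (P : Switch.Policy n) (π : ℝ → PMF (Switch.State n)),
      (∀ ε : ℝ, 0 < ε → ε < 1 → Switch.IsStationary (Switch.step ε P) (π ε)) →
      ENNReal.ofReal ((n : ℝ) - 1) ≤
        2 * liminf (fun ε : ℝ => ENNReal.ofReal ε * Switch.meanTotal (π ε)) (𝓝[>] 0) := by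
    intro P π h
    have h1 := mul_le_mul_right (Switch.le_liminf_mul_meanTotal hn h) 2
    refine le_trans (le_of_eq ?_) h1
    rw [← ENNReal.ofReal_ofNat 2, ← ENNReal.ofReal_mul (by norm_num)]
    congr 1
    ring
  refine ⟨fun P ε h0 h1 μ₀ π _ hπ => Switch.le_meanTotal hn h0 h1
      (Switch.isStationary_of_tendsto hπ.tendsto_apply), fun P μ₀ π h => ?_, ?_,
    fun r hr => ⟨Switch.isLittleO_one_div (Switch.tendsto_mul_B₁ n hr),
      Switch.isLittleO_one_div (Switch.tendsto_mul_B₂ n hr)⟩⟩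
  · have hπ : ∀ ε : ℝ, 0 < ε → ε < 1 → Switch.IsStationary (Switch.step ε P) (π ε) :=
      fun ε h0 h1 => Switch.isStationary_of_tendsto (h ε h0 h1).2.tendsto_apply
    refine ⟨Switch.le_liminf_mul_meanTotal hn hπ, ?_, fun hn2 => ?_⟩
    · exact (ENNReal.ofReal_le_ofReal (Switch.heavyTrafficConst_le hn)).trans
        (two_mul_liminf P π hπ)
    · refine lt_of_lt_of_le ?_ (two_mul_liminf P π hπ)
      have : (2 : ℝ) ≤ n := by exact_mod_cast hn2
      exact (ENNReal.ofReal_lt_ofReal_iff (by linarith)).2 (Switch.heavyTrafficConst_lt hn2)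
  · have hex : ∀ ε : ℝ, ∃ π : PMF (Switch.State n), 0 < ε → ε < 1 →
        Switch.IsPositiveRecurrentFrom (Switch.step ε (Switch.maxWeight n)) 0 ∧
        Switch.IsStationary (Switch.step ε (Switch.maxWeight n)) π ∧
        ∀ μ₀ : PMF (Switch.State n), Switch.ConvergesInDistribution
          (Switch.law (Switch.step ε (Switch.maxWeight n)) μ₀) π := fun ε => by
      by_cases h : 0 < ε ∧ ε < 1
      · obtain ⟨π, hπ⟩ := Switch.exists_stationary_maxWeight hn h.1 h.2
        exact ⟨π, fun _ _ => hπ⟩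
      · exact ⟨PMF.pure 0, fun h0 h1 => absurd ⟨h0, h1⟩ h⟩
    choose π hπ using hex
    have lt_one : ∀ ε : ℝ, ε ≤ 1 / (2 * (n : ℝ)) → ε < 1 := fun ε h => by
      have hn' : (1 : ℝ) ≤ n := by exact_mod_cast hn
      exact h.trans_lt (by rw [div_lt_one (by linarith)]; linarith)
    refine ⟨π, hπ, fun ε h0 h2 r hr =>
        Switch.integral_perp_pow_le hn h0 h2 (hπ ε h0 (lt_one ε h2)).2.1 hr,
      fun ε h0 h2 => ⟨?_, fun r hr =>
        Switch.meanTotal_bounds hn h0 h2 (hπ ε h0 (lt_one ε h2)).2.1 hr⟩,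
      Switch.tendsto_mul_meanTotal hn fun ε h0 h1 => (hπ ε h0 h1).2.1⟩
    exact Switch.meanTotal_ne_top
      (Switch.integrable_norm_pow hn h0 (lt_one ε h2) (hπ ε h0 (lt_one ε h2)).2.1 1)
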